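/- **Setting.** Let $T\ge 1$, let $S=\bigcup_{l=1}^{s}\{-(M_l+N_l),\dots,-M_l\}$ be a finite set of negative integers, $S^+=-S$, $Z^S=\{1,2,\dots\}\setminus S^+$, $\mathbb Z_-=\{-1,-2,\dots\}$, $U=S\cup\{0,1,2,\dots\}$. Let $\vec a(j)\in\mathbb C^T$ with $\sum_{j\in Z^S}\sum_k|a_k(j)|<\infty$, put $\vec a(j)=\vec 0$ for $j\notin Z^S$, and $A(e^{i\lambda})=\sum_{j\in Z^S}\vec a(j)e^{-ij\lambda}$. A spectral density is an integrable function on $[-\pi,\pi)$ whose values are positive semidefinite Hermitian $T\times T$ matrices. For spectral densities $F$ (of $\vec\xi$) and $G$ (of the uncorrelated noise $\vec\eta$) let $L_2(F+G)$ be the space of $h$ with $\int h^\top(F+G)\overline h\,d\lambda<\infty$, and $L_2^s(F+G)$ its closed subspace generated by $e^{in\lambda}\delta_k$, $n\in\mathbb Z_-\setminus S$, $k=1,\dots,T$. The mean square error of the linear estimate of $A\vec\xi=\sum_{j\in Z^S}\vec a(j)^\top\vec\xi(-j)$ from $\vec\xi(j)+\vec\eta(j)$, $j\in\mathbb Z_-\setminus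 S$, with spectral characteristic $h\in L_2^s(F+G)$ is $$\Delta(h;F,G)=\frac1{2\pi}\int_{-\pi}^{\pi}(A-h)^\top F\,\overline{(A-h)}\,d\lambda+\frac1{2\pi}\int_{-\pi}^{\pi}h^\top G\,\overline h\,d\lambda ,$$ $h(F,G)$ denotes the minimizer of $\Delta(\cdot\,;F,G)$ over $L_2^s(F+G)$, and $\Delta(F,G)=\Delta(h(F,G);F,G)$. **Operators.** Minimality of $(F,G)$ means that $F+G$ is invertible a.e. and $\int_{-\pi}^{\pi}(F+G)^{-1}d\lambda<\infty$. For such pairs let $$B(k,j)=\tfrac1{2\pi}\int(F+G)^{-1}e^{-i(k-j)\lambda}d\lambda,\quad R(k,j)=\tfrac1{2\pi}\int F(F+G)^{-1}e^{-i(k+j)\lambda}d\lambda,\quad Q(k,j)=\tfrac1{2\pi}\int F(F+G)^{-1}G\,e^{-i(k-j)\lambda}d\lambda .$$ These act on sequences of row vectors: $(\mathbf B\mathbf c)(k)^\top=\sum_{j\in U}\vec c(j)^\top B(k,j)$, $(\mathbf R\mathbf a)(k)^\top=\sum_{j}\vec a(j)^\top R(k,j)$ for $k\in U$, $\langle\mathbf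 Q\mathbf a,\mathbf a\rangle=\sum_{j,k}\vec a(j)^\top Q(j,k)\overline{\vec a(k)}$, $\langle \mathbf x,\mathbf c\rangle=\sum_k\vec x(k)^\top\overline{\vec c(k)}$. The positive operator $\mathbf B$ on finitely supported sequences may be unbounded; it, the pairing $\langle\mathbf R\mathbf a,\cdot\rangle$ and $\mathbf c\mapsto C(e^{i\lambda})=\sum_{k\in U}\vec c(k)e^{ik\lambda}$ are extended by continuity in the norm $\langle\mathbf B\mathbf c,\mathbf c\rangle^{1/2}=\big(\frac1{2\pi}\int C^\top(F+G)^{-1}\overline C\,d\lambda\big)^{1/2}$, and $\mathbf B^{-1}\mathbf R\mathbf a$ is the solution $\mathbf c$ of $\mathbf B\mathbf c=\mathbf R\mathbf a$ so obtained. Write $C=\sum_{k\in U}(\mathbf B^{-1}\mathbf R\mathbf a)(k)e^{ik\lambda}$ and $r_F^\top=(A^\top F-C^\top)(F+G)^{-1}$. **Classes.** Let $V,U$ be given spectral densities (this $U$ is not the index set), $q,q_k\in\mathbb R$, $B_2,Q$ positive definite Hermitian matrices, $\langle B_2,G\rangle=\sum_{k,l}(B_2)_{kl}g_{kl}$. Consider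 the following sets of spectral densities $G$, with pointwise conditions understood a.e.: $D^1$: $\operatorname{Tr}V\le\operatorname{Tr}G\le\operatorname{Tr}U$, $\frac1{2\pi}\int\operatorname{Tr}G\,d\lambda=q$; $D^2$: $v_{kk}\le g_{kk}\le u_{kk}$, $\frac1{2\pi}\int g_{kk}\,d\lambda=q_k$ for $k=1,\dots,T$; $D^3$: $\langle B_2,V\rangle\le\langle B_2,G\rangle\le\langle B_2,U\rangle$, $\frac1{2\pi}\int\langle B_2,G\rangle d\lambda=q$; $D^4$: $V\le G\le U$ as Hermitian matrices, $\frac1{2\pi}\int G\,d\lambda=Q$. **Statement.** Let $F$ be a known spectral density, let $D$ be one of $D^1,\dots,D^4$, let $G^0\in D$, and suppose that $(F,G^0)$ satisfies the minimality condition. Suppose that $(F,G^0)$ solves the optimization problem $$\max_{G\in D}\ \langle\mathbf R\mathbf a,\mathbf B^{-1}\mathbf R\mathbf a\rangle+\langle\mathbf Q\mathbf a,\mathbf a\rangle$$ (over those $G\in D$ for which $(F,G)$ satisfies the minimality condition), and that, with $C$ formed for $(F,G^0)$ and $r^\top$ denoting either $r_F^\top$ or its numerator $A^\top F-C^\top$,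 the corresponding relation holds a.e.: (1) $(r^\top)^*r^\top=(\beta^2+\gamma_1+\gamma_2)(F+G^0)^2$, where $\beta\in\mathbb R$, $\gamma_1\le0$, $\gamma_1=0$ where $\operatorname{Tr}G^0>\operatorname{Tr}V$, $\gamma_2\ge0$, $\gamma_2=0$ where $\operatorname{Tr}G^0<\operatorname{Tr}U$; (2) $(r^\top)^*r^\top=(F+G^0)\{(\beta_k^2+\gamma_{1k}+\gamma_{2k})\delta_{kl}\}_{k,l=1}^T(F+G^0)$, where $\beta_k\in\mathbb R$, $\gamma_{1k}\le0$, $\gamma_{1k}=0$ where $g^0_{kk}>v_{kk}$, $\gamma_{2k}\ge0$, $\gamma_{2k}=0$ where $g^0_{kk}<u_{kk}$; (3) $(r^\top)^*r^\top=(\beta^2+\gamma_1'+\gamma_2')(F+G^0)B_2^\top(F+G^0)$, where $\beta\in\mathbb R$, $\gamma_1'\le0$, $\gamma_1'=0$ where $\langle B_2,G^0\rangle>\langle B_2,V\rangle$, $\gamma_2'\ge0$, $\gamma_2'=0$ where $\langle B_2,G^0\rangle<\langle B_2,U\rangle$; (4) $(r^\top)^*r^\top=(F+G^0)(\vec\beta\vec\beta^*+\Gamma_1+\Gamma_2)(F+G^0)$,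 where $\vec\beta\in\mathbb C^T$, $\Gamma_1\le0$, $\Gamma_1=0$ where $G^0>V$, $\Gamma_2\ge0$, $\Gamma_2=0$ where $G^0<U$ (Hermitian matrix-valued $\Gamma_1,\Gamma_2$; the order is that of Hermitian matrices, strict inequality meaning that the difference is positive definite). Then $G^0$ is least favorable in $D$: $\Delta(F,G)\le\Delta(F,G^0)$ for all $G\in D$. Moreover $\mathbf B^{-1}\mathbf R\mathbf a$ exists for $(F,G^0)$, and $$(h^0)^\top=A^\top F(F+G^0)^{-1}-\Big(\sum_{k\in U}(\mathbf B^{-1}\mathbf R\mathbf a)(k)e^{ik\lambda}\Big)^{\!\top}(F+G^0)^{-1}$$ is the optimal characteristic $h(F,G^0)$ and is minimax-robust: $h^0\in H_D=\bigcap_{G\in D}L_2^s(F+G)$, the maximum of $\Delta(h^0;F,G)$ over $G\in D$ is attained, and it equals $\min_{h\in H_D}\sup_{G\in D}\Delta(h;F,G)$. -/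

import Mathlib

open MeasureTheory Filter Topology
open scoped ENNReal Matrix ComplexOrder

noncomputable section

namespace Filtering

variable {T : ℕ}

/-- Normalised Lebesgue measure on one period: `∫ f ∂freq` is `1/(2π) ∫_{-π}^{π} f(θ) dθ`. -/
def freq : Measure ℝ :=
  ENNReal.ofReal (1 / (2 * Real.pi)) • volume.restrict (Set.Ioc (-Real.pi) Real.pi)

/-- Matrix-valued functions of the frequency. -/
abbrev MatFun (T : ℕ) := ℝ → Matrix (Fin T) (Fin T) ℂ

/-- Vector-valued functions of the frequency. -/
abbrev VecFun (T : ℕ) := ℝ → Fin T → ℂ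

/-- The character `e^{inθ}`. -/
def expChar (n : ℤ) (θ : ℝ) : ℂ := Complex.exp (Complex.I * n * θ)

/-! ### Spectral densities -/

/-- Spectral densities of `T`-dimensional stationary sequences: integrable functions whose values
are positive semidefinite Hermitian matrices. -/
structure IsSpectralDensity (F : MatFun T) : Prop where
  integrable : ∀ i j, Integrable (fun θ => F θ i j) freq
  posSemidef : ∀ᵐ θ ∂freq, (F θ).PosSemidef

/-- The minimality condition `∫ W(θ)⁻¹ dθ < ∞` (for `W = F + G`). -/
structure IsMinimal (W : MatFun T) : Prop where
  invertible : ∀ᵐ θ ∂freq, IsUnit (W θ).det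
  integrable : ∀ i j, Integrable (fun θ => (W θ)⁻¹ i j) freq

/-! ### Index sets and the functional -/

/-- The set `S` of the missing (negative) times: a union of `s` intervals. -/
def missing {s : ℕ} (M N : Fin s → ℕ) : Set ℤ :=
  ⋃ l, Set.Icc (-((M l : ℤ) + N l)) (-(M l : ℤ))

/-- The times `ℤ₋ \ S`, `ℤ₋ = {-1, -2, …}`, at which `ξ + η` is observed. -/
def observed (S : Set ℤ) : Set ℤ := {j | j < 0 ∧ j ∉ S}

/-- `U = S ∪ {0, 1, 2, …}`. -/
def unobserved (S : Set ℤ) : Set ℤ := S ∪ {j | 0 ≤ j}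

/-- `Z^S = {1, 2, …} \ S⁺`, where `S⁺ = -S`. -/
def target (S : Set ℤ) : Set ℤ := {j | 1 ≤ j ∧ -j ∉ S}

/-- The coefficients `a(j)`, set to `0` for `j ∉ Z^S`. -/
def coeff (S : Set ℤ) (a : ℤ → Fin T → ℂ) : ℤ → Fin T → ℂ := (target S).indicator a

/-- `∑_{j ∈ Z^S} ∑_k |a_k(j)| < ∞`. -/
def SummableCoeff (S : Set ℤ) (a : ℤ → Fin T → ℂ) : Prop :=
  Summable fun j => ∑ k, ‖coeff S a j k‖

/-- `A(e^{iθ}) = ∑_{j ∈ Z^S} a(j) e^{-ijθ}`. -/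
def symbolA (S : Set ℤ) (a : ℤ → Fin T → ℂ) : VecFun T :=
  fun θ => ∑' j, expChar (-j) θ • coeff S a j

/-! ### The spaces `L₂(W)`, `L₂ˢ(W)` and the mean square error -/

/-- `1/(2π) ∫ h(θ)ᵀ W(θ) conj(h(θ)) dθ`, as an extended nonnegative number. -/
def sqNorm (W : MatFun T) (h : VecFun T) : ℝ≥0∞ :=
  ∫⁻ θ, ENNReal.ofReal ((h θ ᵥ* W θ) ⬝ᵥ star (h θ)).re ∂freq

/-- `∑_k c(k) e^{ikθ}` for a finitely supported sequence `c`. -/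
def trigPoly (c : ℤ →₀ (Fin T → ℂ)) : VecFun T :=
  fun θ => c.sum fun k v => expChar k θ • v

/-- `h ∈ L₂(W)`. -/
def MemL2 (W : MatFun T) (h : VecFun T) : Prop :=
  AEStronglyMeasurable h freq ∧ sqNorm W h < ∞

/-- `h ∈ L₂ˢ(W)`: the closed subspace of `L₂(W)` generated by `e^{inθ} δ_k`, `n ∈ ℤ₋ \ S`. -/
def MemL2s (S : Set ℤ) (W : MatFun T) (h : VecFun T) : Prop :=
  MemL2 W h ∧ ∀ ε : ℝ≥0∞, 0 < ε →
    ∃ p : ℤ →₀ (Fin T → ℂ), (p.support : Set ℤ) ⊆ observed S ∧ sqNorm W (h - trigPoly p) < ε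

/-- The mean square error `Δ(h; F, G)` of the linear estimate with spectral characteristic `h`. -/
def mse (S : Set ℤ) (a : ℤ → Fin T → ℂ) (h : VecFun T) (F G : MatFun T) : ℝ≥0∞ :=
  sqNorm F (symbolA S a - h) + sqNorm G h

/-- `h = h(F, G)` is the spectral characteristic of the optimal linear estimate. -/
def IsOptimal (S : Set ℤ) (a : ℤ → Fin T → ℂ) (F G : MatFun T) (h : VecFun T) : Prop :=
  MemL2s S (F + G) h ∧ ∀ h', MemL2s S (F + G) h' → mse S a h F G ≤ mse S a h' F G

/-- `Δ(F, G) = Δ(h(F, G); F, G)`, the error of the optimal linear estimate. -/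
def optimalMse (S : Set ℤ) (a : ℤ → Fin T → ℂ) (F G : MatFun T) : ℝ≥0∞ :=
  ⨅ (h : VecFun T) (_ : MemL2s S (F + G) h), mse S a h F G

/-! ### Least favorable densities and minimax-robust characteristics -/

/-- `(F₀, G₀)` is least favorable in `D_F × D_G`. -/
def IsLeastFavorable (S : Set ℤ) (a : ℤ → Fin T → ℂ) (DF DG : Set (MatFun T))
    (F₀ G₀ : MatFun T) : Prop :=
  F₀ ∈ DF ∧ G₀ ∈ DG ∧ ∀ F ∈ DF, ∀ G ∈ DG, optimalMse S a F G ≤ optimalMse S a F₀ G₀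

/-- `h ∈ H_D`, the intersection of the `L₂ˢ(F + G)` over `(F, G) ∈ D_F × D_G`. -/
def MemHD (S : Set ℤ) (DF DG : Set (MatFun T)) (h : VecFun T) : Prop :=
  ∀ F ∈ DF, ∀ G ∈ DG, MemL2s S (F + G) h

/-- The largest error of `h` over `D_F × D_G`. -/
def worstMse (S : Set ℤ) (a : ℤ → Fin T → ℂ) (DF DG : Set (MatFun T)) (h : VecFun T) : ℝ≥0∞ :=
  ⨆ (F ∈ DF) (G ∈ DG), mse S a h F G

/-- `h₀` is a minimax-robust spectral characteristic for `D_F × D_G`: it lies in `H_D`, its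
largest error over `D_F × D_G` is attained, and it minimises the largest error over `H_D`. -/
structure IsMinimaxRobust (S : Set ℤ) (a : ℤ → Fin T → ℂ) (DF DG : Set (MatFun T))
    (h₀ : VecFun T) : Prop where
  mem : MemHD S DF DG h₀
  attained : ∃ F ∈ DF, ∃ G ∈ DG, mse S a h₀ F G = worstMse S a DF DG h₀
  minimal : ∀ h, MemHD S DF DG h → worstMse S a DF DG h₀ ≤ worstMse S a DF DG h

/-! ### The operators `B`, `R`, `Q`

The block matrices act on sequences of row vectors. -/

/-- The matrix `1/(2π) ∫ X(θ) e^{-inθ} dθ`. -/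
def fourierMat (X : MatFun T) (n : ℤ) : Matrix (Fin T) (Fin T) ℂ :=
  Matrix.of fun i j => ∫ θ, X θ i j * expChar (-n) θ ∂freq

/-- `B(k, j)`. -/
def matB (F G : MatFun T) (k j : ℤ) : Matrix (Fin T) (Fin T) ℂ :=
  fourierMat (fun θ => (F θ + G θ)⁻¹) (k - j)

/-- `R(k, j)`. -/
def matR (F G : MatFun T) (k j : ℤ) : Matrix (Fin T) (Fin T) ℂ :=
  fourierMat (fun θ => F θ * (F θ + G θ)⁻¹) (k + j)

/-- `Q(k, j)`. -/
def matQ (F G : MatFun T) (k j : ℤ) : Matrix (Fin T) (Fin T) ℂ :=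
  fourierMat (fun θ => F θ * (F θ + G θ)⁻¹ * G θ) (k - j)

/-- `(B c)(k)ᵀ = ∑_j c(j)ᵀ B(k, j)` for a finitely supported sequence `c`. -/
def opB (F G : MatFun T) (c : ℤ →₀ (Fin T → ℂ)) (k : ℤ) : Fin T → ℂ :=
  c.sum fun j v => v ᵥ* matB F G k j

/-- `(R a)(k)ᵀ = ∑_j a(j)ᵀ R(k, j)`. -/
def opRa (S : Set ℤ) (a : ℤ → Fin T → ℂ) (F G : MatFun T) (k : ℤ) : Fin T → ℂ :=
  ∑' j, coeff S a j ᵥ* matR F G k j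

/-- `⟨Q a, a⟩ = ∑_j ∑_k a(j)ᵀ Q(j, k) conj(a(k))`. -/
def formQ (S : Set ℤ) (a : ℤ → Fin T → ℂ) (F G : MatFun T) : ℂ :=
  ∑' j, ∑' k, (coeff S a j ᵥ* matQ F G j k) ⬝ᵥ star (coeff S a k)

/-- `⟨x, c⟩ = ∑_k x(k)ᵀ conj(c(k))` for a finitely supported `c`. -/
def pairing (x : ℤ → Fin T → ℂ) (c : ℤ →₀ (Fin T → ℂ)) : ℂ :=
  c.sum fun k v => x k ⬝ᵥ star v

/-- The finitely supported sequences `c n` on `U` exhibit `b` as `B⁻¹ R a` and the function `C` as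
`∑_{k ∈ U} b(k) e^{ikθ}`. Under the minimality condition alone `B` is in general an unbounded
positive operator; as usual it is extended from finitely supported sequences by continuity in the
norm `⟨B c, c⟩^{1/2} = (1/(2π) ∫ Cᵀ (F + G)⁻¹ conj(C))^{1/2}`. So `b` is the limit of the `c n` in
this norm (and coordinatewise), and `(B b)(k) = lim (B (c n))(k)` has to be `(R a)(k)` for all
`k ∈ U`. -/
structure Approximates (S : Set ℤ) (a : ℤ → Fin T → ℂ) (F G : MatFun T)
    (c : ℕ → ℤ →₀ (Fin T → ℂ)) (b : ℤ → Fin T → ℂ) (C : VecFun T) : Prop where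
  support : ∀ n, ((c n).support : Set ℤ) ⊆ unobserved S
  measurable : AEStronglyMeasurable C freq
  coord : ∀ k, Tendsto (fun n => c n k) atTop (𝓝 (b k))
  series : Tendsto (fun n => sqNorm (fun θ => (F θ + G θ)⁻¹) (trigPoly (c n) - C)) atTop (𝓝 0)
  solves : ∀ k ∈ unobserved S, Tendsto (fun n => opB F G (c n) k) atTop (𝓝 (opRa S a F G k))

/-- `b = B⁻¹ R a` and `C(θ) = ∑_{k ∈ U} b(k) e^{ikθ}`. -/
def IsInverseImage (S : Set ℤ) (a : ℤ → Fin T → ℂ) (F G : MatFun T)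
    (b : ℤ → Fin T → ℂ) (C : VecFun T) : Prop :=
  ∃ c, Approximates S a F G c b C

/-- `v = ⟨R a, B⁻¹ R a⟩ + ⟨Q a, a⟩`. -/
def IsOperatorValue (S : Set ℤ) (a : ℤ → Fin T → ℂ) (F G : MatFun T) (v : ℝ) : Prop :=
  ∃ c b C, Approximates S a F G c b C ∧ ∃ w : ℂ,
    Tendsto (fun n => pairing (opRa S a F G) (c n)) atTop (𝓝 w) ∧ (v : ℂ) = w + formQ S a F G

/-- `(F₀, G₀)` solves the problem of maximising `⟨R a, B⁻¹ R a⟩ + ⟨Q a, a⟩` over the pairs in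
`D_F × D_G` (those that satisfy the minimality condition, which the operators presuppose). -/
def SolvesExtremal (S : Set ℤ) (a : ℤ → Fin T → ℂ) (DF DG : Set (MatFun T))
    (F₀ G₀ : MatFun T) : Prop :=
  F₀ ∈ DF ∧ G₀ ∈ DG ∧ ∃ v₀, IsOperatorValue S a F₀ G₀ v₀ ∧
    ∀ F ∈ DF, ∀ G ∈ DG, IsMinimal (F + G) → ∀ v, IsOperatorValue S a F G v → v ≤ v₀

/-- `Aᵀ F - Cᵀ`, the numerator of `r_F`. -/
def numF (S : Set ℤ) (a : ℤ → Fin T → ℂ) (F : MatFun T) (C : VecFun T) : VecFun T :=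
  fun θ => symbolA S a θ ᵥ* F θ - C θ

/-- `r_F`, given by `r_Fᵀ = (Aᵀ F - Cᵀ) (F + G)⁻¹`. -/
def rF (S : Set ℤ) (a : ℤ → Fin T → ℂ) (F G : MatFun T) (C : VecFun T) : VecFun T :=
  fun θ => numF S a F C θ ᵥ* (F θ + G θ)⁻¹

/-- The spectral characteristic `hᵀ = Aᵀ F (F + G)⁻¹ - Cᵀ (F + G)⁻¹`, where
`C = ∑_{k ∈ U} (B⁻¹ R a)(k) e^{ikθ}`. -/
def charFormula (S : Set ℤ) (a : ℤ → Fin T → ℂ) (F G : MatFun T) (C : VecFun T) : VecFun T :=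
  fun θ => symbolA S a θ ᵥ* (F θ * (F θ + G θ)⁻¹) - C θ ᵥ* (F θ + G θ)⁻¹

/-! ### The band classes -/

/-- `⟨B, X⟩ = ∑_{k,l} b_{kl} x_{kl}` (a real number for Hermitian matrices). -/
def bracket (B X : Matrix (Fin T) (Fin T) ℂ) : ℝ := (∑ k, ∑ l, B k l * X k l).re

/-- First band class. -/
def band1 (V U : MatFun T) (q : ℝ) : Set (MatFun T) :=
  {G | IsSpectralDensity G ∧
    (∀ᵐ θ ∂freq, (V θ).trace.re ≤ (G θ).trace.re ∧ (G θ).trace.re ≤ (U θ).trace.re) ∧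
    ∫ θ, (G θ).trace.re ∂freq = q}

/-- Second band class. -/
def band2 (V U : MatFun T) (q : Fin T → ℝ) : Set (MatFun T) :=
  {G | IsSpectralDensity G ∧ ∀ k,
    (∀ᵐ θ ∂freq, (V θ k k).re ≤ (G θ k k).re ∧ (G θ k k).re ≤ (U θ k k).re) ∧
    ∫ θ, (G θ k k).re ∂freq = q k}

/-- Third band class. -/
def band3 (V U : MatFun T) (B : Matrix (Fin T) (Fin T) ℂ) (q : ℝ) : Set (MatFun T) :=
  {G | IsSpectralDensity G ∧
    (∀ᵐ θ ∂freq, bracket B (V θ) ≤ bracket B (G θ) ∧ bracket B (G θ) ≤ bracket B (U θ)) ∧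
    ∫ θ, bracket B (G θ) ∂freq = q}

/-- Fourth band class; the inequalities are those of Hermitian matrices. -/
def band4 (V U : MatFun T) (Q : Matrix (Fin T) (Fin T) ℂ) : Set (MatFun T) :=
  {G | IsSpectralDensity G ∧
    (∀ᵐ θ ∂freq, (G θ - V θ).PosSemidef ∧ (U θ - G θ).PosSemidef) ∧
    ∀ i j, ∫ θ, G θ i j ∂freq = Q i j}

/-! ### The relations for the band classes

`Matrix.vecMulVec (star v) v` is the matrix `(v^T)^* v^T`. -/

/-- Relation for the first class. -/
def Relation1 (F G₀ V U : MatFun T) (r : VecFun T) : Prop :=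
  ∃ (β : ℝ) (γ₁ γ₂ : ℝ → ℝ), ∀ᵐ θ ∂freq,
    Matrix.vecMulVec (star (r θ)) (r θ)
      = ((β ^ 2 + γ₁ θ + γ₂ θ : ℝ) : ℂ) • (F θ + G₀ θ) ^ 2 ∧
    γ₁ θ ≤ 0 ∧ ((V θ).trace.re < (G₀ θ).trace.re → γ₁ θ = 0) ∧
    0 ≤ γ₂ θ ∧ ((G₀ θ).trace.re < (U θ).trace.re → γ₂ θ = 0)

/-- Relation for the second class. -/
def Relation2 (F G₀ V U : MatFun T) (r : VecFun T) : Prop :=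
  ∃ (β : Fin T → ℝ) (γ₁ γ₂ : Fin T → ℝ → ℝ), ∀ᵐ θ ∂freq,
    Matrix.vecMulVec (star (r θ)) (r θ)
      = (F θ + G₀ θ) *
        Matrix.diagonal (fun k => ((β k ^ 2 + γ₁ k θ + γ₂ k θ : ℝ) : ℂ)) * (F θ + G₀ θ) ∧
    ∀ k, γ₁ k θ ≤ 0 ∧ ((V θ k k).re < (G₀ θ k k).re → γ₁ k θ = 0) ∧
      0 ≤ γ₂ k θ ∧ ((G₀ θ k k).re < (U θ k k).re → γ₂ k θ = 0)

/-- Relation for the third class. -/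
def Relation3 (F G₀ V U : MatFun T) (B : Matrix (Fin T) (Fin T) ℂ) (r : VecFun T) : Prop :=
  ∃ (β : ℝ) (γ₁ γ₂ : ℝ → ℝ), ∀ᵐ θ ∂freq,
    Matrix.vecMulVec (star (r θ)) (r θ)
      = ((β ^ 2 + γ₁ θ + γ₂ θ : ℝ) : ℂ) • ((F θ + G₀ θ) * Bᵀ * (F θ + G₀ θ)) ∧
    γ₁ θ ≤ 0 ∧ (bracket B (V θ) < bracket B (G₀ θ) → γ₁ θ = 0) ∧
    0 ≤ γ₂ θ ∧ (bracket B (G₀ θ) < bracket B (U θ) → γ₂ θ = 0)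

/-- Relation for the fourth class. -/
def Relation4 (F G₀ V U : MatFun T) (r : VecFun T) : Prop :=
  ∃ (β : Fin T → ℂ) (Γ₁ Γ₂ : MatFun T), ∀ᵐ θ ∂freq,
    Matrix.vecMulVec (star (r θ)) (r θ)
      = (F θ + G₀ θ) * (Matrix.vecMulVec β (star β) + Γ₁ θ + Γ₂ θ) * (F θ + G₀ θ) ∧
    (-Γ₁ θ).PosSemidef ∧ ((G₀ θ - V θ).PosDef → Γ₁ θ = 0) ∧
    (Γ₂ θ).PosSemidef ∧ ((U θ - G₀ θ).PosDef → Γ₂ θ = 0)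

/-- A relation `P` holds at `(F, G₀)` for `r_F` in one of its two normalisations: `r_F` itself,
or its numerator `Aᵀ F - Cᵀ`. -/
def Satisfies (S : Set ℤ) (a : ℤ → Fin T → ℂ) (F G₀ : MatFun T) (P : VecFun T → Prop) : Prop :=
  ∃ b C, IsInverseImage S a F G₀ b C ∧ (P (rF S a F G₀ C) ∨ P (numF S a F C))

/-- The conclusion for a known `F` and a class `D` of densities: `G₀` is least favorable in `D`,
and the formula for the spectral characteristic at `(F, G₀)` makes sense and gives the optimal
characteristic `h(F, G₀)`, which is minimax-robust. -/
structure MinimaxSolution (S : Set ℤ) (a : ℤ → Fin T → ℂ) (F : MatFun T) (D : Set (MatFun T))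
    (G₀ : MatFun T) : Prop where
  leastFavorable : IsLeastFavorable S a {F} D F G₀
  exists_inverse : ∃ b C, IsInverseImage S a F G₀ b C
  optimal : ∀ b C, IsInverseImage S a F G₀ b C → IsOptimal S a F G₀ (charFormula S a F G₀ C)
  minimax : ∀ b C, IsInverseImage S a F G₀ b C →
    IsMinimaxRobust S a {F} D (charFormula S a F G₀ C)

end Filtering

end

open Filtering

/-! For a fixed characteristic `h` the error `Δ(h; F, G)` is affine in `G`, so the optimal error is
an infimum of affine functions and hence concave in `G`. The band classes are convex. At a maximiser
`G₀` with optimal characteristic `h₀`, this should give the saddle point inequality `Δ(h₀; F, G) ≤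
Δ(h₀; F, G₀)` for all `G ∈ D`, from which least favorability and minimax robustness are immediate.

The obstacle is that `F + G` need not be minimal for `G ∈ D`: the maximum compares `G₀` with minimal
pairs only, and it is not clear beforehand that `h₀ ∈ L₂ˢ(F + G)`. In `memL2s_and_mse_le` one
therefore moves along `G_t = (1 - t) G₀ + t G` with `0 < t < 1`, where `F + G_t ≥ (1 - t)(F + G₀)`
is minimal. Let `h_t` be optimal at `G_t`. Its error there is at most the error `Δ` at `G₀`, while
its error at `G₀` is at least `Δ`; so its error at `G` is at most `Δ`. By Pythagoras the errors at
`G` increase as `t → 0`, and their increments bound the squared distances in `L₂(F + G)`. Thus the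
`h_t` are Cauchy there, while they tend to `h₀` in `L₂(F + G₀)`; an almost everywhere convergent
subsequence shows that the two limits agree.

The operators are translated into frequency language with `W = F + G`. The vector `B⁻¹ R a` is the
coefficient sequence of the residual `C = Aᵀ F - hᵀ W` in `L₂(W⁻¹)`, where `h` is the projection of
`Aᵀ F W⁻¹` onto `L₂ˢ(W)`; the operator expression is then the optimal error (`Approximates.value`).
This needs `L₂ˢ(W)` to consist of all elements of `L₂(W)` without frequencies in `U` (`memL2s_iff`),
and the dual statement for `C`. Both reduce to `integral_dotProduct_star_eq_zero`: integrable
functions with complementary frequencies are orthogonal once their product is integrable. Parseval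
is not available for integrable functions, so they are first multiplied by outer functions of Szegő
type (`exists_outer`), which make them square integrable without raising frequencies. -/

noncomputable section

namespace Filtering

variable {T : ℕ}

/-! ### The sesquilinear form of a matrix -/

/-- The sesquilinear form `xᵀ M conj(y)`. -/
def form (M : Matrix (Fin T) (Fin T) ℂ) (x y : Fin T → ℂ) : ℂ := (x ᵥ* M) ⬝ᵥ star y

section form

variable (M N : Matrix (Fin T) (Fin T) ℂ) (x x' y y' : Fin T → ℂ) (c : ℂ)

lemma form_eq_sum : form M x y = ∑ j, (∑ i, x i * M i j) * star (y j) := rfl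

lemma form_add_left : form M (x + x') y = form M x y + form M x' y := by
  simp [form, Matrix.add_vecMul, add_dotProduct]

lemma form_sub_left : form M (x - x') y = form M x y - form M x' y := by
  simp [form, Matrix.sub_vecMul, sub_dotProduct]

lemma form_smul_left : form M (c • x) y = c * form M x y := by
  simp [form, Matrix.smul_vecMul, smul_dotProduct]

lemma form_add_right : form M x (y + y') = form M x y + form M x y' := by
  simp [form, star_add, dotProduct_add]

lemma form_sub_right : form M x (y - y') = form M x y - form M x y' := by
  simp [form, star_sub, dotProduct_sub]

lemma form_smul_right : form M x (c • y) = star c * form M x y := by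
  simp [form, star_smul, dotProduct_smul]

lemma form_add_mat : form (M + N) x y = form M x y + form N x y := by
  simp [form, Matrix.vecMul_add, add_dotProduct]

lemma form_smul_mat : form (c • M) x y = c * form M x y := by
  simp [form, Matrix.vecMul_smul, smul_dotProduct]

variable {M N}

lemma star_form (hM : M.IsHermitian) : star (form M x y) = form M y x := by
  rw [form, form, ← Matrix.star_dotProduct_star, star_star, Matrix.star_vecMul, hM.eq,
    Matrix.dotProduct_mulVec, dotProduct_comm]

lemma form_self_nonneg (hM : M.PosSemidef) : 0 ≤ form M x x := by
  have := hM.dotProduct_mulVec_nonneg (star x)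
  rwa [star_star, Matrix.dotProduct_mulVec] at this

lemma form_self_re_nonneg (hM : M.PosSemidef) : 0 ≤ (form M x x).re :=
  (Complex.le_def.1 (form_self_nonneg x hM)).1

lemma form_self_eq_re (hM : M.PosSemidef) : form M x x = ((form M x x).re : ℂ) :=
  Complex.ext rfl (Complex.le_def.1 (form_self_nonneg x hM)).2.symm

/-- Expand the nonnegative form at `x - u y`, with `u` the phase of `form M x y`. This additive
version of Cauchy–Schwarz is what domination arguments need. -/
lemma norm_form_le (hM : M.PosSemidef) :
    ‖form M x y‖ ≤ ((form M x x).re + (form M y y).re) / 2 := by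
  set z := form M x y with hz
  by_cases h0 : z = 0
  · rw [h0, norm_zero]
    linarith [form_self_re_nonneg x hM, form_self_re_nonneg y hM]
  have hn : ‖z‖ ≠ 0 := norm_ne_zero_iff.2 h0
  set u : ℂ := z / ‖z‖ with hu
  have h1 : star u * z = ‖z‖ := by
    have : star z * z = (‖z‖ : ℂ) * ‖z‖ := by
      rw [mul_comm, ← sq, Complex.star_def, Complex.mul_conj, Complex.normSq_eq_norm_sq]; simp
    have hn' : (‖z‖ : ℂ) ≠ 0 := by exact_mod_cast hn
    rw [hu, star_div₀, div_mul_eq_mul_div, this]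
    simp [hn']
  have h2 : star u * u = 1 := by
    have hn' : (‖z‖ : ℂ) ≠ 0 := by exact_mod_cast hn
    rw [hu, mul_div_assoc', h1]; simp [hn']
  have h3 := form_self_re_nonneg (x - u • y) hM
  have h4 : u * form M y x = ‖z‖ := by
    rw [← star_form x y hM.1, ← hz]
    have := congrArg star h1
    simpa [mul_comm] using this
  rw [form_sub_left, form_sub_right, form_sub_right, form_smul_left, form_smul_left,
    form_smul_right, form_smul_right, h4, ← hz, h1, mul_left_comm, ← mul_assoc, h2] at h3
  simp at h3
  linarith

/-- Source of the duality: `y ↦ yᵀ W⁻¹` maps `L₂(W⁻¹)` isometrically to `L₂(W)` and turns the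
unweighted pairing into the inner product of `L₂(W)`. -/
lemma form_inv_right (hM : M.PosSemidef) (hu : IsUnit M.det) :
    form M x (y ᵥ* M⁻¹) = x ⬝ᵥ star y := by
  rw [← star_form _ _ hM.1, form, Matrix.vecMul_vecMul, Matrix.nonsing_inv_mul _ hu,
    Matrix.vecMul_one, ← Matrix.star_dotProduct_star, star_star]

lemma form_inv_inv (hM : M.PosSemidef) (hu : IsUnit M.det) :
    form M (x ᵥ* M⁻¹) (y ᵥ* M⁻¹) = form M⁻¹ x y := by
  rw [form_inv_right _ _ hM hu]; rfl

end form

/-! ### Measurability -/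

/-- Entrywise measurability. -/
def MatMeas (W : MatFun T) : Prop := ∀ i j, AEStronglyMeasurable (fun θ => W θ i j) freq

lemma MatMeas.mul {W X : MatFun T} (hW : MatMeas W) (hX : MatMeas X) :
    MatMeas (fun θ => W θ * X θ) := fun i j => by
  simp only [Matrix.mul_apply]
  exact Finset.aestronglyMeasurable_fun_sum _ fun k _ => (hW i k).mul (hX k j)

lemma aesm_apply {h : VecFun T} (hh : AEStronglyMeasurable h freq) (k : Fin T) :
    AEStronglyMeasurable (fun θ => h θ k) freq :=
  (continuous_apply k).comp_aestronglyMeasurable hh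

lemma aesm_of_apply {h : VecFun T} (hh : ∀ k, AEStronglyMeasurable (fun θ => h θ k) freq) :
    AEStronglyMeasurable h freq :=
  (aemeasurable_pi_lambda _ fun k => (hh k).aemeasurable).aestronglyMeasurable

lemma MatMeas.vecMul {W : MatFun T} (hW : MatMeas W) {h : VecFun T}
    (hh : AEStronglyMeasurable h freq) : AEStronglyMeasurable (fun θ => h θ ᵥ* W θ) freq :=
  aesm_of_apply fun k => by
    simp only [Matrix.vecMul, dotProduct]
    exact Finset.aestronglyMeasurable_fun_sum _ fun i _ => (aesm_apply hh i).mul (hW i k)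

lemma aesm_dotProduct_star {h g : VecFun T} (hh : AEStronglyMeasurable h freq)
    (hg : AEStronglyMeasurable g freq) :
    AEStronglyMeasurable (fun θ => h θ ⬝ᵥ star (g θ)) freq := by
  simp only [dotProduct]
  exact Finset.aestronglyMeasurable_fun_sum _ fun i _ =>
    (aesm_apply hh i).mul (continuous_star.comp_aestronglyMeasurable (aesm_apply hg i))

lemma MatMeas.form {W : MatFun T} (hW : MatMeas W) {h g : VecFun T}
    (hh : AEStronglyMeasurable h freq) (hg : AEStronglyMeasurable g freq) :
    AEStronglyMeasurable (fun θ => Filtering.form (W θ) (h θ) (g θ)) freq :=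
  aesm_dotProduct_star (hW.vecMul hh) hg

lemma IsSpectralDensity.meas {W : MatFun T} (hW : IsSpectralDensity W) : MatMeas W :=
  fun i j => (hW.integrable i j).aestronglyMeasurable

lemma IsMinimal.meas_inv {W : MatFun T} (hW : IsMinimal W) : MatMeas (fun θ => (W θ)⁻¹) :=
  fun i j => (hW.integrable i j).aestronglyMeasurable

lemma IsSpectralDensity.add {W X : MatFun T} (hW : IsSpectralDensity W)
    (hX : IsSpectralDensity X) : IsSpectralDensity (W + X) where
  integrable i j := (hW.integrable i j).add (hX.integrable i j)
  posSemidef := by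
    filter_upwards [hW.posSemidef, hX.posSemidef] with θ h1 h2 using h1.add h2

lemma IsSpectralDensity.smul {W : MatFun T} (hW : IsSpectralDensity W) {t : ℝ} (ht : 0 ≤ t) :
    IsSpectralDensity ((t : ℂ) • W) where
  integrable i j := (hW.integrable i j).const_mul (t : ℂ)
  posSemidef := by
    filter_upwards [hW.posSemidef] with θ h1
    exact h1.smul (by exact_mod_cast ht : (0 : ℂ) ≤ t)

lemma IsMinimal.inv_density {W : MatFun T} (hm : IsMinimal W) (hW : IsSpectralDensity W) :
    IsSpectralDensity (fun θ => (W θ)⁻¹) where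
  integrable := hm.integrable
  posSemidef := by filter_upwards [hW.posSemidef] with θ h using h.inv

/-- Minimality is symmetric under `W ↔ W⁻¹`, so all results on `L₂(W)` apply as well to `L₂(W⁻¹)`,
the space of the residuals `C`. -/
lemma IsMinimal.inv_minimal {W : MatFun T} (hm : IsMinimal W) (hW : IsSpectralDensity W) :
    IsMinimal (fun θ => (W θ)⁻¹) where
  invertible := by
    filter_upwards [hm.invertible] with θ h
    exact Matrix.isUnit_nonsing_inv_det _ h
  integrable i j := by
    refine (hW.integrable i j).congr ?_
    filter_upwards [hm.invertible] with θ h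
    rw [Matrix.nonsing_inv_nonsing_inv _ h]

/-! ### `L₂(W)` -/

lemma sqNorm_eq_form (W : MatFun T) (h : VecFun T) :
    sqNorm W h = ∫⁻ θ, ENNReal.ofReal (form (W θ) (h θ) (h θ)).re ∂freq := rfl

section L2

variable {W : MatFun T} {h g : VecFun T}

lemma MemL2.integrable_self (hW : IsSpectralDensity W) (hh : MemL2 W h) :
    Integrable (fun θ => (form (W θ) (h θ) (h θ)).re) freq := by
  refine ⟨(hW.meas.form hh.1 hh.1).re, ?_⟩
  rw [hasFiniteIntegral_iff_ofReal]
  · exact hh.2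
  · filter_upwards [hW.posSemidef] with θ h1 using form_self_re_nonneg _ h1

lemma MemL2.integrable_form (hW : IsSpectralDensity W) (hh : MemL2 W h) (hg : MemL2 W g) :
    Integrable (fun θ => form (W θ) (h θ) (g θ)) freq := by
  refine Integrable.mono' (((hh.integrable_self hW).add (hg.integrable_self hW)).div_const 2)
    (hW.meas.form hh.1 hg.1) ?_
  filter_upwards [hW.posSemidef] with θ h1 using norm_form_le _ _ h1

lemma memL2_of_integrable (hm : AEStronglyMeasurable h freq)
    (hi : Integrable (fun θ => form (W θ) (h θ) (h θ)) freq) : MemL2 W h := by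
  refine ⟨hm, ?_⟩
  refine lt_of_le_of_lt (lintegral_mono fun θ => ?_) hi.2
  rw [← ofReal_norm]
  exact ENNReal.ofReal_le_ofReal (Complex.re_le_norm _)

lemma MemL2.smul (c : ℂ) (hW : IsSpectralDensity W) (hh : MemL2 W h) : MemL2 W (c • h) := by
  refine memL2_of_integrable (hh.1.const_smul c) ?_
  simp only [Pi.smul_apply, form_smul_left, form_smul_right]
  exact ((hh.integrable_form hW hh).const_mul _).const_mul _

lemma MemL2.add (hW : IsSpectralDensity W) (hh : MemL2 W h) (hg : MemL2 W g) :
    MemL2 W (h + g) := by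
  have h1 := ((hh.integrable_form hW hh).add (hh.integrable_form hW hg)).add
    ((hg.integrable_form hW hh).add (hg.integrable_form hW hg))
  refine memL2_of_integrable (hh.1.add hg.1) (h1.congr (.of_forall fun θ => ?_))
  simp only [Pi.add_apply, form_add_left, form_add_right]
  ring

lemma memL2_zero (W : MatFun T) : MemL2 W 0 :=
  memL2_of_integrable aestronglyMeasurable_const (by simp [form])

/-- `L₂(W)` as a space of functions, with the seminorm `sqNorm W ^ (1/2)`. -/
def WL2 (hW : IsSpectralDensity W) : Type :=
  ({ carrier := {h | MemL2 W h}
     add_mem' := fun h1 h2 => h1.add hW h2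
     zero_mem' := memL2_zero W
     smul_mem' := fun c _ h1 => h1.smul c hW } : Submodule ℂ (VecFun T))

namespace WL2

variable (hW : IsSpectralDensity W)

instance : AddCommGroup (WL2 hW) := by unfold WL2; infer_instance
instance : Module ℂ (WL2 hW) := by unfold WL2; infer_instance

variable {hW}

/-- The underlying function. -/
def fn (h : WL2 hW) : VecFun T := h.1

lemma mem (h : WL2 hW) : MemL2 W h.fn := h.2

/-- A function in `L₂(W)` as an element of the space. -/
def mk (hW : IsSpectralDensity W) (h : VecFun T) (hh : MemL2 W h) : WL2 hW := ⟨h, hh⟩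

@[simp] lemma fn_mk (hh : MemL2 W h) : (mk hW h hh).fn = h := rfl
@[simp] lemma fn_add (x y : WL2 hW) : (x + y).fn = x.fn + y.fn := rfl
@[simp] lemma fn_sub (x y : WL2 hW) : (x - y).fn = x.fn - y.fn := rfl
@[simp] lemma fn_smul (c : ℂ) (x : WL2 hW) : (c • x).fn = c • x.fn := rfl

variable (hW)

/-- The inner product `1/(2π) ∫ yᵀ W conj(x)`. -/
instance core : PreInnerProductSpace.Core ℂ (WL2 hW) where
  inner x y := ∫ θ, form (W θ) (y.fn θ) (x.fn θ) ∂freq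
  conj_inner_symm x y := by
    rw [← integral_conj]
    refine integral_congr_ae ?_
    filter_upwards [hW.posSemidef] with θ h
    exact star_form _ _ h.1
  re_inner_nonneg x := by
    have h1 := x.mem.integrable_form hW x.mem
    have := integral_re h1
    rw [← this]
    refine integral_nonneg_of_ae ?_
    filter_upwards [hW.posSemidef] with θ h using form_self_re_nonneg _ h
  add_left x y z := by
    rw [← integral_add (z.mem.integrable_form hW x.mem) (z.mem.integrable_form hW y.mem)]
    simp only [fn_add, Pi.add_apply, form_add_right]
  smul_left x y c := by
    rw [← integral_const_mul]
    simp only [fn_smul, Pi.smul_apply, form_smul_right]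
    rfl

instance : SeminormedAddCommGroup (WL2 hW) :=
  InnerProductSpace.Core.toSeminormedAddCommGroup (𝕜 := ℂ)

instance : InnerProductSpace ℂ (WL2 hW) := InnerProductSpace.ofCore (core hW)

variable {hW}

lemma inner_def (x y : WL2 hW) :
    inner ℂ x y = ∫ θ, form (W θ) (y.fn θ) (x.fn θ) ∂freq := rfl

lemma norm_sq_eq_integral (x : WL2 hW) :
    ‖x‖ ^ 2 = ∫ θ, (form (W θ) (x.fn θ) (x.fn θ)).re ∂freq := by
  rw [@norm_sq_eq_re_inner ℂ, inner_def]
  exact (integral_re (x.mem.integrable_form hW x.mem)).symm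

lemma sqNorm_eq (x : WL2 hW) : sqNorm W x.fn = ENNReal.ofReal (‖x‖ ^ 2) := by
  rw [norm_sq_eq_integral, ofReal_integral_eq_lintegral_ofReal (x.mem.integrable_self hW)]
  · rfl
  · filter_upwards [hW.posSemidef] with θ h using form_self_re_nonneg _ h

lemma tendsto_iff_sqNorm {x : ℕ → WL2 hW} {y : WL2 hW} :
    Tendsto x atTop (𝓝 y) ↔ Tendsto (fun n => sqNorm W ((x n).fn - y.fn)) atTop (𝓝 0) := by
  have : (fun n => sqNorm W ((x n).fn - y.fn)) = fun n => ENNReal.ofReal (‖x n - y‖ ^ 2) := by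
    ext n; rw [← sqNorm_eq, fn_sub]
  rw [this, tendsto_iff_norm_sub_tendsto_zero, ← ENNReal.ofReal_zero]
  constructor
  · intro h
    refine ENNReal.tendsto_ofReal ?_
    simpa using h.pow 2
  · intro h
    have h2 := (ENNReal.tendsto_toReal (by simp)).comp h
    simp only [Function.comp_def, ENNReal.toReal_ofReal (sq_nonneg _)] at h2
    have h3 := (Real.continuous_sqrt.tendsto _).comp h2
    simpa [Function.comp_def, Real.sqrt_sq (norm_nonneg _)] using h3

end WL2

end L2

instance : IsProbabilityMeasure freq := ⟨by
  rw [freq, Measure.smul_apply, Measure.restrict_apply_univ, Real.volume_Ioc, smul_eq_mul,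
    ← ENNReal.ofReal_mul (by positivity), ENNReal.ofReal_eq_one]
  field_simp
  ring⟩

/-! ### Characters and trigonometric polynomials -/

lemma continuous_expChar (n : ℤ) : Continuous (expChar n) := by
  unfold expChar; fun_prop

@[simp] lemma norm_expChar (n : ℤ) (θ : ℝ) : ‖expChar n θ‖ = 1 := by
  rw [expChar, show Complex.I * n * θ = ((n * θ : ℝ) : ℂ) * Complex.I by push_cast; ring]
  exact Complex.norm_exp_ofReal_mul_I _

lemma expChar_add (m n : ℤ) (θ : ℝ) : expChar (m + n) θ = expChar m θ * expChar n θ := by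
  rw [expChar, expChar, expChar, ← Complex.exp_add]; push_cast; ring_nf

@[simp] lemma expChar_zero (θ : ℝ) : expChar 0 θ = 1 := by simp [expChar]

lemma star_expChar (n : ℤ) (θ : ℝ) : star (expChar n θ) = expChar (-n) θ := by
  rw [expChar, expChar, Complex.star_def, ← Complex.exp_conj]
  simp

lemma aesm_expChar (n : ℤ) : AEStronglyMeasurable (expChar n) freq :=
  (continuous_expChar n).aestronglyMeasurable

lemma trigPoly_add (p q : ℤ →₀ (Fin T → ℂ)) : trigPoly (p + q) = trigPoly p + trigPoly q := by
  ext1 θ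
  exact Finsupp.sum_add_index' (by simp) (by simp [smul_add])

lemma trigPoly_smul (c : ℂ) (p : ℤ →₀ (Fin T → ℂ)) : trigPoly (c • p) = c • trigPoly p := by
  ext1 θ
  simp only [trigPoly, Pi.smul_apply, Finsupp.smul_sum]
  rw [Finsupp.sum_smul_index' (by simp)]
  simp only [smul_comm c]

@[simp] lemma trigPoly_zero : trigPoly (0 : ℤ →₀ (Fin T → ℂ)) = 0 := by
  ext1 θ; simp [trigPoly]

lemma trigPoly_single (n : ℤ) (v : Fin T → ℂ) :
    trigPoly (Finsupp.single n v) = fun θ => expChar n θ • v := by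
  ext1 θ; simp [trigPoly]

lemma continuous_trigPoly (p : ℤ →₀ (Fin T → ℂ)) : Continuous (trigPoly p) := by
  unfold trigPoly Finsupp.sum
  exact continuous_finsetSum _ fun i _ => (continuous_expChar i).smul continuous_const

lemma trigPoly_bounded (p : ℤ →₀ (Fin T → ℂ)) : ∃ C, ∀ θ k, ‖trigPoly p θ k‖ ≤ C := by
  refine ⟨p.sum fun _ v => ‖v‖, fun θ k => (norm_le_pi_norm _ k).trans ?_⟩
  refine (norm_sum_le _ _).trans (Finset.sum_le_sum fun i _ => ?_)
  rw [norm_smul, norm_expChar, one_mul]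

/-! ### Elements of `L₂(W)` and duality between `W` and `W⁻¹` -/

section

variable {W : MatFun T} {h g : VecFun T}

lemma memL2_of_bounded (hW : IsSpectralDensity W) (hm : AEStronglyMeasurable h freq) {C : ℝ}
    (hC : ∀ θ k, ‖h θ k‖ ≤ C) : MemL2 W h := by
  refine memL2_of_integrable hm ?_
  simp only [form_eq_sum, Finset.sum_mul]
  refine integrable_finsetSum _ fun j _ => integrable_finsetSum _ fun i _ => ?_
  refine Integrable.mul_bdd (c := C) ((hW.integrable i j).bdd_mul (c := C) (aesm_apply hm i)
    (.of_forall fun θ => hC θ i)) (continuous_star.comp_aestronglyMeasurable (aesm_apply hm j))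
    (.of_forall fun θ => ?_)
  simpa using hC θ j

lemma memL2_trigPoly (hW : IsSpectralDensity W) (p : ℤ →₀ (Fin T → ℂ)) :
    MemL2 W (trigPoly p) := by
  obtain ⟨C, hC⟩ := trigPoly_bounded p
  exact memL2_of_bounded hW (continuous_trigPoly p).aestronglyMeasurable hC

lemma MemL2.sub (hW : IsSpectralDensity W) (hh : MemL2 W h) (hg : MemL2 W g) :
    MemL2 W (h - g) := by
  have := hh.add hW (hg.smul (-1) hW)
  simpa [sub_eq_add_neg] using this

lemma MemL2.vecMul_inv (hW : IsSpectralDensity W) (hm : IsMinimal W)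
    (hg : MemL2 (fun θ => (W θ)⁻¹) g) : MemL2 W (fun θ => g θ ᵥ* (W θ)⁻¹) := by
  refine memL2_of_integrable (hm.meas_inv.vecMul hg.1) ?_
  refine (hg.integrable_form (hm.inv_density hW) hg).congr ?_
  filter_upwards [hm.invertible, hW.posSemidef] with θ h1 h2
  rw [form_inv_inv _ _ h2 h1]

lemma MemL2.vecMul_self (hW : IsSpectralDensity W) (hm : IsMinimal W)
    (hg : MemL2 W g) : MemL2 (fun θ => (W θ)⁻¹) (fun θ => g θ ᵥ* W θ) := by
  refine memL2_of_integrable (hW.meas.vecMul hg.1) ?_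
  refine (hg.integrable_form hW hg).congr ?_
  filter_upwards [hm.invertible, hW.posSemidef] with θ h1 h2
  rw [← form_inv_inv _ _ h2 h1, Matrix.vecMul_vecMul, Matrix.mul_nonsing_inv _ h1,
    Matrix.vecMul_one]

/-- The pairing of `L₂(W)` and `L₂(W⁻¹)` as an inner product in `L₂(W)`. -/
lemma inner_vecMul_inv (hW : IsSpectralDensity W) (hm : IsMinimal W) (x : WL2 hW)
    (hg : MemL2 (fun θ => (W θ)⁻¹) g) :
    inner ℂ (WL2.mk hW _ (hg.vecMul_inv hW hm)) x = ∫ θ, x.fn θ ⬝ᵥ star (g θ) ∂freq := by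
  rw [WL2.inner_def]
  refine integral_congr_ae ?_
  filter_upwards [hm.invertible, hW.posSemidef] with θ h1 h2
  rw [WL2.fn_mk, form_inv_right _ _ h2 h1]

lemma MemL2.integrable_dual (hW : IsSpectralDensity W) (hm : IsMinimal W) (hh : MemL2 W h)
    (hg : MemL2 (fun θ => (W θ)⁻¹) g) : Integrable (fun θ => h θ ⬝ᵥ star (g θ)) freq := by
  refine (hh.integrable_form hW (hg.vecMul_inv hW hm)).congr ?_
  filter_upwards [hm.invertible, hW.posSemidef] with θ h1 h2
  rw [form_inv_right _ _ h2 h1]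

lemma dotProduct_star_single (x : Fin T → ℂ) (k : Fin T) (c : ℂ) :
    x ⬝ᵥ star (Pi.single k c) = x k * star c := by
  rw [← Pi.single_star, dotProduct_single]

/-- Integrability of `W⁻¹` puts the constant unit vectors into the dual space `L₂(W⁻¹)`. Elements of
`L₂(W)` thereby acquire Fourier coefficients. -/
lemma MemL2.integrable_apply (hW : IsSpectralDensity W) (hm : IsMinimal W) (hh : MemL2 W h)
    (k : Fin T) : Integrable (fun θ => h θ k) freq := by
  have hg : MemL2 (fun θ => (W θ)⁻¹) (fun _ => Pi.single k 1) :=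
    memL2_of_bounded (C := 1) (hm.inv_density hW) aestronglyMeasurable_const fun θ j => by
      by_cases h : j = k
      · subst h; simp
      · simp [h]
  refine (hh.integrable_dual hW hm hg).congr (.of_forall fun θ => ?_)
  simp

/-- Pair `x` with the phase of its `k`-th entry times the `k`-th unit vector and apply
Cauchy–Schwarz; the squared dual norm is at most the integral of `‖(W⁻¹)_kk‖`. -/
lemma exists_integral_norm_apply_le (hW : IsSpectralDensity W) (hm : IsMinimal W) (k : Fin T) :
    ∃ C : ℝ, 0 ≤ C ∧ ∀ x : WL2 hW, ∫ θ, ‖x.fn θ k‖ ∂freq ≤ C * ‖x‖ := by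
  have hV := hm.inv_density hW
  refine ⟨√(∫ θ, ‖(W θ)⁻¹ k k‖ ∂freq), Real.sqrt_nonneg _, fun x => ?_⟩
  -- At zeros of the entry the quotient is `0`, so `u` has modulus at most `1`, not always equal to
  -- it.
  set u : ℝ → ℂ := fun θ => x.fn θ k / ‖x.fn θ k‖ with hu
  have hu1 : ∀ θ, ‖u θ‖ ≤ 1 := fun θ => by
    rw [hu]; simp only [norm_div, Complex.norm_real, norm_norm]; exact div_self_le_one _
  have hum : AEStronglyMeasurable u freq := by
    have h1 := aesm_apply x.mem.1 k
    exact ((h1.aemeasurable.div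
      (Complex.measurable_ofReal.comp_aemeasurable h1.norm.aemeasurable))).aestronglyMeasurable
  have hg : MemL2 (fun θ => (W θ)⁻¹) (fun θ => Pi.single k (u θ)) := by
    refine memL2_of_bounded (C := 1) hV ?_ fun θ j => ?_
    · refine aesm_of_apply fun j => ?_
      by_cases h : j = k
      · subst h; simpa using hum
      · simpa [h] using aestronglyMeasurable_const
    · by_cases h : j = k
      · subst h; simpa using hu1 θ
      · simp [h]
  set y := WL2.mk hW _ (hg.vecMul_inv hW hm)
  have h1 : inner ℂ y x = ((∫ θ, ‖x.fn θ k‖ ∂freq : ℝ) : ℂ) := by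
    rw [inner_vecMul_inv hW hm x hg, ← integral_complex_ofReal]
    refine integral_congr_ae (.of_forall fun θ => ?_)
    simp only [dotProduct_star_single, hu]
    by_cases h0 : x.fn θ k = 0
    · simp [h0]
    · have hn : (‖x.fn θ k‖ : ℂ) ≠ 0 := by exact_mod_cast norm_ne_zero_iff.2 h0
      rw [star_div₀, mul_div_assoc', Complex.star_def, Complex.mul_conj,
        Complex.normSq_eq_norm_sq]
      simp [field]
  have h2 : ‖y‖ ^ 2 ≤ ∫ θ, ‖(W θ)⁻¹ k k‖ ∂freq := by
    rw [WL2.norm_sq_eq_integral]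
    refine integral_mono_ae (y.mem.integrable_self hW) (hm.integrable k k).norm ?_
    filter_upwards [hm.invertible, hW.posSemidef] with θ h1 h2
    have : form (W θ) (y.fn θ) (y.fn θ) = u θ * (W θ)⁻¹ k k * star (u θ) := by
      simp only [y, WL2.fn_mk]
      rw [form_inv_inv _ _ h2 h1, form, dotProduct_star_single, Matrix.single_vecMul]
      simp
    rw [this]
    refine (Complex.re_le_norm _).trans ?_
    rw [norm_mul, norm_mul, norm_star]
    have := hu1 θ
    have := norm_nonneg (u θ)
    have h4 : ‖u θ‖ * ‖u θ‖ ≤ 1 := by nlinarith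
    nlinarith [norm_nonneg ((W θ)⁻¹ k k)]
  have h3 := norm_inner_le_norm (𝕜 := ℂ) y x
  rw [h1, Complex.norm_real, Real.norm_eq_abs] at h3
  refine (le_abs_self _).trans (h3.trans ?_)
  gcongr
  exact Real.le_sqrt_of_sq_le h2

/-- Lower semicontinuity of `sqNorm`. -/
lemma sqNorm_le_of_tendsto_ae (hW : MatMeas W) {x : ℕ → VecFun T}
    (hx : ∀ i, AEStronglyMeasurable (x i) freq)
    (hlim : ∀ᵐ θ ∂freq, Tendsto (fun i => x i θ) atTop (𝓝 (g θ))) {C : ℝ≥0∞}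
    (hC : ∀ᶠ i in atTop, sqNorm W (x i) ≤ C) : sqNorm W g ≤ C := by
  have h1 : sqNorm W g ≤ liminf (fun i => sqNorm W (x i)) atTop := by
    have h2 := lintegral_liminf_le' (μ := freq) (u := atTop)
      (f := fun i θ => ENNReal.ofReal (form (W θ) (x i θ) (x i θ)).re)
      (fun i => (hW.form (hx i) (hx i)).re.aemeasurable.ennreal_ofReal)
    refine le_trans (le_of_eq ?_) h2
    refine lintegral_congr_ae ?_
    filter_upwards [hlim] with θ hθ
    have hc : Continuous fun v : Fin T → ℂ =>
        ENNReal.ofReal (form (W θ) v v).re := by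
      simp only [form_eq_sum]
      refine ENNReal.continuous_ofReal.comp (Complex.continuous_re.comp ?_)
      fun_prop
    exact ((hc.tendsto _).comp hθ).liminf_eq.symm
  refine h1.trans ?_
  exact liminf_le_of_frequently_le' hC.frequently

/-- The inclusion of `L₂(W)` in `L₁` for a minimal `W`. -/
def toL1 (hW : IsSpectralDensity W) (hm : IsMinimal W) :
    WL2 hW →ₗ[ℂ] Lp (Fin T → ℂ) 1 (freq) where
  toFun x := Integrable.toL1 x.fn (Integrable.of_eval fun k => x.mem.integrable_apply hW hm k)
  map_add' _ _ := rfl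
  map_smul' _ _ := rfl

lemma uniformContinuous_toL1 (hW : IsSpectralDensity W) (hm : IsMinimal W) :
    UniformContinuous (toL1 hW hm) := by
  choose C hC0 hC using exists_integral_norm_apply_le hW hm
  have : ∀ x, ‖toL1 hW hm x‖ ≤ (∑ k, C k) * ‖x‖ := fun x => by
    have hi : ∀ k, Integrable (fun θ => x.fn θ k) freq := x.mem.integrable_apply hW hm
    have h0 : ‖toL1 hW hm x‖ = ∫ θ, ‖x.fn θ‖ ∂freq := by
      rw [L1.norm_eq_integral_norm]
      refine integral_congr_ae ?_
      filter_upwards [Integrable.coeFn_toL1 (Integrable.of_eval hi)] with θ hθ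
      exact congrArg norm hθ
    rw [h0, Finset.sum_mul]
    refine le_trans ?_ (Finset.sum_le_sum fun k _ => hC k x)
    rw [← integral_finsetSum _ fun k _ => (hi k).norm]
    refine integral_mono (Integrable.of_eval hi).norm
      (integrable_finsetSum _ fun k _ => (hi k).norm) fun θ => ?_
    refine (pi_norm_le_iff_of_nonneg (Finset.sum_nonneg fun _ _ => norm_nonneg _)).2 fun k => ?_
    exact Finset.single_le_sum (f := fun k => ‖x.fn θ k‖) (fun _ _ => norm_nonneg _)
      (Finset.mem_univ k)
  exact ((toL1 hW hm).mkContinuous _ this).uniformContinuous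

/-- The sequence converges in `L₁`, hence in measure, hence almost everywhere along a subsequence.
-/
lemma exists_ae_limit_of_cauchy (hW : IsSpectralDensity W) (hm : IsMinimal W) {x : ℕ → WL2 hW}
    (hx : CauchySeq x) : ∃ g : VecFun T, AEStronglyMeasurable g freq ∧ ∃ ns : ℕ → ℕ,
      StrictMono ns ∧ ∀ᵐ θ ∂freq, Tendsto (fun i => (x (ns i)).fn θ) atTop (𝓝 (g θ)) := by
  obtain ⟨g, hg⟩ := cauchySeq_tendsto_of_complete
    ((uniformContinuous_toL1 hW hm).comp_cauchySeq hx)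
  have h1 := tendstoInMeasure_of_tendsto_Lp hg
  obtain ⟨ns, hns, h2⟩ := h1.exists_seq_tendsto_ae
  refine ⟨g, Lp.aestronglyMeasurable g, ns, hns, ?_⟩
  have h3 : ∀ᵐ θ ∂freq, ∀ i, toL1 hW hm (x i) θ = (x i).fn θ :=
    ae_all_iff.2 fun i => Integrable.coeFn_toL1 (Integrable.of_eval fun k =>
      (x i).mem.integrable_apply hW hm k)
  filter_upwards [h2, h3] with θ h4 h5
  simpa [h5] using h4

/-- Pointwise convergence does not refer to the weight, which lets a limit found in one weighted
space be recognised in another. -/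
lemma exists_ae_subseq_of_tendsto (hW : IsSpectralDensity W) (hm : IsMinimal W)
    {x : ℕ → WL2 hW} {y : WL2 hW} (hx : Tendsto x atTop (𝓝 y)) : ∃ ns : ℕ → ℕ,
      StrictMono ns ∧ ∀ᵐ θ ∂freq, Tendsto (fun i => (x (ns i)).fn θ) atTop (𝓝 (y.fn θ)) := by
  have hg := ((uniformContinuous_toL1 hW hm).continuous.tendsto y).comp hx
  have h1 := tendstoInMeasure_of_tendsto_Lp hg
  obtain ⟨ns, hns, h2⟩ := h1.exists_seq_tendsto_ae
  refine ⟨ns, hns, ?_⟩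
  have h3 : ∀ᵐ θ ∂freq, ∀ i, toL1 hW hm (x i) θ = (x i).fn θ :=
    ae_all_iff.2 fun i => Integrable.coeFn_toL1 (Integrable.of_eval fun k =>
      (x i).mem.integrable_apply hW hm k)
  filter_upwards [h2, h3, Integrable.coeFn_toL1 (Integrable.of_eval fun k =>
      y.mem.integrable_apply hW hm k)] with θ h4 h5 h6
  have h7 : toL1 hW hm y θ = y.fn θ := h6
  simpa [h5, h7] using h4

/-- If `W` is minimal, then `L₂(W)` is complete. -/
lemma WL2.completeSpace (hW : IsSpectralDensity W) (hm : IsMinimal W) :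
    CompleteSpace (WL2 hW) := by
  refine Metric.complete_of_cauchySeq_tendsto fun x hx => ?_
  obtain ⟨g, hgm, ns, hns, hg⟩ := exists_ae_limit_of_cauchy hW hm hx
  -- The Cauchy bound for `x n - x (ns i)` survives the limit in `i` by lower semicontinuity of
  -- `sqNorm`. One such bound puts `g` into `L₂(W)`; all of them give convergence.
  have key : ∀ ε : ℝ, 0 < ε → ∃ N, ∀ n ≥ N,
      sqNorm W ((x n).fn - g) ≤ ENNReal.ofReal (ε ^ 2) := fun ε hε => by
    obtain ⟨N, hN⟩ := Metric.cauchySeq_iff.1 hx ε hε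
    refine ⟨N, fun n hn => ?_⟩
    refine sqNorm_le_of_tendsto_ae hW.meas (x := fun i => (x n).fn - (x (ns i)).fn)
      (fun i => (x n).mem.1.sub (x (ns i)).mem.1) ?_ ?_
    · filter_upwards [hg] with θ hθ using tendsto_const_nhds.sub hθ
    · filter_upwards [eventually_ge_atTop N] with i hi
      rw [← WL2.fn_sub, WL2.sqNorm_eq]
      have := hN n hn (ns i) (hi.trans (hns.id_le i))
      rw [dist_eq_norm] at this
      gcongr
  have hg2 : MemL2 W g := by
    obtain ⟨N, hN⟩ := key 1 one_pos
    have h1 : MemL2 W ((x N).fn - g) :=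
      ⟨(x N).mem.1.sub hgm, (hN N le_rfl).trans_lt ENNReal.ofReal_lt_top⟩
    simpa using (x N).mem.sub hW h1
  refine ⟨WL2.mk hW g hg2, ?_⟩
  rw [Metric.tendsto_atTop]
  intro ε hε
  obtain ⟨N, hN⟩ := key (ε / 2) (by positivity)
  refine ⟨N, fun n hn => ?_⟩
  have h1 := hN n hn
  have h2 : (x n).fn - g = (x n - WL2.mk hW g hg2).fn := rfl
  rw [h2, WL2.sqNorm_eq, ENNReal.ofReal_le_ofReal_iff (by positivity)] at h1
  rw [dist_eq_norm]
  have := abs_le_of_sq_le_sq h1 (by positivity)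
  linarith [le_abs_self ‖x n - WL2.mk hW g hg2‖]

/-- The trigonometric polynomials with frequencies in `Λ`, as elements of `L₂(W)`. -/
def polySpace (hW : IsSpectralDensity W) (Λ : Set ℤ) : Submodule ℂ (WL2 hW) where
  carrier := {x | ∃ p : ℤ →₀ (Fin T → ℂ), (p.support : Set ℤ) ⊆ Λ ∧ x.fn = trigPoly p}
  add_mem' := by
    classical
    rintro x y ⟨p, hp, hx⟩ ⟨q, hq, hy⟩
    refine ⟨p + q, fun i hi => ?_, by rw [trigPoly_add, WL2.fn_add, hx, hy]⟩
    rcases Finset.mem_union.1 (Finsupp.support_add hi) with h | h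
    exacts [hp h, hq h]
  zero_mem' := ⟨0, by simp, by rw [trigPoly_zero]; rfl⟩
  smul_mem' := by
    rintro c x ⟨p, hp, hx⟩
    exact ⟨c • p, fun i hi => hp (Finsupp.support_smul hi),
      by rw [trigPoly_smul, WL2.fn_smul, hx]⟩

/-- Orthogonal projection onto the closed span of the characters with frequencies in `Λ`. -/
lemma exists_projection (hW : IsSpectralDensity W) (hm : IsMinimal W) (Λ : Set ℤ) (x : WL2 hW) :
    ∃ y : WL2 hW, (∃ p : ℕ → WL2 hW, (∀ n, p n ∈ polySpace hW Λ) ∧ Tendsto p atTop (𝓝 y)) ∧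
      (∀ q ∈ polySpace hW Λ, inner ℂ q (x - y) = 0) ∧ ‖x - y‖ ≤ ‖x‖ := by
  have := WL2.completeSpace hW hm
  -- `WL2 hW` carries only a seminorm, so the projection is taken in its completion. It is a limit
  -- of polynomials, and completeness of `WL2 hW` gives it a representative `y`.
  let ι := UniformSpace.Completion.toComplₗᵢ (𝕜 := ℂ) (E := WL2 hW)
  let K := ((polySpace hW Λ).map ι.toLinearMap).topologicalClosure
  have : CompleteSpace K := (Submodule.isClosed_topologicalClosure _).completeSpace_coe
  set z := K.starProjection (ι x) with hz
  have hzK : z ∈ closure (((polySpace hW Λ).map ι.toLinearMap :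
      Submodule ℂ (UniformSpace.Completion (WL2 hW))) : Set _) :=
    Submodule.starProjection_apply_mem K (ι x)
  obtain ⟨r, hr, hrz⟩ := mem_closure_iff_seq_limit.1 hzK
  choose p hp hpr using hr
  have hpc : CauchySeq p := by
    have h1 := hrz.cauchySeq
    rw [Metric.cauchySeq_iff] at h1 ⊢
    intro ε hε
    obtain ⟨N, hN⟩ := h1 ε hε
    refine ⟨N, fun m hm n hn => ?_⟩
    rw [← ι.dist_map]
    have := hN m hm n hn
    rw [← hpr, ← hpr] at this
    exact this
  obtain ⟨y, hy⟩ := cauchySeq_tendsto_of_complete hpc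
  have hyz : ι y = z := by
    refine tendsto_nhds_unique ((ι.continuous.tendsto y).comp hy) ?_
    convert hrz using 1
    ext n
    exact hpr n
  refine ⟨y, ⟨p, hp, hy⟩, fun q hq => ?_, ?_⟩
  · rw [← ι.inner_map_map, map_sub, hyz, hz]
    exact Submodule.sub_starProjection_mem_orthogonal (K := K) (ι x) _
      (Submodule.le_topologicalClosure _ ⟨q, hq, rfl⟩)
  · rw [← ι.norm_map, ← ι.norm_map x, map_sub, hyz, hz]
    have h1 : ι x - K.starProjection (ι x) = Kᗮ.starProjection (ι x) := by
      rw [Submodule.starProjection_orthogonal]; rfl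
    rw [h1]
    exact Submodule.norm_starProjection_apply_le _ _

end

/-! ### Fourier coefficients -/

/-- The Fourier coefficient `1/(2π) ∫ f(θ) e^{-inθ} dθ`. -/
def fcoef (f : ℝ → ℂ) (n : ℤ) : ℂ := ∫ θ, f θ * expChar (-n) θ ∂freq

lemma integrable_mul_expChar {f : ℝ → ℂ} (hf : Integrable f freq) (n : ℤ) :
    Integrable (fun θ => f θ * expChar n θ) freq :=
  hf.mul_bdd (c := 1) (aesm_expChar n) (.of_forall fun θ => (norm_expChar n θ).le)

lemma fcoef_sub {f g : ℝ → ℂ} (hf : Integrable f freq) (hg : Integrable g freq) (n : ℤ) :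
    fcoef (f - g) n = fcoef f n - fcoef g n := by
  simp only [fcoef, Pi.sub_apply, sub_mul]
  exact integral_sub (integrable_mul_expChar hf _) (integrable_mul_expChar hg _)

lemma fcoef_mul_expChar (f : ℝ → ℂ) (m n : ℤ) :
    fcoef (fun θ => f θ * expChar m θ) n = fcoef f (n - m) := by
  simp only [fcoef, mul_assoc, ← expChar_add]
  simp [sub_eq_add_neg]

lemma fcoef_star (f : ℝ → ℂ) (n : ℤ) :
    fcoef (fun θ => star (f θ)) n = star (fcoef f (-n)) := by
  rw [fcoef, fcoef]
  refine Eq.trans ?_ integral_conj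
  refine integral_congr_ae (.of_forall fun θ => ?_)
  simp only [map_mul]
  rw [← Complex.star_def, star_expChar, neg_neg]

lemma integral_expChar (n : ℤ) : ∫ θ, expChar n θ ∂freq = if n = 0 then 1 else 0 := by
  split_ifs with h
  · simp [h]
  · rw [freq, integral_smul_measure,
      ← intervalIntegral.integral_of_le (by linarith [Real.pi_pos])]
    have hc : Complex.I * n ≠ 0 := mul_ne_zero Complex.I_ne_zero (by exact_mod_cast h)
    simp only [expChar]
    rw [integral_exp_mul_complex hc]
    have : Complex.exp (Complex.I * n * (Real.pi : ℝ))
        = Complex.exp (Complex.I * n * ((-Real.pi : ℝ) : ℂ)) := by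
      rw [Complex.exp_eq_exp_iff_exists_int]
      exact ⟨n, by push_cast; ring⟩
    rw [this]; simp

lemma fcoef_expChar (m n : ℤ) : fcoef (expChar m) n = if m = n then 1 else 0 := by
  simp only [fcoef, ← expChar_add]
  rw [integral_expChar]
  simp [add_neg_eq_zero]

/-- An integrable function is determined by its Fourier coefficients. -/
lemma ae_eq_zero_of_fcoef {f : ℝ → ℂ} (hf : Integrable f freq) (h : ∀ n, fcoef f n = 0) :
    ∀ᵐ θ ∂freq, f θ = 0 := by
  have : Fact (0 < 2 * Real.pi) := ⟨Real.two_pi_pos⟩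
  have hint : ∀ Φ : C(AddCircle (2 * Real.pi), ℂ),
      Integrable (fun θ : ℝ => Φ θ * f θ) freq := fun Φ =>
    hf.bdd_mul (c := ‖Φ‖)
      (Φ.continuous.comp (AddCircle.continuous_mk' _)).aestronglyMeasurable
      (.of_forall fun θ => Φ.norm_coe_le_norm θ)
  -- Integration against `f` is a continuous functional on continuous periodic functions; it kills
  -- the characters, whose span is dense, hence it is zero.
  let L : C(AddCircle (2 * Real.pi), ℂ) →L[ℂ] ℂ := LinearMap.mkContinuous
    { toFun := fun Φ => ∫ θ : ℝ, Φ θ * f θ ∂freq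
      map_add' := fun Φ Ψ => by
        simp only [ContinuousMap.add_apply, add_mul]
        exact integral_add (hint Φ) (hint Ψ)
      map_smul' := fun c Φ => by
        simp only [ContinuousMap.smul_apply, smul_eq_mul, mul_assoc, integral_const_mul]
        rfl } (∫ θ, ‖f θ‖ ∂freq) fun Φ => by
      refine (norm_integral_le_integral_norm _).trans ?_
      rw [← integral_mul_const]
      refine integral_mono (hint Φ).norm (hf.norm.mul_const _) fun θ => ?_
      simp only [norm_mul]
      rw [mul_comm]
      gcongr
      exact Φ.norm_coe_le_norm θ
  have hL : ∀ Φ, L Φ = ∫ θ : ℝ, Φ θ * f θ ∂freq := fun _ => rfl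
  have hL0 : ∀ Φ, L Φ = 0 := by
    have h1 : (Submodule.span ℂ (Set.range (@fourier (2 * Real.pi)))).topologicalClosure
        ≤ LinearMap.ker L.toLinearMap := by
      refine Submodule.topologicalClosure_minimal _ (Submodule.span_le.2 ?_) L.isClosed_ker
      rintro _ ⟨n, rfl⟩
      change L (fourier n) = 0
      rw [hL, ← h (-n), fcoef]
      refine integral_congr_ae (.of_forall fun θ => ?_)
      simp only [fourier_coe_apply, neg_neg, expChar, mul_comm (f θ)]
      congr 2
      have := Real.pi_ne_zero
      push_cast
      field_simp
    intro Φ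
    rw [span_fourier_closure_eq_top] at h1
    exact h1 (Submodule.mem_top (x := Φ))
  have hfi : IntegrableOn f (Set.Ioc (-Real.pi) Real.pi) volume := by
    rw [freq, integrable_smul_measure (by simp [Real.pi_pos]) (by simp)] at hf
    exact hf
  have key := isOpen_Ioo (a := -Real.pi) (b := Real.pi)
    |>.ae_eq_zero_of_integral_contDiff_smul_eq_zero (f := f) (μ := volume)
      ((hfi.mono_set Set.Ioo_subset_Ioc_self).locallyIntegrableOn) fun g hg _ hgs => by
    have hg0 : ∀ θ, θ ∉ Set.Ioo (-Real.pi) Real.pi → g θ = 0 := fun θ hθ =>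
      image_eq_zero_of_notMem_tsupport fun h => hθ (hgs h)
    have h2 : -Real.pi + 2 * Real.pi = Real.pi := by ring
    -- A test function supported in the open interval vanishes at both ends, so it extends to a
    -- continuous function on the circle.
    have hc : Continuous (AddCircle.liftIoc (2 * Real.pi) (-Real.pi) fun θ => (g θ : ℂ)) := by
      refine AddCircle.liftIoc_continuous ?_ ?_
      · rw [h2, hg0 _ (by simp), hg0 _ (by simp)]
      · exact (Complex.continuous_ofReal.comp hg.continuous).continuousOn
    have h3 := hL0 ⟨_, hc⟩
    rw [hL, freq, integral_smul_measure] at h3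
    have h4 : ∫ θ in Set.Ioc (-Real.pi) Real.pi, g θ • f θ = 0 := by
      have h5 : (ENNReal.ofReal (1 / (2 * Real.pi))).toReal ≠ 0 := by
        rw [ENNReal.toReal_ofReal (by positivity)]; positivity
      rw [← (smul_eq_zero_iff_right h5).1 h3]
      refine setIntegral_congr_fun measurableSet_Ioc fun θ hθ => ?_
      simp only [ContinuousMap.coe_mk]
      rw [AddCircle.liftIoc_coe_apply (by rwa [h2])]
      simp
    rw [← h4, setIntegral_eq_integral_of_forall_compl_eq_zero]
    intro θ hθ
    rw [hg0 θ fun h => hθ (Set.Ioo_subset_Ioc_self h), zero_smul]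
  rw [freq]
  refine Measure.smul_absolutelyContinuous.ae_le ?_
  rw [Measure.restrict_congr_set Ioo_ae_eq_Ioc.symm]
  exact (ae_restrict_iff' measurableSet_Ioo).2 key

lemma memLp_expChar (n : ℤ) : MemLp (expChar n) 2 freq :=
  MemLp.of_bound (aesm_expChar n) 1 (.of_forall fun θ => (norm_expChar n θ).le)

lemma orthonormal_expChar :
    Orthonormal ℂ (fun n : ℤ => (memLp_expChar n).toLp : ℤ → Lp ℂ 2 freq) := by
  rw [orthonormal_iff_ite]
  intro m n
  rw [L2.inner_def]
  have : ∫ θ, inner ℂ ((memLp_expChar m).toLp _ θ) ((memLp_expChar n).toLp _ θ) ∂freq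
      = ∫ θ, expChar (n - m) θ ∂freq := by
    refine integral_congr_ae ?_
    filter_upwards [(memLp_expChar m).coeFn_toLp, (memLp_expChar n).coeFn_toLp] with θ h1 h2
    rw [h1, h2, RCLike.inner_apply, ← Complex.star_def, star_expChar, ← expChar_add,
      sub_eq_add_neg]
  rw [this, integral_expChar]
  simp [sub_eq_zero, eq_comm]

lemma inner_toLp_expChar {f : ℝ → ℂ} (hf : MemLp f 2 freq) (n : ℤ) :
    inner ℂ ((memLp_expChar n).toLp : Lp ℂ 2 freq) hf.toLp = fcoef f n := by
  rw [L2.inner_def]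
  refine integral_congr_ae ?_
  filter_upwards [(memLp_expChar n).coeFn_toLp, hf.coeFn_toLp] with θ h1 h2
  rw [h1, h2, RCLike.inner_apply, ← Complex.star_def, star_expChar]

/-- The characters as a Hilbert basis of `L₂`. -/
def charBasis : HilbertBasis ℤ ℂ (Lp ℂ 2 freq) :=
  HilbertBasis.mkOfOrthogonalEqBot orthonormal_expChar <| by
    rw [Submodule.eq_bot_iff]
    intro f hf
    have hmem := Lp.memLp f
    have h1 : hmem.toLp = f := Lp.toLp_coeFn f hmem
    have h2 : ∀ n, fcoef f n = 0 := fun n => by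
      rw [← inner_toLp_expChar hmem n, h1]
      exact (Submodule.mem_orthogonal _ _).1 hf _ (Submodule.subset_span ⟨n, rfl⟩)
    rw [Lp.eq_zero_iff_ae_eq_zero]
    exact ae_eq_zero_of_fcoef (hmem.integrable (by norm_num)) h2

/-- Parseval's identity. -/
lemma hasSum_fcoef_mul_fcoef {f g : ℝ → ℂ} (hf : MemLp f 2 freq) (hg : MemLp g 2 freq) :
    HasSum (fun n => fcoef f n * fcoef g (-n)) (∫ θ, f θ * g θ ∂freq) := by
  have hg' : MemLp (fun θ => star (g θ)) 2 freq := hg.star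
  have h1 := charBasis.hasSum_inner_mul_inner (hg'.toLp) (hf.toLp)
  have hb : ∀ n, charBasis n = ((memLp_expChar n).toLp : Lp ℂ 2 freq) := fun n => by
    rw [charBasis, HilbertBasis.coe_mkOfOrthogonalEqBot]
  have h2 : inner ℂ hg'.toLp hf.toLp = ∫ θ, f θ * g θ ∂freq := by
    rw [L2.inner_def]
    refine integral_congr_ae ?_
    filter_upwards [hf.coeFn_toLp, hg'.coeFn_toLp] with θ h1 h2
    rw [h1, h2, RCLike.inner_apply, ← Complex.star_def, star_star]
  rw [← h2]
  refine h1.congr_fun fun n => ?_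
  rw [hb, inner_toLp_expChar, ← inner_conj_symm, inner_toLp_expChar, ← Complex.star_def,
    fcoef_star, star_star, mul_comm]

/-- The vector of Fourier coefficients of a vector function. -/
def vcoef (f : VecFun T) (n : ℤ) : Fin T → ℂ := fun i => fcoef (fun θ => f θ i) n

lemma vcoef_sub {f g : VecFun T} (hf : ∀ i, Integrable (fun θ => f θ i) freq)
    (hg : ∀ i, Integrable (fun θ => g θ i) freq) (n : ℤ) :
    vcoef (f - g) n = vcoef f n - vcoef g n :=
  funext fun i => fcoef_sub (hf i) (hg i) n

lemma vcoef_congr {f g : VecFun T} (h : ∀ᵐ θ ∂freq, f θ = g θ) (n : ℤ) :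
    vcoef f n = vcoef g n := by
  ext i
  refine integral_congr_ae ?_
  filter_upwards [h] with θ hθ
  rw [hθ]

lemma integral_dotProduct_char {f : VecFun T} (hf : ∀ i, Integrable (fun θ => f θ i) freq)
    (n : ℤ) (v : Fin T → ℂ) :
    ∫ θ, f θ ⬝ᵥ star (expChar n θ • v) ∂freq = vcoef f n ⬝ᵥ star v := by
  simp only [dotProduct, vcoef, fcoef]
  rw [integral_finsetSum]
  · refine Finset.sum_congr rfl fun i _ => ?_
    rw [← integral_mul_const]
    simp only [Pi.star_apply, Pi.smul_apply, smul_eq_mul, star_mul', star_expChar, mul_assoc]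
  · intro i _
    simp only [Pi.star_apply, Pi.smul_apply, smul_eq_mul, star_mul', star_expChar, ← mul_assoc]
    exact (integrable_mul_expChar (hf i) _).mul_const _

lemma integrable_dotProduct_char {f : VecFun T} (hf : ∀ i, Integrable (fun θ => f θ i) freq)
    (n : ℤ) (v : Fin T → ℂ) :
    Integrable (fun θ => f θ ⬝ᵥ star (expChar n θ • v)) freq := by
  simp only [dotProduct]
  refine integrable_finsetSum _ fun i _ => ?_
  simp only [Pi.star_apply, Pi.smul_apply, smul_eq_mul, star_mul', star_expChar, ← mul_assoc]
  exact (integrable_mul_expChar (hf i) _).mul_const _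

lemma integral_dotProduct_trigPoly {f : VecFun T}
    (hf : ∀ i, Integrable (fun θ => f θ i) freq) (p : ℤ →₀ (Fin T → ℂ)) :
    ∫ θ, f θ ⬝ᵥ star (trigPoly p θ) ∂freq = p.sum fun k v => vcoef f k ⬝ᵥ star v := by
  simp only [trigPoly, Finsupp.sum, star_sum, dotProduct_sum]
  rw [integral_finsetSum _ fun i _ => integrable_dotProduct_char hf i _]
  exact Finset.sum_congr rfl fun i _ => integral_dotProduct_char hf i _

lemma vcoef_trigPoly (p : ℤ →₀ (Fin T → ℂ)) (n : ℤ) : vcoef (trigPoly p) n = p n := by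
  ext i
  simp only [vcoef, fcoef, trigPoly, Finsupp.sum, Finset.sum_apply, Pi.smul_apply, smul_eq_mul,
    Finset.sum_mul]
  rw [integral_finsetSum]
  · have : ∀ k ∈ p.support, ∫ θ, expChar k θ * p k i * expChar (-n) θ ∂freq
        = if k = n then p k i else 0 := fun k _ => by
      have h := fcoef_expChar k n
      rw [fcoef] at h
      simp only [mul_right_comm]
      rw [integral_mul_const, h]
      split_ifs <;> simp
    rw [Finset.sum_congr rfl this, Finset.sum_ite_eq']
    split_ifs with h
    · rfl
    · rw [Finsupp.notMem_support_iff.1 h]; rfl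
  · intro k _
    exact integrable_mul_expChar ((Integrable.of_bound (aesm_expChar k) 1 (.of_forall fun θ => (norm_expChar k θ).le)).mul_const _) _

/-! ### Fourier coefficients of elements of `L₂(W)` -/

section

variable {W : MatFun T} {h g : VecFun T}

lemma memL2_char (hW : IsSpectralDensity W) (n : ℤ) (v : Fin T → ℂ) :
    MemL2 W (fun θ => expChar n θ • v) := by
  rw [← trigPoly_single]; exact memL2_trigPoly hW _

lemma MemL2.integrable_vecMul (hW : IsSpectralDensity W) (hm : IsMinimal W) (hh : MemL2 W h)
    (i : Fin T) : Integrable (fun θ => (h θ ᵥ* W θ) i) freq :=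
  (hh.vecMul_self hW hm).integrable_apply (hm.inv_density hW) (hm.inv_minimal hW) i

/-- By duality the coefficient functionals are represented by elements of `L₂(W)`, which makes them
continuous in its norm. -/
lemma vcoef_eq_inner (hW : IsSpectralDensity W) (hm : IsMinimal W) (x : WL2 hW) (n : ℤ)
    (k : Fin T) : vcoef x.fn n k = inner ℂ (WL2.mk hW _
      ((memL2_char (hm.inv_density hW) n (Pi.single k 1)).vecMul_inv hW hm)) x := by
  rw [inner_vecMul_inv hW hm x (memL2_char (hm.inv_density hW) n (Pi.single k 1)),
    integral_dotProduct_char (x.mem.integrable_apply hW hm), dotProduct_star_single]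
  simp

/-- Fourier coefficients are continuous on `L₂(W)`. -/
lemma tendsto_vcoef (hW : IsSpectralDensity W) (hm : IsMinimal W) {x : ℕ → WL2 hW} {y : WL2 hW}
    (hx : Tendsto x atTop (𝓝 y)) (n : ℤ) :
    Tendsto (fun i => vcoef (x i).fn n) atTop (𝓝 (vcoef y.fn n)) := by
  rw [tendsto_pi_nhds]
  intro k
  simp only [vcoef_eq_inner hW hm]
  exact tendsto_const_nhds.inner hx

lemma inner_char (hW : IsSpectralDensity W) (hm : IsMinimal W) (z : WL2 hW) (n : ℤ)
    (v : Fin T → ℂ) : inner ℂ (WL2.mk hW _ (memL2_char hW n v)) z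
      = vcoef (fun θ => z.fn θ ᵥ* W θ) n ⬝ᵥ star v :=
  integral_dotProduct_char (z.mem.integrable_vecMul hW hm) n v

lemma inner_trigPoly (hW : IsSpectralDensity W) (hm : IsMinimal W) (z : WL2 hW)
    (p : ℤ →₀ (Fin T → ℂ)) : inner ℂ (WL2.mk hW _ (memL2_trigPoly hW p)) z
      = p.sum fun k v => vcoef (fun θ => z.fn θ ᵥ* W θ) k ⬝ᵥ star v :=
  integral_dotProduct_trigPoly (z.mem.integrable_vecMul hW hm) p

/-- The inner product of `z` with a character is a Fourier coefficient of `zᵀ W`, not of `z`. So a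
projection error `z` has its missing frequencies in the dual function `zᵀ W`. -/
lemma vcoef_vecMul_eq_zero (hW : IsSpectralDensity W) (hm : IsMinimal W) {Λ : Set ℤ}
    {z : WL2 hW} (hz : ∀ q ∈ polySpace hW Λ, inner ℂ q z = 0) {n : ℤ} (hn : n ∈ Λ) :
    vcoef (fun θ => z.fn θ ᵥ* W θ) n = 0 := by
  ext k
  have h1 := hz (WL2.mk hW _ (memL2_char hW n (Pi.single k 1)))
    ⟨Finsupp.single n (Pi.single k 1), fun i hi => by
      rw [Finset.mem_singleton.1 (Finsupp.support_single_subset hi)]; exact hn,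
      (trigPoly_single _ _).symm⟩
  rw [inner_char hW hm, dotProduct_star_single] at h1
  simpa using h1

lemma inner_eq_zero_of_mem_polySpace (hW : IsSpectralDensity W) (hm : IsMinimal W) {Λ : Set ℤ}
    {z q : WL2 hW} (hq : q ∈ polySpace hW Λ)
    (hz : ∀ n ∈ Λ, vcoef (fun θ => z.fn θ ᵥ* W θ) n = 0) : inner ℂ q z = 0 := by
  obtain ⟨p, hp, hqp⟩ := hq
  have : q = WL2.mk hW _ (memL2_trigPoly hW p) := Subtype.ext hqp
  rw [this, inner_trigPoly hW hm]
  refine Finset.sum_eq_zero fun k hk => ?_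
  dsimp only
  rw [hz k (hp hk), zero_dotProduct]

lemma vcoef_eq_zero_of_tendsto (hW : IsSpectralDensity W) (hm : IsMinimal W) {Λ : Set ℤ}
    {x : ℕ → WL2 hW} {y : WL2 hW} (hx : Tendsto x atTop (𝓝 y))
    (hp : ∀ i, x i ∈ polySpace hW Λ) {n : ℤ} (hn : n ∉ Λ) : vcoef y.fn n = 0 := by
  refine tendsto_nhds_unique (tendsto_vcoef hW hm hx n) ?_
  have : (fun i => vcoef (x i).fn n) = fun _ => 0 := by
    ext1 i
    obtain ⟨p, hps, hpi⟩ := hp i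
    rw [hpi, vcoef_trigPoly]
    exact Finsupp.notMem_support_iff.1 fun h => hn (hps h)
  rw [this]
  exact tendsto_const_nhds

end

/-! ### Szegő's outer functions -/

/-- A nonnegative function as a `1 × 1` weight. -/
def scalarWeight (μ : ℝ → ℝ) : MatFun 1 := fun θ => Matrix.diagonal fun _ => (μ θ : ℂ)

lemma form_scalarWeight (μ : ℝ → ℝ) (θ : ℝ) (x y : Fin 1 → ℂ) :
    form (scalarWeight μ θ) x y = x 0 * μ θ * star (y 0) := by
  simp [form, scalarWeight, dotProduct, Matrix.vecMul_diagonal]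

lemma scalarWeight_density {μ : ℝ → ℝ} (hi : Integrable μ freq) (h : ∀ θ, 1 ≤ μ θ) :
    IsSpectralDensity (scalarWeight μ) where
  integrable i j := by
    have : i = j := Subsingleton.elim _ _
    subst this
    exact (hi.ofReal (𝕜 := ℂ)).congr (.of_forall fun θ => by simp [scalarWeight])
  posSemidef := .of_forall fun θ => by
    rw [scalarWeight, Matrix.posSemidef_diagonal_iff]
    intro _
    exact_mod_cast zero_le_one.trans (h θ)

lemma scalarWeight_minimal {μ : ℝ → ℝ} (hi : Integrable μ freq) (h : ∀ θ, 1 ≤ μ θ) :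
    IsMinimal (scalarWeight μ) where
  invertible := .of_forall fun θ => by
    have : (μ θ : ℂ) ≠ 0 := by exact_mod_cast (zero_lt_one.trans_le (h θ)).ne'
    simp [scalarWeight, this]
  integrable i j := by
    have h1 : ∀ θ, (scalarWeight μ θ)⁻¹ i j = (((μ θ)⁻¹ : ℝ) : ℂ) := fun θ => by
      have h0 : (μ θ : ℂ) ≠ 0 := by exact_mod_cast (zero_lt_one.trans_le (h θ)).ne'
      have h2 : (scalarWeight μ θ)⁻¹ = Matrix.diagonal fun _ => ((μ θ : ℂ))⁻¹ := by
        refine Matrix.inv_eq_right_inv ?_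
        rw [scalarWeight, Matrix.diagonal_mul_diagonal]
        simp [h0]
      rw [h2, Subsingleton.elim j i]
      simp
    simp only [h1]
    have h3 : AEStronglyMeasurable (fun θ => (μ θ)⁻¹) freq :=
      hi.aestronglyMeasurable.aemeasurable.inv.aestronglyMeasurable
    have h4 : ∀ θ, ‖(μ θ)⁻¹‖ ≤ 1 := fun θ => by
      rw [norm_inv, Real.norm_eq_abs, abs_of_nonneg (zero_le_one.trans (h θ))]
      exact inv_le_one_of_one_le₀ (h θ)
    exact (Integrable.of_bound h3 1 (.of_forall h4)).ofReal

/-- For an integrable `m ≥ 0` there is `φ` with `‖φ‖² (1 + m)` constant, close to `1` in mean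
square, such that multiplication by `φ` does not create higher frequencies. -/
lemma exists_outer {m : ℝ → ℝ} (hm0 : ∀ θ, 0 ≤ m θ) (hmi : Integrable m freq) :
    ∃ φ : ℝ → ℂ, AEStronglyMeasurable φ freq ∧
      (∀ᵐ θ ∂freq, ‖φ θ‖ ^ 2 * (1 + m θ) ≤ 1 + ∫ θ, m θ ∂freq) ∧
      ∫ θ, ‖φ θ - 1‖ ^ 2 ∂freq ≤ ∫ θ, m θ ∂freq ∧
      ∀ (g : ℝ → ℂ) (K : ℝ), AEStronglyMeasurable g freq → (∀ θ, ‖g θ‖ ≤ K * (1 + m θ)) →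
        ∀ j : ℤ, (∀ n > j, fcoef g n = 0) → ∀ n > j, fcoef (fun θ => φ θ * g θ) n = 0 := by
  set μ : ℝ → ℝ := fun θ => 1 + m θ with hμ
  have hμi : Integrable μ freq := (integrable_const 1).add hmi
  have hμ1 : ∀ θ, 1 ≤ μ θ := fun θ => by simpa [hμ] using hm0 θ
  have hW := scalarWeight_density hμi hμ1
  have hmin := scalarWeight_minimal hμi hμ1
  have hform := form_scalarWeight μ
  set W := scalarWeight μ
  set x : WL2 hW := WL2.mk hW _ (memL2_char hW 0 1) with hx
  have hxfn : ∀ θ, x.fn θ = 1 := fun θ => by simp [hx]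
  -- Szegő's extremal problem: `φ` is the constant `1` minus its projection, in `L₂(μ)`, onto the
  -- closed span of the characters of negative frequency. It is a limit of polynomials with
  -- frequencies `≤ 0`.
  obtain ⟨y, ⟨p, hp, hpy⟩, horth, hle⟩ := exists_projection hW hmin {n | n < 0} x
  set z := x - y with hz
  have hzlim : Tendsto (fun i => x - p i) atTop (𝓝 z) := tendsto_const_nhds.sub hpy
  have hqmem : ∀ i, x - p i ∈ polySpace hW {n | n ≤ 0} := fun i => by
    refine Submodule.sub_mem _ ⟨Finsupp.single 0 1, fun k hk => ?_, (trigPoly_single _ _).symm⟩ ?_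
    · rw [Finset.mem_singleton.1 (Finsupp.support_single_subset hk)]; exact le_refl (0 : ℤ)
    · obtain ⟨q, hq, hqi⟩ := hp i
      exact ⟨q, fun k hk => (show k < 0 from hq hk).le, hqi⟩
  have hz0 : ∀ n < 0, vcoef (fun θ => z.fn θ ᵥ* W θ) n = 0 := fun n hn =>
    vcoef_vecMul_eq_zero hW hmin horth hn
  set φ : ℝ → ℂ := fun θ => z.fn θ 0 with hφ
  have hφm : AEStronglyMeasurable φ freq := aesm_apply z.mem.1 0
  have hzz : ∀ θ, form (W θ) (z.fn θ) (z.fn θ) = ((‖φ θ‖ ^ 2 * μ θ : ℝ) : ℂ) := fun θ => by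
    rw [hform, mul_right_comm, Complex.star_def, Complex.mul_conj,
      Complex.normSq_eq_norm_sq]
    push_cast; ring
  have hρi : Integrable (fun θ => ‖φ θ‖ ^ 2 * μ θ) freq := by
    have := z.mem.integrable_self hW
    simpa only [hzz, Complex.ofReal_re] using this
  have hρc : Integrable (fun θ => ((‖φ θ‖ ^ 2 * μ θ : ℝ) : ℂ)) freq := hρi.ofReal
  set c : ℝ := ∫ θ, ‖φ θ‖ ^ 2 * μ θ ∂freq with hc
  have hcz : ‖z‖ ^ 2 = c := by
    rw [WL2.norm_sq_eq_integral]; simp only [hzz, Complex.ofReal_re, hc]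
  have hcx : ‖x‖ ^ 2 = 1 + ∫ θ, m θ ∂freq := by
    rw [WL2.norm_sq_eq_integral]
    have : ∀ θ, (form (W θ) (x.fn θ) (x.fn θ)).re = μ θ := fun θ => by
      rw [hform, hxfn]; simp
    simp only [this, hμ]
    rw [integral_add (integrable_const _) hmi]; simp
  have hcle : c ≤ 1 + ∫ θ, m θ ∂freq := by
    rw [← hcz, ← hcx]; gcongr
  -- the density `‖φ‖² μ` is constant
  have hneg : ∀ n < 0, fcoef (fun θ => ((‖φ θ‖ ^ 2 * μ θ : ℝ) : ℂ)) n = 0 := fun n hn => by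
    -- The coefficient in question is the inner product of `z` with `ψ = e^{-inθ} z`. At `k ≤ 0` the
    -- coefficient of `ψ μ` is that of `z μ` at `k + n < 0`, which is zero by orthogonality; and `z`
    -- is a limit of polynomials with frequencies `≤ 0`.
    have hψ : MemL2 W (fun θ => expChar (-n) θ • z.fn θ) := by
      refine memL2_of_integrable ((aesm_expChar _).smul z.mem.1) ?_
      refine (z.mem.integrable_form hW z.mem).congr (.of_forall fun θ => ?_)
      dsimp only
      rw [form_smul_left, form_smul_right, star_expChar, ← mul_assoc, ← expChar_add]
      simp
    have h1 : inner ℂ z (WL2.mk hW _ hψ) = 0 := by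
      refine tendsto_nhds_unique (hzlim.inner tendsto_const_nhds) ?_
      have h2 : ∀ i, inner ℂ (x - p i) (WL2.mk hW _ hψ) = 0 := fun i => by
        refine inner_eq_zero_of_mem_polySpace hW hmin (hqmem i) fun k hk => ?_
        rw [← hz0 (k + n) (by have : k ≤ 0 := hk; omega)]
        ext j
        simp only [vcoef, fcoef, WL2.fn_mk, Matrix.smul_vecMul, Pi.smul_apply, smul_eq_mul]
        refine integral_congr_ae (.of_forall fun θ => ?_)
        dsimp only
        rw [neg_add, expChar_add]; ring
      simp only [h2]
      exact tendsto_const_nhds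
    rw [← h1, WL2.inner_def, fcoef]
    refine integral_congr_ae (.of_forall fun θ => ?_)
    dsimp only
    rw [WL2.fn_mk, form_smul_left, hzz, mul_comm]
  have hconst : ∀ᵐ θ ∂freq, ‖φ θ‖ ^ 2 * μ θ = c := by
    have h1 := ae_eq_zero_of_fcoef
      (f := (fun θ => ((‖φ θ‖ ^ 2 * μ θ : ℝ) : ℂ)) - fun θ => (c : ℂ) * expChar 0 θ)
      (hρc.sub (by simp)) fun n => by
      rw [fcoef_sub hρc (by simp), fcoef_mul_expChar]
      rcases lt_trichotomy n 0 with hn | hn | hn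
      · rw [hneg n hn]
        have := fcoef_expChar 0 n
        simp only [fcoef] at this ⊢
        rw [integral_const_mul]
        simp only [expChar_zero, one_mul, sub_zero] at this ⊢
        rw [this, if_neg hn.ne']; simp
      · subst hn
        have h2 : ∫ θ, ((‖φ θ‖ ^ 2 * μ θ : ℝ) : ℂ) ∂freq = (c : ℂ) := integral_ofReal
        simp only [fcoef, neg_zero, sub_zero, expChar_zero, mul_one]
        rw [h2]; simp
      · have h2 : fcoef (fun θ => ((‖φ θ‖ ^ 2 * μ θ : ℝ) : ℂ)) n = 0 := by
          have h3 := fcoef_star (fun θ => ((‖φ θ‖ ^ 2 * μ θ : ℝ) : ℂ)) n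
          rw [hneg (-n) (by omega), star_zero] at h3
          rw [← h3]
          simp only [Complex.star_def, Complex.conj_ofReal]
        rw [h2]
        have := fcoef_expChar 0 n
        simp only [fcoef] at this ⊢
        rw [integral_const_mul]
        simp only [expChar_zero, one_mul, sub_zero] at this ⊢
        rw [this, if_neg hn.ne]; simp
    filter_upwards [h1] with θ hθ
    simp only [Pi.sub_apply, expChar_zero, mul_one] at hθ
    exact_mod_cast sub_eq_zero.1 hθ
  -- the mean of `φ`
  have hφi : Integrable φ freq := z.mem.integrable_apply hW hmin 0
  have hmean : ∫ θ, φ θ ∂freq = 1 := by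
    have h1 : vcoef y.fn 0 = 0 :=
      vcoef_eq_zero_of_tendsto hW hmin hpy hp (by simp)
    have h2 := congrFun h1 0
    simp only [vcoef, fcoef, neg_zero, expChar_zero, mul_one, Pi.zero_apply] at h2
    have h3 : ∀ θ, φ θ = 1 - y.fn θ 0 := fun θ => by
      simp only [hφ, hz, WL2.fn_sub, Pi.sub_apply, hxfn, Pi.one_apply]
    simp only [h3]
    rw [integral_sub (integrable_const _) (y.mem.integrable_apply hW hmin 0), h2]
    simp
  have hφ2 : Integrable (fun θ => ‖φ θ‖ ^ 2) freq := by
    refine hρi.mono' (hφm.norm.pow 2) (.of_forall fun θ => ?_)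
    rw [Real.norm_eq_abs, abs_of_nonneg (by positivity)]
    nlinarith [hμ1 θ, sq_nonneg ‖φ θ‖]
  refine ⟨φ, hφm, ?_, ?_, ?_⟩
  · filter_upwards [hconst] with θ hθ
    exact hθ.le.trans hcle
  -- Since `φ` has mean `1`, the left side is the integral of `‖φ‖²` minus `1`, and `μ ≥ 1` bounds
  -- that integral by `c ≤ 1 + ∫ m`.
  · have h1 : ∀ θ, ‖φ θ - 1‖ ^ 2 = ‖φ θ‖ ^ 2 - 2 * (φ θ).re + 1 := fun θ => by
      rw [Complex.sq_norm, Complex.sq_norm, Complex.normSq_apply, Complex.normSq_apply]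
      simp; ring
    have hre : ∫ θ, (φ θ).re ∂freq = 1 := by
      have := integral_re hφi
      simp only [RCLike.re_to_complex] at this
      rw [this, hmean]; simp
    have h2 : ∫ θ, ‖φ θ - 1‖ ^ 2 ∂freq = ∫ θ, ‖φ θ‖ ^ 2 ∂freq - 1 := by
      have hrei : Integrable (fun θ => 2 * (φ θ).re) freq := hφi.re.const_mul 2
      simp only [h1]
      rw [integral_add (f := fun θ => ‖φ θ‖ ^ 2 - 2 * (φ θ).re) (hφ2.sub hrei)
        (integrable_const _), integral_sub hφ2 hrei, integral_const_mul, hre]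
      simp; ring
    have h3 : ∫ θ, ‖φ θ‖ ^ 2 ∂freq ≤ c :=
      integral_mono hφ2 hρi fun θ => by nlinarith [hμ1 θ, sq_nonneg ‖φ θ‖]
    linarith
  · intro g K hgm hgK j hg n hn
    have hμ0 : ∀ θ, (μ θ : ℂ) ≠ 0 := fun θ => by
      exact_mod_cast (zero_lt_one.trans_le (hμ1 θ)).ne'
    have hgi : Integrable g freq :=
      (hμi.const_mul K).mono' hgm (.of_forall fun θ => hgK θ)
    -- Division by `μ` makes `w` bounded by `K`. So `u ↦ ∫ u g e^{-inθ}` is continuous on `L₂(μ)`,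
    -- and it suffices to treat the polynomials approximating `φ`, for which only coefficients of
    -- `g` at `n - k ≥ n > j` occur.
    set w : VecFun 1 := fun θ _ => star (g θ * expChar (-n) θ) / μ θ with hw
    have hwm : MemL2 W w := by
      refine memL2_of_bounded (C := K) hW ?_ fun θ k => ?_
      · refine aesm_of_apply fun k => ?_
        exact ((continuous_star.comp_aestronglyMeasurable
          (hgm.mul (aesm_expChar _))).aemeasurable.div
          (Complex.measurable_ofReal.comp_aemeasurable
            hμi.aestronglyMeasurable.aemeasurable)).aestronglyMeasurable
      · rw [hw]
        simp only [norm_div, norm_star, norm_mul, norm_expChar, mul_one, Complex.norm_real,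
          Real.norm_eq_abs]
        have := zero_lt_one.trans_le (hμ1 θ)
        rw [abs_of_pos this, div_le_iff₀ this]
        exact hgK θ
    have h1 : ∀ u : WL2 hW, inner ℂ (WL2.mk hW w hwm) u
        = ∫ θ, u.fn θ 0 * (g θ * expChar (-n) θ) ∂freq := fun u => by
      rw [WL2.inner_def]
      refine integral_congr_ae (.of_forall fun θ => ?_)
      dsimp only
      rw [hform, WL2.fn_mk, hw]
      simp only [star_div₀, star_star]
      have : star (μ θ : ℂ) = μ θ := Complex.conj_ofReal _
      rw [this]
      field_simp [hμ0 θ]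
    have h2 : ∀ i, inner ℂ (WL2.mk hW w hwm) (x - p i) = 0 := fun i => by
      obtain ⟨q, hq, hqi⟩ := hqmem i
      rw [h1, hqi]
      have h3 : ∀ θ, trigPoly q θ 0 * (g θ * expChar (-n) θ)
          = q.sum fun k v => g θ * expChar (k - n) θ * v 0 := fun θ => by
        simp only [trigPoly, Finsupp.sum, Finset.sum_apply, Pi.smul_apply, smul_eq_mul,
          Finset.sum_mul]
        refine Finset.sum_congr rfl fun k _ => ?_
        rw [sub_eq_add_neg, expChar_add]; ring
      simp only [h3, Finsupp.sum]
      rw [integral_finsetSum _ fun k _ => (integrable_mul_expChar hgi _).mul_const _]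
      refine Finset.sum_eq_zero fun k hk => ?_
      have h4 := hg (n - k) (by have : k ≤ 0 := hq hk; omega)
      rw [fcoef, neg_sub] at h4
      rw [integral_mul_const, h4, zero_mul]
    have h5 : inner ℂ (WL2.mk hW w hwm) z = 0 := by
      refine tendsto_nhds_unique (tendsto_const_nhds.inner hzlim) ?_
      simp only [h2]
      exact tendsto_const_nhds
    rw [← h5, h1, fcoef]
    simp only [hφ, mul_assoc]

/-- Outer functions `φ N → 1` that tame an integrable `m ≥ 0`. -/
lemma exists_outer_seq {m : ℝ → ℝ} (hm0 : ∀ θ, 0 ≤ m θ) (hmi : Integrable m freq) :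
    ∃ (φ : ℕ → ℝ → ℂ) (B : ℝ) (c : ℕ → ℝ), 0 ≤ B ∧ (∀ N, AEStronglyMeasurable (φ N) freq) ∧
      (∀ N, ∀ᵐ θ ∂freq, ‖φ N θ‖ ≤ B) ∧ (∀ N, ∀ᵐ θ ∂freq, ‖φ N θ‖ ^ 2 * m θ ≤ c N) ∧
      (∀ᵐ θ ∂freq, Tendsto (fun N => φ N θ) atTop (𝓝 1)) ∧
      ∀ (N : ℕ) (g : ℝ → ℂ), AEStronglyMeasurable g freq → (∀ θ, ‖g θ‖ ≤ m θ) →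
        ∀ j : ℤ, (∀ n > j, fcoef g n = 0) → ∀ n > j, fcoef (fun θ => φ N θ * g θ) n = 0 := by
  set I := ∫ θ, m θ ∂freq with hI
  have hI0 : 0 ≤ I := integral_nonneg hm0
  have hε : ∀ N : ℕ, (0 : ℝ) < 1 / (N + 1) := fun N => by positivity
  -- With `m / (N + 1)` in place of `m`, the mean square distance of `φ` to `1` is at most `I / (N +
  -- 1)`, while `‖φ‖² m` is still bounded, by `(1 + I)(N + 1)`.
  choose φ hφm hφ1 hφ2 hφ3 using fun N : ℕ =>
    exists_outer (m := fun θ => 1 / ((N : ℝ) + 1) * m θ)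
      (fun θ => mul_nonneg (hε N).le (hm0 θ)) (hmi.const_mul _)
  simp only [integral_const_mul, ← hI] at hφ1 hφ2
  have hεI : ∀ N : ℕ, 1 / ((N : ℝ) + 1) * I ≤ I := fun N => by
    refine mul_le_of_le_one_left hI0 ?_
    rw [div_le_one (by positivity)]
    linarith [(Nat.cast_nonneg N : (0 : ℝ) ≤ N)]
  have hsq : ∀ N, ∀ᵐ θ ∂freq, ‖φ N θ‖ ^ 2 ≤ 1 + I := fun N => by
    filter_upwards [hφ1 N] with θ hθ
    have h1 : 0 ≤ ‖φ N θ‖ ^ 2 * (1 / ((N : ℝ) + 1) * m θ) :=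
      mul_nonneg (sq_nonneg _) (mul_nonneg (hε N).le (hm0 θ))
    linarith [hεI N]
  have hbd : ∀ N, ∀ᵐ θ ∂freq, ‖φ N θ‖ ≤ √(1 + I) := fun N => by
    filter_upwards [hsq N] with θ hθ using Real.le_sqrt_of_sq_le hθ
  have hmeas : TendstoInMeasure freq φ atTop (fun _ => 1) := by
    refine tendstoInMeasure_of_tendsto_eLpNorm (p := 2) (by norm_num) hφm
      aestronglyMeasurable_const ?_
    have h1 : ∀ N, eLpNorm (φ N - fun _ => 1) 2 freq
        = ENNReal.ofReal ((∫ θ, ‖φ N θ - 1‖ ^ 2 ∂freq) ^ (1 / 2 : ℝ)) := fun N => by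
      have h2 : MemLp (φ N - fun _ => 1) 2 freq :=
        (MemLp.of_bound (hφm N) _ (hbd N)).sub (memLp_const 1)
      rw [h2.eLpNorm_eq_integral_rpow_norm (by norm_num) (by norm_num)]
      simp
    simp only [h1]
    rw [← ENNReal.ofReal_zero]
    refine ENNReal.tendsto_ofReal ?_
    have h3 : Tendsto (fun N => ∫ θ, ‖φ N θ - 1‖ ^ 2 ∂freq) atTop (𝓝 0) := by
      refine squeeze_zero (fun N => integral_nonneg fun θ => by positivity) hφ2 ?_
      simpa using (tendsto_one_div_add_atTop_nhds_zero_nat (𝕜 := ℝ)).mul_const I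
    have h4 := (Real.continuous_rpow_const (q := (1 / 2 : ℝ)) (by norm_num)).tendsto 0
    have h5 := h4.comp h3
    simpa [Function.comp_def] using h5
  obtain ⟨ns, -, hns⟩ := hmeas.exists_seq_tendsto_ae
  refine ⟨fun N => φ (ns N), √(1 + I), fun N => (1 + I) * (ns N + 1), Real.sqrt_nonneg _,
    fun N => hφm _, fun N => hbd _, fun N => ?_, hns, fun N g hg hgm j hgj => ?_⟩
  · filter_upwards [hφ1 (ns N)] with θ hθ
    have h1 : (0 : ℝ) < (ns N : ℝ) + 1 := by positivity
    have h2 : ‖φ (ns N) θ‖ ^ 2 * m θ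
        = ‖φ (ns N) θ‖ ^ 2 * (1 / ((ns N : ℝ) + 1) * m θ) * (ns N + 1) := by
      field_simp
    rw [h2]
    gcongr
    nlinarith [sq_nonneg ‖φ (ns N) θ‖, hεI (ns N)]
  · refine hφ3 (ns N) g (ns N + 1) hg (fun θ => ?_) j hgj
    have h1 : (0 : ℝ) < (ns N : ℝ) + 1 := by positivity
    refine (hgm θ).trans ?_
    have h2 : ((ns N : ℝ) + 1) * (1 + 1 / ((ns N : ℝ) + 1) * m θ) = (ns N + 1) + m θ := by
      field_simp
    rw [h2]; linarith

/-- Two integrable functions whose product is integrable and whose frequencies lie in a set `Λ`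
of negative integers with finite complement, respectively in the complement of `Λ`, are
orthogonal. -/
lemma integral_dotProduct_star_eq_zero {Λ : Set ℤ} {b : ℕ} (hneg : ∀ n ∈ Λ, n < 0)
    (hbot : ∀ n : ℤ, n < -b → n ∈ Λ) {d v : VecFun T}
    (hd : ∀ k, Integrable (fun θ => d θ k) freq) (hv : ∀ k, Integrable (fun θ => v θ k) freq)
    (hdv : Integrable (fun θ => d θ ⬝ᵥ star (v θ)) freq)
    (hd0 : ∀ n ∉ Λ, vcoef d n = 0) (hv0 : ∀ n ∈ Λ, vcoef v n = 0) :
    ∫ θ, d θ ⬝ᵥ star (v θ) ∂freq = 0 := by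
  set m : ℝ → ℝ := fun θ => ∑ k, (‖d θ k‖ + ‖v θ k‖) with hm
  have hm0 : ∀ θ, 0 ≤ m θ := fun θ => Finset.sum_nonneg fun k _ => by positivity
  have hmi : Integrable m freq :=
    integrable_finsetSum _ fun k _ => (hd k).norm.add (hv k).norm
  have hdm : ∀ k θ, ‖d θ k‖ ≤ m θ := fun k θ =>
    (le_add_of_nonneg_right (norm_nonneg _)).trans
      (Finset.single_le_sum (f := fun k => ‖d θ k‖ + ‖v θ k‖) (fun _ _ => by positivity)
        (Finset.mem_univ k))
  have hvm : ∀ k θ, ‖star (v θ k)‖ ≤ m θ := fun k θ => by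
    rw [norm_star]
    exact (le_add_of_nonneg_left (norm_nonneg _)).trans
      (Finset.single_le_sum (f := fun k => ‖d θ k‖ + ‖v θ k‖) (fun _ _ => by positivity)
        (Finset.mem_univ k))
  have hvi : ∀ k, Integrable (fun θ => star (v θ k)) freq := fun k =>
    (hv k).mono (continuous_star.comp_aestronglyMeasurable (hv k).aestronglyMeasurable)
      (.of_forall fun θ => by simp)
  obtain ⟨φ, B, c, hB, hφm, hφB, hφc, hφ1, hφ⟩ := exists_outer_seq hm0 hmi
  -- From `‖g‖ ≤ m` follows `‖φ g‖² ≤ ‖φ‖² m ‖g‖ ≤ c N ‖g‖`, which is integrable.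
  have hL2 : ∀ N (g : ℝ → ℂ), Integrable g freq → (∀ θ, ‖g θ‖ ≤ m θ) →
      MemLp (fun θ => φ N θ * g θ) 2 freq := fun N g hg hgm => by
    refine (memLp_two_iff_integrable_sq_norm (f := fun θ => φ N θ * g θ)
      ((hφm N).mul hg.aestronglyMeasurable)).2 ?_
    refine (hg.norm.const_mul (c N)).mono'
      (((hφm N).mul hg.aestronglyMeasurable).norm.pow 2) ?_
    filter_upwards [hφc N] with θ hθ
    rw [Real.norm_eq_abs, abs_of_nonneg (by positivity), norm_mul, mul_pow, sq ‖g θ‖, ← mul_assoc]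
    gcongr
    refine le_trans ?_ hθ
    gcongr
    exact hgm θ
  have hlim : ∀ (g : ℝ → ℂ), Integrable g freq → ∀ n,
      Tendsto (fun N => fcoef (fun θ => φ N θ * g θ) n) atTop (𝓝 (fcoef g n)) := fun g hg n => by
    refine tendsto_integral_of_dominated_convergence (fun θ => B * ‖g θ‖)
      (fun N => ((hφm N).mul hg.aestronglyMeasurable).mul (aesm_expChar _))
      (hg.norm.const_mul B) (fun N => ?_) ?_
    · filter_upwards [hφB N] with θ hθ
      rw [norm_mul, norm_mul, norm_expChar, mul_one]
      gcongr
    · filter_upwards [hφ1] with θ hθ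
      simpa using (hθ.mul_const (g θ)).mul_const (expChar (-n) θ)
  -- Both `d` and the conjugate of `v` have frequencies bounded above, by `-1` and by `b`. Hence the
  -- same `φ N` may multiply both, giving `φ²` rather than `‖φ‖²`, and Parseval leaves only the
  -- finitely many `n` with `-b ≤ n < 0`.
  have hpar : ∀ N, ∫ θ, φ N θ ^ 2 * (d θ ⬝ᵥ star (v θ)) ∂freq
      = ∑ k, ∑ n ∈ Finset.Ico (-(b : ℤ)) 0, fcoef (fun θ => φ N θ * d θ k) n
        * fcoef (fun θ => φ N θ * star (v θ k)) (-n) := fun N => by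
    have h1 : ∀ k, ∫ θ, (φ N θ * d θ k) * (φ N θ * star (v θ k)) ∂freq
        = ∑ n ∈ Finset.Ico (-(b : ℤ)) 0, fcoef (fun θ => φ N θ * d θ k) n
          * fcoef (fun θ => φ N θ * star (v θ k)) (-n) := fun k => by
      refine (hasSum_fcoef_mul_fcoef (hL2 N _ (hd k) (hdm k))
        (hL2 N _ (hvi k) (hvm k))).unique (hasSum_sum_of_ne_finset_zero fun n hn => ?_)
      rw [Finset.mem_Ico, not_and_or, not_le, not_lt] at hn
      rcases hn with hn | hn
      · rw [hφ N _ (hvi k).aestronglyMeasurable (hvm k) b ?_ (-n) (by omega), mul_zero]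
        intro j hj
        rw [fcoef_star]
        have := congrFun (hv0 (-j) (hbot _ (by omega))) k
        rw [vcoef] at this
        rw [this]; simp
      · rw [hφ N _ (hd k).aestronglyMeasurable (hdm k) (-1) ?_ n (by omega), zero_mul]
        intro j hj
        exact congrFun (hd0 j fun h => by have := hneg j h; omega) k
    simp only [← h1]
    have h2 : ∀ k, Integrable (fun θ => (φ N θ * d θ k) * (φ N θ * star (v θ k))) freq :=
      fun k => (hL2 N _ (hd k) (hdm k)).integrable_mul (hL2 N _ (hvi k) (hvm k))
    rw [← integral_finsetSum _ fun k _ => h2 k]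
    refine integral_congr_ae (.of_forall fun θ => ?_)
    simp only [dotProduct, Finset.mul_sum, Pi.star_apply]
    exact Finset.sum_congr rfl fun k _ => by ring
  have hlim1 : Tendsto (fun N => ∫ θ, φ N θ ^ 2 * (d θ ⬝ᵥ star (v θ)) ∂freq) atTop
      (𝓝 (∫ θ, d θ ⬝ᵥ star (v θ) ∂freq)) := by
    refine tendsto_integral_of_dominated_convergence (fun θ => B ^ 2 * ‖d θ ⬝ᵥ star (v θ)‖)
      (fun N => ((hφm N).pow 2).mul hdv.aestronglyMeasurable) (hdv.norm.const_mul _)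
      (fun N => ?_) ?_
    · filter_upwards [hφB N] with θ hθ
      rw [norm_mul, norm_pow]
      gcongr
    · filter_upwards [hφ1] with θ hθ
      simpa using (hθ.pow 2).mul_const (d θ ⬝ᵥ star (v θ))
  -- In the limit each of the finitely many terms contains a vanishing coefficient: of `v` if `n ∈
  -- Λ`, of `d` otherwise.
  have hlim2 : Tendsto (fun N => ∫ θ, φ N θ ^ 2 * (d θ ⬝ᵥ star (v θ)) ∂freq) atTop (𝓝 0) := by
    simp only [hpar]
    have h0 : (0 : ℂ) = ∑ k, ∑ n ∈ Finset.Ico (-(b : ℤ)) 0, fcoef (fun θ => d θ k) n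
        * fcoef (fun θ => star (v θ k)) (-n) := by
      refine (Finset.sum_eq_zero fun k _ => Finset.sum_eq_zero fun n _ => ?_).symm
      by_cases hn : n ∈ Λ
      · have := congrFun (hv0 n hn) k
        rw [vcoef] at this
        rw [fcoef_star, neg_neg, this]; simp
      · have := congrFun (hd0 n hn) k
        rw [vcoef] at this
        rw [this]; simp
    rw [h0]
    exact tendsto_finsetSum _ fun k _ => tendsto_finsetSum _ fun n _ =>
      (hlim _ (hd k) n).mul (hlim _ (hvi k) (-n))
  exact tendsto_nhds_unique hlim1 hlim2

/-! ### `L₂ˢ(W)` in terms of Fourier coefficients -/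

section closure

variable {S : Set ℤ}

lemma mem_unobserved_iff {n : ℤ} : n ∈ unobserved S ↔ n ∉ observed S := by
  simp only [unobserved, observed, Set.mem_union, Set.mem_ofPred_eq, not_and_or, not_not, not_lt]
  tauto

/-- This is the form in which finiteness of the gap is used: far enough in the past every time is
observed. -/
lemma exists_lower_bound_missing {s : ℕ} (M N : Fin s → ℕ) :
    ∃ b : ℕ, ∀ n ∈ missing M N, -(b : ℤ) ≤ n := by
  refine ⟨∑ l, (M l + N l), fun n hn => ?_⟩
  obtain ⟨l, hl⟩ := Set.mem_iUnion.1 hn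
  have h1 : M l + N l ≤ ∑ l, (M l + N l) :=
    Finset.single_le_sum (f := fun l => M l + N l) (fun _ _ => Nat.zero_le _) (Finset.mem_univ l)
  have h2 : ((M l + N l : ℕ) : ℤ) ≤ ((∑ l, (M l + N l) : ℕ) : ℤ) := by exact_mod_cast h1
  have := hl.1
  push_cast at h2 ⊢
  omega

lemma dotProduct_star_vecMul {M : Matrix (Fin T) (Fin T) ℂ} (hM : M.PosSemidef)
    (x : Fin T → ℂ) : x ⬝ᵥ star (x ᵥ* M) = form M x x := by
  have h1 := star_form x x hM.1
  rw [← h1, form, ← Matrix.star_dotProduct_star, star_star]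

variable {b : ℕ} (hb : ∀ n ∈ S, -(b : ℤ) ≤ n)
include hb

lemma orthogonal_of_vcoef {d v : VecFun T}
    (hd : ∀ k, Integrable (fun θ => d θ k) freq) (hv : ∀ k, Integrable (fun θ => v θ k) freq)
    (hdv : Integrable (fun θ => d θ ⬝ᵥ star (v θ)) freq)
    (hd0 : ∀ n ∈ unobserved S, vcoef d n = 0) (hv0 : ∀ n ∈ observed S, vcoef v n = 0) :
    ∫ θ, d θ ⬝ᵥ star (v θ) ∂freq = 0 :=
  integral_dotProduct_star_eq_zero (Λ := observed S) (b := b) (fun n hn => hn.1)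
    (fun n hn => ⟨by omega, fun h => by have := hb n h; omega⟩) hd hv hdv
    (fun n hn => hd0 n (mem_unobserved_iff.2 hn)) hv0

variable {W : MatFun T} (hW : IsSpectralDensity W) (hm : IsMinimal W)

include hW hm

/-- Let `y` be the projection of `x` onto the observed polynomials. Then `d = x - y` has no
frequencies in `U` and `dᵀ W` has none in the complement, so they are orthogonal, which says `‖d‖ =
0`. -/
lemma exists_seq_observed (x : WL2 hW) (hx : ∀ n ∈ unobserved S, vcoef x.fn n = 0) :
    ∃ p : ℕ → WL2 hW, (∀ n, p n ∈ polySpace hW (observed S)) ∧ Tendsto p atTop (𝓝 x) := by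
  obtain ⟨y, ⟨p, hp, hpy⟩, horth, -⟩ := exists_projection hW hm (observed S) x
  have hx1 := x.mem.integrable_apply hW hm
  have hy1 := y.mem.integrable_apply hW hm
  have h0 : ‖x - y‖ ^ 2 = 0 := by
    have h1 := orthogonal_of_vcoef hb ((x - y).mem.integrable_apply hW hm)
      ((x - y).mem.integrable_vecMul hW hm)
      ((x - y).mem.integrable_dual hW hm ((x - y).mem.vecMul_self hW hm))
      (fun n hn => by
        rw [WL2.fn_sub, vcoef_sub hx1 hy1, hx n hn,
          vcoef_eq_zero_of_tendsto hW hm hpy hp (mem_unobserved_iff.1 hn), sub_zero])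
      (fun n hn => vcoef_vecMul_eq_zero hW hm horth hn)
    rw [@norm_sq_eq_re_inner ℂ, WL2.inner_def]
    have h2 : ∫ θ, form (W θ) ((x - y).fn θ) ((x - y).fn θ) ∂freq
        = ∫ θ, (x - y).fn θ ⬝ᵥ star ((x - y).fn θ ᵥ* W θ) ∂freq := by
      refine integral_congr_ae ?_
      filter_upwards [hW.posSemidef] with θ hθ
      exact (dotProduct_star_vecMul hθ _).symm
    rw [h2, h1]; simp
  refine ⟨p, hp, ?_⟩
  rw [tendsto_iff_norm_sub_tendsto_zero] at hpy ⊢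
  refine squeeze_zero (fun _ => norm_nonneg _) (fun i => ?_) hpy
  have h1 : p i - x = (p i - y) - (x - y) := by abel
  rw [h1]
  refine (norm_sub_le _ _).trans ?_
  rw [pow_eq_zero_iff two_ne_zero |>.1 h0, add_zero]

/-- The same argument with the roles of `x - y` and `(x - y)ᵀ W` exchanged. It serves, with the
weight `W⁻¹`, to approximate the residual `C` by polynomials on `U`. -/
lemma exists_seq_unobserved (x : WL2 hW) (hx : ∀ n ∈ observed S, vcoef x.fn n = 0) :
    ∃ p : ℕ → WL2 hW, (∀ n, p n ∈ polySpace hW (unobserved S)) ∧ Tendsto p atTop (𝓝 x) := by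
  obtain ⟨y, ⟨p, hp, hpy⟩, horth, -⟩ := exists_projection hW hm (unobserved S) x
  have hx1 := x.mem.integrable_apply hW hm
  have hy1 := y.mem.integrable_apply hW hm
  have h0 : ‖x - y‖ ^ 2 = 0 := by
    have h1 := orthogonal_of_vcoef hb ((x - y).mem.integrable_vecMul hW hm)
      ((x - y).mem.integrable_apply hW hm) ((x - y).mem.integrable_form hW (x - y).mem)
      (fun n hn => vcoef_vecMul_eq_zero hW hm horth hn)
      (fun n hn => by
        rw [WL2.fn_sub, vcoef_sub hx1 hy1, hx n hn,
          vcoef_eq_zero_of_tendsto hW hm hpy hp fun h => mem_unobserved_iff.1 h hn, sub_zero])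
    rw [@norm_sq_eq_re_inner ℂ, WL2.inner_def]
    have h2 : ∫ θ, form (W θ) ((x - y).fn θ) ((x - y).fn θ) ∂freq = 0 := h1
    rw [h2]; simp
  refine ⟨p, hp, ?_⟩
  rw [tendsto_iff_norm_sub_tendsto_zero] at hpy ⊢
  refine squeeze_zero (fun _ => norm_nonneg _) (fun i => ?_) hpy
  have h1 : p i - x = (p i - y) - (x - y) := by abel
  rw [h1]
  refine (norm_sub_le _ _).trans ?_
  rw [pow_eq_zero_iff two_ne_zero |>.1 h0, add_zero]

/-- The elements of `L₂ˢ(W)` are the elements of `L₂(W)` with frequencies in `ℤ₋ \ S`. -/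
lemma memL2s_iff {h : VecFun T} :
    MemL2s S W h ↔ MemL2 W h ∧ ∀ n ∈ unobserved S, vcoef h n = 0 := by
  constructor
  · rintro ⟨h1, h2⟩
    refine ⟨h1, fun n hn => ?_⟩
    choose p hp hpε using fun i : ℕ => h2 (ENNReal.ofReal (1 / ((i : ℝ) + 1)))
      (ENNReal.ofReal_pos.2 (by positivity))
    refine vcoef_eq_zero_of_tendsto hW hm (y := WL2.mk hW h h1)
      (x := fun i => WL2.mk hW _ (memL2_trigPoly hW (p i))) ?_ (fun i => ⟨p i, hp i, rfl⟩)
      (mem_unobserved_iff.1 hn)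
    have h3 : Tendsto (fun i => WL2.mk hW h h1 - WL2.mk hW _ (memL2_trigPoly hW (p i))) atTop
        (𝓝 0) := by
      rw [WL2.tendsto_iff_sqNorm]
      refine tendsto_of_tendsto_of_tendsto_of_le_of_le tendsto_const_nhds ?_
        (fun i => zero_le) (fun i => (le_of_eq ?_).trans (hpε i).le)
      · rw [← ENNReal.ofReal_zero]
        exact ENNReal.tendsto_ofReal tendsto_one_div_add_atTop_nhds_zero_nat
      · congr 1
        exact sub_zero _
    simpa using (tendsto_const_nhds (x := WL2.mk hW h h1)).sub h3
  · rintro ⟨h1, h2⟩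
    refine ⟨h1, fun ε hε => ?_⟩
    obtain ⟨p, hp, hpx⟩ := exists_seq_observed hb hW hm (WL2.mk hW h h1) h2
    have h3 : Tendsto (fun i => WL2.mk hW h h1 - p i) atTop (𝓝 (WL2.mk hW h h1 -
      WL2.mk hW h h1)) := tendsto_const_nhds.sub hpx
    rw [sub_self, WL2.tendsto_iff_sqNorm] at h3
    obtain ⟨i, hi⟩ := (h3.eventually_lt_const hε).exists
    obtain ⟨q, hq, hqi⟩ := hp i
    refine ⟨q, hq, ?_⟩
    rw [← hqi]
    convert hi using 2
    exact (sub_zero _).symm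

end closure

/-! ### The symbol `A` -/

section symbol

variable {S : Set ℤ} {a : ℤ → Fin T → ℂ}

lemma SummableCoeff.norm (ha : SummableCoeff S a) : Summable fun j => ‖coeff S a j‖ := by
  refine Summable.of_nonneg_of_le (fun j => norm_nonneg _) (fun j => ?_) ha
  exact (pi_norm_le_iff_of_nonneg (Finset.sum_nonneg fun _ _ => norm_nonneg _)).2 fun k =>
    Finset.single_le_sum (f := fun k => ‖coeff S a j k‖) (fun _ _ => norm_nonneg _)
      (Finset.mem_univ k)

lemma norm_char_smul (n : ℤ) (θ : ℝ) (v : Fin T → ℂ) : ‖expChar n θ • v‖ = ‖v‖ := by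
  rw [norm_smul, norm_expChar, one_mul]

lemma hasSum_symbolA (ha : SummableCoeff S a) (θ : ℝ) :
    HasSum (fun j : ℤ => expChar (-j) θ • coeff S a j) (symbolA S a θ) :=
  (Summable.of_norm (by simpa only [norm_char_smul] using ha.norm)).hasSum

lemma continuous_symbolA (ha : SummableCoeff S a) : Continuous (symbolA S a) :=
  continuous_tsum (fun j : ℤ => (continuous_expChar (-j)).smul continuous_const) ha.norm
    fun _ _ => (norm_char_smul _ _ _).le

lemma symbolA_bounded (ha : SummableCoeff S a) :
    ∀ θ k, ‖symbolA S a θ k‖ ≤ ∑' j, ‖coeff S a j‖ := fun _ k =>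
  (norm_le_pi_norm _ k).trans (tsum_of_norm_bounded ha.norm.hasSum
    fun _ => (norm_char_smul _ _ _).le)

lemma memL2_symbolA (ha : SummableCoeff S a) {W : MatFun T} (hW : IsSpectralDensity W) :
    MemL2 W (symbolA S a) :=
  memL2_of_bounded hW (continuous_symbolA ha).aestronglyMeasurable (symbolA_bounded ha)

/-- Termwise integration of the series for `A`. -/
lemma hasSum_integral_symbolA (ha : SummableCoeff S a) {f : VecFun T}
    (hf : ∀ i, Integrable (fun θ => f θ i) freq) :
    HasSum (fun j : ℤ => ∫ θ, (expChar (-j) θ • coeff S a j) ⬝ᵥ f θ ∂freq)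
      (∫ θ, symbolA S a θ ⬝ᵥ f θ ∂freq) := by
  have hint : ∀ j : ℤ, Integrable (fun θ => (expChar (-j) θ • coeff S a j) ⬝ᵥ f θ) freq := by
    intro j
    simp only [dotProduct, Pi.smul_apply, smul_eq_mul]
    refine integrable_finsetSum _ fun i _ => ?_
    refine ((integrable_mul_expChar (hf i) (-j)).const_mul (coeff S a j i)).congr
      (.of_forall fun θ => ?_)
    dsimp only; ring
  have hbd : ∀ (j : ℤ) θ, ‖(expChar (-j) θ • coeff S a j) ⬝ᵥ f θ‖
      ≤ ‖coeff S a j‖ * ∑ i, ‖f θ i‖ := fun j θ => by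
    simp only [dotProduct, Finset.mul_sum]
    refine (norm_sum_le _ _).trans (Finset.sum_le_sum fun i _ => ?_)
    rw [norm_mul]
    gcongr
    rw [← norm_char_smul (-j) θ]
    exact norm_le_pi_norm _ i
  have hfs : Integrable (fun θ => ∑ i, ‖f θ i‖) freq :=
    integrable_finsetSum _ fun i _ => (hf i).norm
  have h1 := hasSum_integral_of_summable_integral_norm hint
    (Summable.of_nonneg_of_le (fun j => integral_nonneg fun θ => norm_nonneg _)
      (fun j => (integral_mono (hint j).norm (hfs.const_mul _) (hbd j)).trans_eq
        (integral_const_mul _ _)) (ha.norm.mul_right _))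
  have h3 : ∫ θ, symbolA S a θ ⬝ᵥ f θ ∂freq
      = ∫ θ, ∑' j : ℤ, (expChar (-j) θ • coeff S a j) ⬝ᵥ f θ ∂freq := ?_
  · rw [h3]; exact h1
  refine integral_congr_ae (.of_forall fun θ => ?_)
  have h2 := (hasSum_symbolA ha θ).map
    (⟨⟨fun v => v ⬝ᵥ f θ, zero_dotProduct _⟩, fun u v => add_dotProduct u v _⟩ :
      (Fin T → ℂ) →+ ℂ) (by
        change Continuous fun v : Fin T → ℂ => v ⬝ᵥ f θ
        unfold dotProduct; fun_prop)
  exact h2.tsum_eq.symm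

end symbol

/-! ### Comparison of forms -/

section pointwise

variable {F G : Matrix (Fin T) (Fin T) ℂ} (x y A C : Fin T → ℂ)

lemma form_vecMul_left (M : Matrix (Fin T) (Fin T) ℂ) :
    form F (x ᵥ* M) y = form (M * F) x y := by
  rw [form, Matrix.vecMul_vecMul, form]

/-- `F W⁻¹ F ≤ F` for `W = F + G`. -/
lemma form_vecMul_mul_inv_le (hF : F.PosSemidef) (hG : G.PosSemidef)
    (hu : IsUnit (F + G).det) :
    (form (F + G) (x ᵥ* (F * (F + G)⁻¹)) (x ᵥ* (F * (F + G)⁻¹))).re ≤ (form F x x).re := by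
  set u := x ᵥ* (F * (F + G)⁻¹) with hudef
  -- By `norm_form_le` this is at most half of `form F x x + form F u u`, and `form F u u` is at
  -- most the left side because `G` is positive semidefinite.
  have h1 : form (F + G) u u = form F x u := by
    rw [hudef, form_vecMul_left, Matrix.mul_assoc, Matrix.nonsing_inv_mul _ hu, Matrix.mul_one]
  have h2 := norm_form_le x u hF
  have h3 : (form (F + G) u u).re = (form F u u).re + (form G u u).re := by
    rw [form_add_mat, Complex.add_re]
  have h4 := form_self_re_nonneg u hG
  have h5 := Complex.re_le_norm (form F x u)
  rw [← h1] at h2 h5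
  linarith

/-- Expansion of the error density around `h`. -/
lemma error_expand (hF : F.PosSemidef) (hG : G.PosSemidef) (h h' : Fin T → ℂ)
    (hC : C = A ᵥ* F - h ᵥ* (F + G)) :
    (form F (A - h') (A - h')).re + (form G h' h').re
      = (form F (A - h) (A - h)).re + (form G h h).re
        + (form (F + G) (h' - h) (h' - h)).re - 2 * (C ⬝ᵥ star (h' - h)).re := by
  set d := h' - h with hd
  have e1 : A - h' = (A - h) - d := by rw [hd]; abel
  have e2 : h' = h + d := by rw [hd]; abel
  have e3 : C ⬝ᵥ star d = form F (A - h) d - form G h d := by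
    rw [hC, form, form, ← sub_dotProduct, Matrix.sub_vecMul, Matrix.vecMul_add, sub_sub]
  have e4 : form F d (A - h) = star (form F (A - h) d) := (star_form _ _ hF.1).symm
  have e5 : form G d h = star (form G h d) := (star_form _ _ hG.1).symm
  rw [e1, e2, e3, form_add_mat]
  simp only [form_sub_left _ (A - h) d, form_sub_right _ _ (A - h) d, form_add_left, form_add_right,
    e4, e5]
  simp
  ring

lemma form_mul_inv_mul_self (hF : F.PosSemidef) (hG : G.PosSemidef)
    (hu : IsUnit (F + G).det) :
    form (F * (F + G)⁻¹ * G) x x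
      = form F x x - form (F + G) (x ᵥ* (F * (F + G)⁻¹)) (x ᵥ* (F * (F + G)⁻¹)) := by
  set W := F + G with hWdef
  have hW : W.PosSemidef := hF.add hG
  set u := x ᵥ* (F * W⁻¹) with hudef
  have huW : u ᵥ* W = x ᵥ* F := by
    rw [hudef, Matrix.vecMul_vecMul, Matrix.mul_assoc, Matrix.nonsing_inv_mul _ hu,
      Matrix.mul_one]
  have h1 : F * W⁻¹ * G = F - F * W⁻¹ * F := by
    have hg : G = W - F := by rw [hWdef]; abel
    rw [hg, Matrix.mul_sub, Matrix.mul_assoc, Matrix.nonsing_inv_mul _ hu, Matrix.mul_one]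
  have h2 : form (F * W⁻¹ * F) x x = form W u u := by
    rw [← form_vecMul_left, ← hudef, ← star_form _ _ hF.1, ← star_form u u hW.1, form, form, huW]
  rw [h1, ← h2]
  simp [form, Matrix.vecMul_sub, sub_dotProduct]

/-- The error density of the estimate with `hᵀ = (Aᵀ F - Cᵀ) (F + G)⁻¹`. -/
lemma error_eq (hF : F.PosSemidef) (hG : G.PosSemidef) (hu : IsUnit (F + G).det)
    (h : Fin T → ℂ) (hC : C = A ᵥ* F - h ᵥ* (F + G)) :
    (form F (A - h) (A - h)).re + (form G h h).re
      = (form (F * (F + G)⁻¹ * G) A A).re + (form (F + G)⁻¹ C C).re := by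
  set W := F + G with hWdef
  have hW : W.PosSemidef := hF.add hG
  set u := A ᵥ* (F * W⁻¹) with hudef
  have huW : u ᵥ* W = A ᵥ* F := by
    rw [hudef, Matrix.vecMul_vecMul, Matrix.mul_assoc, Matrix.nonsing_inv_mul _ hu,
      Matrix.mul_one]
  -- Completing the square: the error is the part that `u` cannot remove plus the squared
  -- `W`-distance of `h` to `u`.
  have hCu : C ᵥ* W⁻¹ = u - h := by
    rw [hC, Matrix.sub_vecMul, Matrix.vecMul_vecMul, Matrix.vecMul_vecMul,
      Matrix.mul_nonsing_inv _ hu, Matrix.vecMul_one]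
  have e1 : form W⁻¹ C C = form W (u - h) (u - h) := by
    rw [← form_inv_inv C C hW hu, hCu]
  have e2 : form (F * W⁻¹ * G) A A = form F A A - form W u u :=
    form_mul_inv_mul_self A hF hG hu
  have e6 : ∀ v, form W u v = form F A v := fun v => by rw [form, form, huW]
  have e7 : form F h A = star (form F A h) := (star_form _ _ hF.1).symm
  have e8 : form W h u = star (form F A h) := by rw [← star_form _ _ hW.1, e6]
  rw [e1, e2]
  simp only [form_sub_left, form_sub_right, e6, e7, e8]
  rw [hWdef, form_add_mat]
  simp
  ring

end pointwise

lemma integrable_star {f : ℝ → ℂ} (hf : Integrable f freq) :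
    Integrable (fun θ => star (f θ)) freq :=
  hf.mono (continuous_star.comp_aestronglyMeasurable hf.aestronglyMeasurable)
    (.of_forall fun θ => by simp)

section densities

variable {F G : MatFun T} {h : VecFun T}

lemma MemL2.mono {W X : MatFun T} (hh : MemL2 W h)
    (hle : ∀ᵐ θ ∂freq, (form (X θ) (h θ) (h θ)).re ≤ (form (W θ) (h θ) (h θ)).re) :
    MemL2 X h := by
  refine ⟨hh.1, lt_of_le_of_lt (lintegral_mono_ae ?_) hh.2⟩
  filter_upwards [hle] with θ hθ
  exact ENNReal.ofReal_le_ofReal hθ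

lemma MemL2.left (hG : IsSpectralDensity G) (hh : MemL2 (F + G) h) : MemL2 F h := by
  refine hh.mono ?_
  filter_upwards [hG.posSemidef] with θ hθ
  rw [Pi.add_apply, form_add_mat, Complex.add_re]
  linarith [form_self_re_nonneg (h θ) hθ]

lemma MemL2.right (hF : IsSpectralDensity F) (hh : MemL2 (F + G) h) : MemL2 G h := by
  rw [add_comm] at hh; exact hh.left hF

lemma sqNorm_eq_ofReal {W : MatFun T} (hW : IsSpectralDensity W) (hh : MemL2 W h) :
    sqNorm W h = ENNReal.ofReal (∫ θ, (form (W θ) (h θ) (h θ)).re ∂freq) := by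
  have := WL2.sqNorm_eq (WL2.mk hW h hh)
  rwa [WL2.norm_sq_eq_integral] at this

variable {A : VecFun T}

/-- `Aᵀ F (F + G)⁻¹ ∈ L₂(F + G)`. -/
lemma memL2_vecMul_mul_inv (hF : IsSpectralDensity F) (hG : IsSpectralDensity G)
    (hm : IsMinimal (F + G)) (hA : MemL2 F A) :
    MemL2 (F + G) (fun θ => A θ ᵥ* (F θ * (F θ + G θ)⁻¹)) := by
  refine ⟨(hF.meas.mul hm.meas_inv).vecMul hA.1, lt_of_le_of_lt (lintegral_mono_ae ?_) hA.2⟩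
  filter_upwards [hF.posSemidef, hG.posSemidef, hm.invertible] with θ h1 h2 h3
  exact ENNReal.ofReal_le_ofReal (form_vecMul_mul_inv_le _ h1 h2 h3)

/-- `Aᵀ F ∈ L₂((F + G)⁻¹)`. -/
lemma memL2_vecMul_dual (hF : IsSpectralDensity F) (hG : IsSpectralDensity G)
    (hm : IsMinimal (F + G)) (hA : MemL2 F A) :
    MemL2 (fun θ => ((F + G) θ)⁻¹) (fun θ => A θ ᵥ* F θ) := by
  have h1 := (memL2_vecMul_mul_inv hF hG hm hA).vecMul_self (hF.add hG) hm
  refine ⟨hF.meas.vecMul hA.1, lt_of_le_of_lt (le_of_eq ?_) h1.2⟩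
  refine lintegral_congr_ae ?_
  filter_upwards [hm.invertible] with θ h3
  have h4 : A θ ᵥ* (F θ * (F θ + G θ)⁻¹) ᵥ* (F + G) θ = A θ ᵥ* F θ := by
    rw [Matrix.vecMul_vecMul, Matrix.mul_assoc,
      show (F θ + G θ)⁻¹ * (F + G) θ = 1 from Matrix.nonsing_inv_mul _ h3, Matrix.mul_one]
  rw [h4]

/-- Both factors are merely integrable, but the rows of `F W⁻¹` lie in `L₂(W)` and thus have
integrable entries. -/
lemma integrable_mul_inv (hF : IsSpectralDensity F) (hG : IsSpectralDensity G)
    (hm : IsMinimal (F + G)) (i j : Fin T) :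
    Integrable (fun θ => (F θ * (F θ + G θ)⁻¹) i j) freq := by
  have h1 : MemL2 F (fun _ => Pi.single i 1) := by
    simpa using memL2_char hF 0 (Pi.single i 1)
  have h2 := (memL2_vecMul_mul_inv hF hG hm h1).integrable_apply (hF.add hG) hm j
  refine h2.congr (.of_forall fun θ => ?_)
  dsimp only
  rw [Matrix.single_one_vecMul]
  rfl

/-- Since `G = W - F`, the product is `F - F W⁻¹ F`, and the entries of `F W⁻¹ F` are the `W`-forms
of pairs of rows of `F W⁻¹`. -/
lemma integrable_mul_inv_mul (hF : IsSpectralDensity F) (hG : IsSpectralDensity G)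
    (hm : IsMinimal (F + G)) (i j : Fin T) :
    Integrable (fun θ => (F θ * (F θ + G θ)⁻¹ * G θ) i j) freq := by
  have h1 : ∀ i, MemL2 F (fun _ => Pi.single i 1) := fun i => by
    simpa using memL2_char hF 0 (Pi.single i 1)
  have h2 := (memL2_vecMul_mul_inv hF hG hm (h1 i)).integrable_form (hF.add hG)
    (memL2_vecMul_mul_inv hF hG hm (h1 j))
  refine ((hF.integrable i j).sub h2).congr ?_
  filter_upwards [hF.posSemidef, hG.posSemidef, hm.invertible] with θ h3 h4 h5
  have h5' : IsUnit (F θ + G θ).det := h5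
  have e1 : F θ * (F θ + G θ)⁻¹ * G θ = F θ - F θ * (F θ + G θ)⁻¹ * F θ := by
    have hg : G θ = (F θ + G θ) - F θ := by abel
    rw [eq_sub_iff_add_eq, ← Matrix.mul_add, add_comm (G θ), Matrix.mul_assoc,
      Matrix.nonsing_inv_mul _ h5', Matrix.mul_one]
  have e2 : form ((F + G) θ) (Pi.single i 1 ᵥ* (F θ * (F θ + G θ)⁻¹))
      (Pi.single j 1 ᵥ* (F θ * (F θ + G θ)⁻¹)) = (F θ * (F θ + G θ)⁻¹ * F θ) i j := by
    rw [Pi.add_apply, ← Matrix.vecMul_vecMul (Pi.single j 1), form_inv_right _ _ (h3.add h4) h5',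
      Matrix.star_vecMul, h3.1.eq, Matrix.dotProduct_mulVec, Matrix.vecMul_vecMul,
      dotProduct_star_single, Matrix.single_one_vecMul]
    simp [Matrix.row]
  rw [Pi.sub_apply, e2, e1]
  rfl

end densities

/-! ### The optimal characteristic -/

/-- The orthogonality conditions for `h(F, G)`: `h` has frequencies in `ℤ₋ \ S`, and
`Aᵀ F - hᵀ (F + G)` has frequencies in the complement. -/
structure IsSolution (S : Set ℤ) (a : ℤ → Fin T → ℂ) (F G : MatFun T) (h : VecFun T) :
    Prop where
  memL2 : MemL2 (F + G) h
  vcoef_eq_zero : ∀ n ∈ unobserved S, vcoef h n = 0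
  residual : ∀ n ∈ observed S,
    vcoef (fun θ => symbolA S a θ ᵥ* F θ - h θ ᵥ* (F θ + G θ)) n = 0

section solution

variable {S : Set ℤ} {a : ℤ → Fin T → ℂ} {F G : MatFun T} {h h' : VecFun T} {b : ℕ}

lemma memL2_residual (ha : SummableCoeff S a) (hF : IsSpectralDensity F)
    (hG : IsSpectralDensity G) (hm : IsMinimal (F + G)) (hh : MemL2 (F + G) h) :
    MemL2 (fun θ => ((F + G) θ)⁻¹)
      (fun θ => symbolA S a θ ᵥ* F θ - h θ ᵥ* (F θ + G θ)) :=
  (memL2_vecMul_dual hF hG hm (memL2_symbolA ha hF)).sub (hm.inv_density (hF.add hG))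
    (hh.vecMul_self (hF.add hG) hm)

/-- Take the projection in `L₂(W)` of `Aᵀ F W⁻¹` onto the closed span of the observed characters.
The residual is the projection error multiplied by `W`. -/
lemma exists_isSolution (ha : SummableCoeff S a) (hF : IsSpectralDensity F)
    (hG : IsSpectralDensity G) (hm : IsMinimal (F + G)) : ∃ h, IsSolution S a F G h := by
  have hW := hF.add hG
  obtain ⟨y, ⟨p, hp, hpy⟩, horth, -⟩ := exists_projection hW hm (observed S)
    (WL2.mk hW _ (memL2_vecMul_mul_inv hF hG hm (memL2_symbolA ha hF)))
  refine ⟨y.fn, y.mem, fun n hn => vcoef_eq_zero_of_tendsto hW hm hpy hp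
    (mem_unobserved_iff.1 hn), fun n hn => ?_⟩
  rw [← vcoef_vecMul_eq_zero hW hm horth hn]
  refine vcoef_congr ?_ n
  filter_upwards [hm.invertible] with θ h3
  have h3' : IsUnit (F θ + G θ).det := h3
  rw [WL2.fn_sub, Pi.sub_apply, WL2.fn_mk, Matrix.sub_vecMul, Matrix.vecMul_vecMul,
    Pi.add_apply, Matrix.mul_assoc, Matrix.nonsing_inv_mul _ h3', Matrix.mul_one]

lemma mse_eq_ofReal (ha : SummableCoeff S a) (hF : IsSpectralDensity F)
    (hG : IsSpectralDensity G) (hh : MemL2 (F + G) h) :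
    mse S a h F G = ENNReal.ofReal (∫ θ, ((form (F θ) (symbolA S a θ - h θ)
      (symbolA S a θ - h θ)).re + (form (G θ) (h θ) (h θ)).re) ∂freq) := by
  have h1 : MemL2 F (symbolA S a - h) := (memL2_symbolA ha hF).sub hF (hh.left hG)
  have h2 : MemL2 G h := hh.right hF
  rw [mse, sqNorm_eq_ofReal hF h1, sqNorm_eq_ofReal hG h2, ← ENNReal.ofReal_add,
    ← integral_add (h1.integrable_self hF) (h2.integrable_self hG)]
  · rfl
  · refine integral_nonneg_of_ae ?_
    filter_upwards [hF.posSemidef] with θ hθ using form_self_re_nonneg _ hθ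
  · refine integral_nonneg_of_ae ?_
    filter_upwards [hG.posSemidef] with θ hθ using form_self_re_nonneg _ hθ

lemma mse_lt_top (ha : SummableCoeff S a) (hF : IsSpectralDensity F)
    (hG : IsSpectralDensity G) (hh : MemL2 (F + G) h) : mse S a h F G < ∞ := by
  rw [mse_eq_ofReal ha hF hG hh]; exact ENNReal.ofReal_lt_top

lemma IsSolution.integral_residual (hb : ∀ n ∈ S, -(b : ℤ) ≤ n) (ha : SummableCoeff S a)
    (hF : IsSpectralDensity F) (hG : IsSpectralDensity G) (hm : IsMinimal (F + G))
    (hs : IsSolution S a F G h) (hh' : MemL2 (F + G) h')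
    (h0 : ∀ n ∈ unobserved S, vcoef h' n = 0) :
    ∫ θ, (symbolA S a θ ᵥ* F θ - h θ ᵥ* (F θ + G θ)) ⬝ᵥ star (h' θ) ∂freq = 0 := by
  have hW := hF.add hG
  have hC := memL2_residual ha hF hG hm hs.memL2
  have h1 := orthogonal_of_vcoef hb (hh'.integrable_apply hW hm)
    (hC.integrable_apply (hm.inv_density hW) (hm.inv_minimal hW))
    (hh'.integrable_dual hW hm hC) h0 hs.residual
  have h2 := congrArg (starRingEnd ℂ) h1
  rw [← integral_conj, map_zero] at h2
  rw [← h2]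
  refine integral_congr_ae (.of_forall fun θ => ?_)
  dsimp only
  rw [← Complex.star_def, ← Matrix.star_dotProduct_star, star_star]

/-- Pythagoras: the excess error over the optimal one. -/
lemma IsSolution.mse_eq_add (hb : ∀ n ∈ S, -(b : ℤ) ≤ n) (ha : SummableCoeff S a)
    (hF : IsSpectralDensity F) (hG : IsSpectralDensity G) (hm : IsMinimal (F + G))
    (hs : IsSolution S a F G h) (hh' : MemL2 (F + G) h')
    (h0 : ∀ n ∈ unobserved S, vcoef h' n = 0) :
    mse S a h' F G = mse S a h F G + sqNorm (F + G) (h' - h) := by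
  have hW := hF.add hG
  have hd : MemL2 (F + G) (h' - h) := hh'.sub hW hs.memL2
  have hd0 : ∀ n ∈ unobserved S, vcoef (h' - h) n = 0 := fun n hn => by
    rw [vcoef_sub (hh'.integrable_apply hW hm) (hs.memL2.integrable_apply hW hm), h0 n hn,
      hs.vcoef_eq_zero n hn, sub_zero]
  have hC := memL2_residual ha hF hG hm hs.memL2
  have hi3 : Integrable (fun θ => (symbolA S a θ ᵥ* F θ - h θ ᵥ* (F θ + G θ))
      ⬝ᵥ star ((h' - h) θ)) freq := by
    refine (integrable_star (hd.integrable_dual hW hm hC)).congr (.of_forall fun θ => ?_)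
    dsimp only
    rw [← Matrix.star_dotProduct_star, star_star]
  have hz : ∫ θ, ((symbolA S a θ ᵥ* F θ - h θ ᵥ* (F θ + G θ)) ⬝ᵥ star ((h' - h) θ)).re ∂freq
      = 0 := by
    have h1 := hs.integral_residual hb ha hF hG hm hd hd0
    have h2 := integral_re hi3
    rw [h1] at h2
    simpa using h2
  have hi1 : Integrable (fun θ => (form (F θ) (symbolA S a θ - h θ)
      (symbolA S a θ - h θ)).re + (form (G θ) (h θ) (h θ)).re) freq :=
    (((memL2_symbolA ha hF).sub hF (hs.memL2.left hG)).integrable_self hF).add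
      ((hs.memL2.right hF).integrable_self hG)
  have hi2 := hd.integrable_self hW
  rw [mse_eq_ofReal ha hF hG hh', mse_eq_ofReal ha hF hG hs.memL2, sqNorm_eq_ofReal hW hd,
    ← ENNReal.ofReal_add]
  · congr 1
    have h4 : ∫ θ, 2 * ((symbolA S a θ ᵥ* F θ - h θ ᵥ* (F θ + G θ))
        ⬝ᵥ star ((h' - h) θ)).re ∂freq = 0 := by
      rw [integral_const_mul, hz, mul_zero]
    have hi4 : Integrable (fun θ => 2 * ((symbolA S a θ ᵥ* F θ - h θ ᵥ* (F θ + G θ))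
        ⬝ᵥ star ((h' - h) θ)).re) freq := hi3.re.const_mul 2
    have h7 := integral_sub (hi1.add hi2) hi4
    rw [h4, sub_zero] at h7
    refine Eq.trans ?_ (h7.trans (integral_add hi1 hi2))
    refine integral_congr_ae ?_
    filter_upwards [hF.posSemidef, hG.posSemidef] with θ h5 h6
    exact error_expand (symbolA S a θ) _ h5 h6 (h θ) (h' θ) rfl
  · refine integral_nonneg_of_ae ?_
    filter_upwards [hF.posSemidef, hG.posSemidef] with θ h5 h6
    exact add_nonneg (form_self_re_nonneg _ h5) (form_self_re_nonneg _ h6)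
  · refine integral_nonneg_of_ae ?_
    filter_upwards [hW.posSemidef] with θ h5 using form_self_re_nonneg _ h5

lemma IsSolution.isOptimal (hb : ∀ n ∈ S, -(b : ℤ) ≤ n) (ha : SummableCoeff S a)
    (hF : IsSpectralDensity F) (hG : IsSpectralDensity G) (hm : IsMinimal (F + G))
    (hs : IsSolution S a F G h) : IsOptimal S a F G h := by
  have hW := hF.add hG
  refine ⟨(memL2s_iff hb hW hm).2 ⟨hs.memL2, hs.vcoef_eq_zero⟩, fun h' hh' => ?_⟩
  obtain ⟨h1, h2⟩ := (memL2s_iff hb hW hm).1 hh'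
  rw [hs.mse_eq_add hb ha hF hG hm h1 h2]
  exact le_self_add

lemma IsOptimal.optimalMse_eq (ho : IsOptimal S a F G h) :
    optimalMse S a F G = mse S a h F G :=
  le_antisymm (iInf₂_le h ho.1) (le_iInf₂ fun h' hh' => ho.2 h' hh')

/-! ### The operators -/

lemma vcoef_vecMul_const {X : MatFun T} (hX : ∀ i j, Integrable (fun θ => X θ i j) freq)
    (v : Fin T → ℂ) (m n : ℤ) :
    vcoef (fun θ => (expChar m θ • v) ᵥ* X θ) n = v ᵥ* fourierMat X (n - m) := by
  ext j
  simp only [vcoef, fcoef, Matrix.vecMul, dotProduct, fourierMat, Matrix.of_apply,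
    Pi.smul_apply, smul_eq_mul]
  simp only [← integral_const_mul, Finset.sum_mul]
  rw [integral_finsetSum]
  · refine Finset.sum_congr rfl fun i _ => integral_congr_ae (.of_forall fun θ => ?_)
    dsimp only
    rw [show -(n - m) = m + -n by ring, expChar_add]; ring
  · intro i _
    refine ((integrable_mul_expChar (hX i j) (m + -n)).const_mul (v i)).congr
      (.of_forall fun θ => ?_)
    dsimp only
    rw [expChar_add]; ring

/-- `B` is multiplication by `W⁻¹` in the frequency domain, so operator equations become conditions
on Fourier coefficients. -/
lemma opB_eq_vcoef (hm : IsMinimal (F + G)) (c : ℤ →₀ (Fin T → ℂ)) (k : ℤ) :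
    opB F G c k = vcoef (fun θ => trigPoly c θ ᵥ* ((F + G) θ)⁻¹) k := by
  have hX := hm.integrable
  have h1 : ∀ j, vcoef (fun θ => (expChar j θ • c j) ᵥ* ((F + G) θ)⁻¹) k
      = c j ᵥ* matB F G k j := fun j => vcoef_vecMul_const hX (c j) j k
  simp only [opB, Finsupp.sum, ← h1]
  ext i
  simp only [Finset.sum_apply, vcoef, fcoef]
  rw [← integral_finsetSum]
  · refine integral_congr_ae (.of_forall fun θ => ?_)
    simp only [trigPoly, Finsupp.sum, Matrix.sum_vecMul, Finset.sum_apply, Finset.sum_mul]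
  · intro j _
    refine integrable_mul_expChar ?_ _
    simp only [Matrix.vecMul, dotProduct, Pi.smul_apply, smul_eq_mul]
    refine integrable_finsetSum _ fun l _ => ?_
    refine ((integrable_mul_expChar (hX l i) j).const_mul (c j l)).congr (.of_forall fun θ => ?_)
    dsimp only; ring

lemma opRa_eq_vcoef (ha : SummableCoeff S a) (hF : IsSpectralDensity F)
    (hG : IsSpectralDensity G) (hm : IsMinimal (F + G)) (k : ℤ) :
    opRa S a F G k = vcoef (fun θ => symbolA S a θ ᵥ* (F θ * (F θ + G θ)⁻¹)) k := by
  have hX := integrable_mul_inv hF hG hm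
  rw [opRa]
  refine HasSum.tsum_eq (Pi.hasSum.2 fun i => ?_)
  have h1 := hasSum_integral_symbolA ha
    (f := fun θ l => (F θ * (F θ + G θ)⁻¹) l i * expChar (-k) θ)
    (fun l => integrable_mul_expChar (hX l i) _)
  have h2 : vcoef (fun θ => symbolA S a θ ᵥ* (F θ * (F θ + G θ)⁻¹)) k i
      = ∫ θ, symbolA S a θ ⬝ᵥ (fun l => (F θ * (F θ + G θ)⁻¹) l i * expChar (-k) θ) ∂freq := by
    simp only [vcoef, fcoef, Matrix.vecMul, dotProduct, Finset.sum_mul, mul_assoc]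
  rw [h2]
  refine h1.congr_fun fun j => ?_
  have h3 := congrFun (vcoef_vecMul_const hX (coeff S a j) (-j) k) i
  rw [sub_neg_eq_add] at h3
  refine h3.symm.trans ?_
  simp only [vcoef, fcoef, Matrix.vecMul, dotProduct, Finset.sum_mul, mul_assoc]

lemma formQ_eq_integral (ha : SummableCoeff S a) (hF : IsSpectralDensity F)
    (hG : IsSpectralDensity G) (hm : IsMinimal (F + G)) :
    formQ S a F G = ∫ θ, form (F θ * (F θ + G θ)⁻¹ * G θ) (symbolA S a θ) (symbolA S a θ)
      ∂freq := by
  have hX := integrable_mul_inv_mul hF hG hm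
  set X : MatFun T := fun θ => F θ * (F θ + G θ)⁻¹ * G θ with hXdef
  have hvX : ∀ (m : ℤ) (v : Fin T → ℂ) i,
      Integrable (fun θ => ((expChar m θ • v) ᵥ* X θ) i) freq := fun m v i => by
    simp only [Matrix.vecMul, dotProduct, Pi.smul_apply, smul_eq_mul]
    refine integrable_finsetSum _ fun l _ => ?_
    refine ((integrable_mul_expChar (hX l i) m).const_mul (v l)).congr (.of_forall fun θ => ?_)
    dsimp only; ring
  have h1 : ∀ j, ∑' k, (coeff S a j ᵥ* matQ F G j k) ⬝ᵥ star (coeff S a k)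
      = ∫ θ, form (X θ) (expChar (-j) θ • coeff S a j) (symbolA S a θ) ∂freq := fun j => by
    refine HasSum.tsum_eq ?_
    have h2 := hasSum_integral_symbolA ha
      (f := fun θ => star ((expChar (-j) θ • coeff S a j) ᵥ* X θ))
      (fun i => integrable_star (hvX (-j) (coeff S a j) i))
    have h3 := h2.star
    have h4 : ∀ u : VecFun T, star (∫ θ, u θ ⬝ᵥ star ((expChar (-j) θ • coeff S a j) ᵥ* X θ)
        ∂freq) = ∫ θ, form (X θ) (expChar (-j) θ • coeff S a j) (u θ) ∂freq := fun u => by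
      rw [Complex.star_def, ← integral_conj]
      refine integral_congr_ae (.of_forall fun θ => ?_)
      dsimp only
      rw [← Complex.star_def, ← Matrix.star_dotProduct_star, star_star]
      rfl
    rw [h4] at h3
    refine h3.congr_fun fun k => ?_
    rw [h4]
    refine Eq.symm ((integral_dotProduct_char (hvX (-j) (coeff S a j)) (-k) _).trans ?_)
    rw [vcoef_vecMul_const hX, matQ, show -k - -j = j - k by ring]
  rw [formQ]
  simp only [h1]
  have hA := symbolA_bounded ha
  have hAm : ∀ i, AEStronglyMeasurable (fun θ => star (symbolA S a θ i)) freq := fun i =>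
    continuous_star.comp_aestronglyMeasurable
      (aesm_apply (continuous_symbolA ha).aestronglyMeasurable i)
  have h5 := hasSum_integral_symbolA ha (f := fun θ => X θ *ᵥ star (symbolA S a θ)) fun i => by
    simp only [Matrix.mulVec, dotProduct]
    refine integrable_finsetSum _ fun l _ => ?_
    exact (hX i l).mul_bdd (c := ∑' j, ‖coeff S a j‖) (hAm l) (.of_forall fun θ => by
      rw [Pi.star_apply, norm_star]; exact hA θ l)
  simp only [Matrix.dotProduct_mulVec] at h5
  exact h5.tsum_eq

end solution

section operators

variable {S : Set ℤ} {a : ℤ → Fin T → ℂ} {F G : MatFun T} {b : ℕ}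

lemma tendsto_vcoef_vecMul {W : MatFun T} (hW : IsSpectralDensity W) (hm : IsMinimal W)
    {x : ℕ → WL2 hW} {y : WL2 hW} (hx : Tendsto x atTop (𝓝 y)) (n : ℤ) :
    Tendsto (fun i => vcoef (fun θ => (x i).fn θ ᵥ* W θ) n) atTop
      (𝓝 (vcoef (fun θ => y.fn θ ᵥ* W θ) n)) := by
  have h1 : ∀ (z : WL2 hW) k, vcoef (fun θ => z.fn θ ᵥ* W θ) n k
      = inner ℂ (WL2.mk hW _ (memL2_char hW n (Pi.single k 1))) z := fun z k => by
    rw [inner_char hW hm, dotProduct_star_single]; simp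
  rw [tendsto_pi_nhds]
  intro k
  simp only [h1]
  exact tendsto_const_nhds.inner hx

/-- The functions `∑ b(k) e^{ikθ}` that occur in the operator formulas. -/
lemma exists_approximates (hb : ∀ n ∈ S, -(b : ℤ) ≤ n) (ha : SummableCoeff S a)
    (hF : IsSpectralDensity F) (hG : IsSpectralDensity G) (hm : IsMinimal (F + G))
    {h : VecFun T} (hs : IsSolution S a F G h) : ∃ c β, Approximates S a F G c β
      (fun θ => symbolA S a θ ᵥ* F θ - h θ ᵥ* (F θ + G θ)) := by
  have hW := hF.add hG
  have hV := hm.inv_density hW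
  have hmV := hm.inv_minimal hW
  have hC := memL2_residual ha hF hG hm hs.memL2
  set C : VecFun T := fun θ => symbolA S a θ ᵥ* F θ - h θ ᵥ* (F θ + G θ) with hCdef
  -- The residual lies in `L₂(W⁻¹)` and has frequencies in `U` only; the coefficients of the
  -- approximating polynomials are the required finitely supported sequences.
  obtain ⟨p, hp, hpC⟩ := exists_seq_unobserved hb hV hmV (WL2.mk hV C hC) hs.residual
  choose c hc hpc using hp
  refine ⟨c, vcoef C, hc, hC.1, fun k => ?_, ?_, fun k hk => ?_⟩
  · have h1 := tendsto_vcoef hV hmV hpC k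
    simp only [hpc, vcoef_trigPoly] at h1
    exact h1
  · have h1 := WL2.tendsto_iff_sqNorm.1 hpC
    simp only [hpc] at h1
    exact h1
  · have h1 := tendsto_vcoef_vecMul hV hmV hpC k
    simp only [hpc, ← opB_eq_vcoef hm] at h1
    -- `Cᵀ W⁻¹ = Aᵀ F W⁻¹ - hᵀ`, and `h` contributes nothing at `k ∈ U`.
    have h2 : vcoef (fun θ => (WL2.mk hV C hC).fn θ ᵥ* ((F + G) θ)⁻¹) k = opRa S a F G k := by
      rw [opRa_eq_vcoef ha hF hG hm, ← sub_zero (vcoef (fun θ => symbolA S a θ ᵥ* _) k),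
        ← hs.vcoef_eq_zero k hk, ← vcoef_sub
          ((memL2_vecMul_mul_inv hF hG hm (memL2_symbolA ha hF)).integrable_apply hW hm)
          (hs.memL2.integrable_apply hW hm)]
      refine vcoef_congr ?_ k
      filter_upwards [hm.invertible] with θ h3
      have h3' : IsUnit (F θ + G θ).det := h3
      rw [WL2.fn_mk, hCdef, Pi.sub_apply, Matrix.sub_vecMul, Matrix.vecMul_vecMul,
        Matrix.vecMul_vecMul, Pi.add_apply, Matrix.mul_nonsing_inv _ h3', Matrix.vecMul_one]
    rw [← h2]
    exact h1

variable {c : ℕ → ℤ →₀ (Fin T → ℂ)} {β : ℤ → Fin T → ℂ} {C : VecFun T}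

lemma Approximates.memL2 (hF : IsSpectralDensity F) (hG : IsSpectralDensity G)
    (hm : IsMinimal (F + G)) (hA : Approximates S a F G c β C) :
    MemL2 (fun θ => ((F + G) θ)⁻¹) C := by
  have hV := hm.inv_density (hF.add hG)
  obtain ⟨n, hn⟩ := (hA.series.eventually_lt_const (u := 1) one_pos).exists
  have h1 := memL2_trigPoly hV (c n)
  have h2 : MemL2 (fun θ => ((F + G) θ)⁻¹) (trigPoly (c n) - C) :=
    ⟨h1.1.sub hA.measurable, hn.trans (by simp)⟩
  simpa using h1.sub hV h2

lemma charFormula_residual (hm : IsMinimal (F + G)) : ∀ᵐ θ ∂freq,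
    symbolA S a θ ᵥ* F θ - charFormula S a F G C θ ᵥ* (F θ + G θ) = C θ := by
  filter_upwards [hm.invertible] with θ h3
  have h3' : IsUnit (F θ + G θ).det := h3
  rw [charFormula, Matrix.sub_vecMul, Matrix.vecMul_vecMul, Matrix.vecMul_vecMul,
    Matrix.mul_assoc, Matrix.nonsing_inv_mul _ h3', Matrix.mul_one, Matrix.vecMul_one]
  abel

lemma Approximates.tendsto (hF : IsSpectralDensity F) (hG : IsSpectralDensity G)
    (hm : IsMinimal (F + G)) (hA : Approximates S a F G c β C) :
    Tendsto (fun n => WL2.mk (hm.inv_density (hF.add hG)) _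
      (memL2_trigPoly (hm.inv_density (hF.add hG)) (c n))) atTop
      (𝓝 (WL2.mk (hm.inv_density (hF.add hG)) C (hA.memL2 hF hG hm))) :=
  WL2.tendsto_iff_sqNorm.2 hA.series

/-- The equation `B c = R a` on `U` says that `Aᵀ F W⁻¹ - Cᵀ W⁻¹` has no frequencies in `U`; the
supports of the approximants say that `C` has none outside `U`. -/
lemma Approximates.isSolution (ha : SummableCoeff S a) (hF : IsSpectralDensity F)
    (hG : IsSpectralDensity G) (hm : IsMinimal (F + G)) (hA : Approximates S a F G c β C) :
    IsSolution S a F G (charFormula S a F G C) := by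
  have hW := hF.add hG
  have hV := hm.inv_density hW
  have hmV := hm.inv_minimal hW
  have hC := hA.memL2 hF hG hm
  have hlim := hA.tendsto hF hG hm
  have h1 := memL2_vecMul_mul_inv hF hG hm (memL2_symbolA ha hF)
  have h2 := hC.vecMul_inv hW hm
  refine ⟨h1.sub hW h2, fun n hn => ?_, fun n hn => ?_⟩
  · have h3 := tendsto_vcoef_vecMul hV hmV hlim n
    have h4 := hA.solves n hn
    simp only [opB_eq_vcoef hm] at h4
    have h5 := tendsto_nhds_unique h3 h4
    rw [opRa_eq_vcoef ha hF hG hm] at h5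
    have h6 := vcoef_sub (h1.integrable_apply hW hm) (h2.integrable_apply hW hm) n
    refine h6.trans ?_
    rw [← h5, sub_eq_zero]
    rfl
  · rw [vcoef_congr (charFormula_residual hm) n]
    exact vcoef_eq_zero_of_tendsto hV hmV hlim (fun i => ⟨c i, hA.support i, rfl⟩)
      fun h => mem_unobserved_iff.1 h hn

/-- The value of the operator expression is the error of the optimal estimate. -/
lemma Approximates.value (hb : ∀ n ∈ S, -(b : ℤ) ≤ n) (ha : SummableCoeff S a)
    (hF : IsSpectralDensity F) (hG : IsSpectralDensity G) (hm : IsMinimal (F + G))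
    (hA : Approximates S a F G c β C) : ∃ w : ℂ, ∃ v : ℝ,
      Tendsto (fun n => pairing (opRa S a F G) (c n)) atTop (𝓝 w) ∧
      (v : ℂ) = w + formQ S a F G ∧ 0 ≤ v ∧
      mse S a (charFormula S a F G C) F G = ENNReal.ofReal v := by
  have hW := hF.add hG
  have hV := hm.inv_density hW
  have hmV := hm.inv_minimal hW
  have hC := hA.memL2 hF hG hm
  have hs := hA.isSolution ha hF hG hm
  have hAF := memL2_vecMul_dual hF hG hm (memL2_symbolA ha hF)
  have hu := memL2_vecMul_mul_inv hF hG hm (memL2_symbolA ha hF)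
  set h := charFormula S a F G C with hh
  have hres : ∀ᵐ θ ∂freq, symbolA S a θ ᵥ* F θ - h θ ᵥ* (F θ + G θ) = C θ :=
    charFormula_residual hm
  have hlim := Filter.Tendsto.inner (𝕜 := ℂ) (hA.tendsto hF hG hm)
    (tendsto_const_nhds (x := WL2.mk hV _ hAF))
  have hpair : ∀ n, pairing (opRa S a F G) (c n)
      = inner ℂ (WL2.mk hV _ (memL2_trigPoly hV (c n))) (WL2.mk hV _ hAF) := fun n => by
    rw [inner_trigPoly hV hmV, pairing]
    refine Finsupp.sum_congr fun k _ => ?_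
    rw [opRa_eq_vcoef ha hF hG hm]
    simp only [WL2.fn_mk, Matrix.vecMul_vecMul, Pi.add_apply]
  -- Here `Aᵀ F = Cᵀ + hᵀ W`, and the second summand contributes the pairing of `h` with `C`, which
  -- vanishes because their frequencies are complementary. Thus the limit of the pairings is the
  -- squared norm of `C` in `L₂(W⁻¹)`.
  have hCC : inner ℂ (WL2.mk hV C hC) (WL2.mk hV _ hAF)
      = ∫ θ, form ((F + G) θ)⁻¹ (C θ) (C θ) ∂freq := by
    have h1 := orthogonal_of_vcoef hb (hs.memL2.integrable_apply hW hm)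
      (hC.integrable_apply hV hmV) (hs.memL2.integrable_dual hW hm hC) hs.vcoef_eq_zero
      (fun n hn => by rw [← vcoef_congr hres n]; exact hs.residual n hn)
    rw [WL2.inner_def, ← add_zero (∫ θ, form ((F + G) θ)⁻¹ (C θ) (C θ) ∂freq), ← h1,
      ← integral_add (hC.integrable_form hV hC) (hs.memL2.integrable_dual hW hm hC)]
    refine integral_congr_ae ?_
    filter_upwards [hres, hm.invertible] with θ h2 h3
    have h3' : IsUnit (F θ + G θ).det := h3
    simp only [WL2.fn_mk]
    have h4 : symbolA S a θ ᵥ* F θ = C θ + h θ ᵥ* (F θ + G θ) := by rw [← h2]; abel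
    have h5 : form ((F + G) θ)⁻¹ (h θ ᵥ* (F θ + G θ)) (C θ) = h θ ⬝ᵥ star (C θ) := by
      rw [form, Pi.add_apply, Matrix.vecMul_vecMul, Matrix.mul_nonsing_inv _ h3',
        Matrix.vecMul_one]
    rw [h4, form_add_left, h5]
  have hiC := hC.integrable_form hV hC
  have hAi := (memL2_symbolA (W := F) ha hF).integrable_form hF (memL2_symbolA ha hF)
  have hui := hu.integrable_form hW hu
  have hX : ∀ᵐ θ ∂freq, form (F θ * (F θ + G θ)⁻¹ * G θ) (symbolA S a θ) (symbolA S a θ)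
      = form (F θ) (symbolA S a θ) (symbolA S a θ)
        - form ((F + G) θ) (symbolA S a θ ᵥ* (F θ * (F θ + G θ)⁻¹))
          (symbolA S a θ ᵥ* (F θ * (F θ + G θ)⁻¹)) := by
    filter_upwards [hF.posSemidef, hG.posSemidef, hm.invertible] with θ h1 h2 h3
    exact form_mul_inv_mul_self _ h1 h2 h3
  have hiX : Integrable (fun θ => form (F θ * (F θ + G θ)⁻¹ * G θ) (symbolA S a θ)
      (symbolA S a θ)) freq := (hAi.sub hui).congr (hX.mono fun θ hθ => hθ.symm)
  set e : ℝ → ℝ := fun θ => (form (F θ) (symbolA S a θ - h θ) (symbolA S a θ - h θ)).re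
    + (form (G θ) (h θ) (h θ)).re with he
  have hsum : ∫ θ, form ((F + G) θ)⁻¹ (C θ) (C θ) ∂freq + formQ S a F G
      = ((∫ θ, e θ ∂freq : ℝ) : ℂ) := by
    rw [formQ_eq_integral ha hF hG hm, ← integral_complex_ofReal, ← integral_add hiC hiX]
    refine integral_congr_ae ?_
    filter_upwards [hF.posSemidef, hG.posSemidef, hm.invertible, hX, hres, hV.posSemidef,
      hW.posSemidef] with θ h1 h2 h3 h4 h5 h6 h7
    have h8 := error_eq (symbolA S a θ) (C θ) h1 h2 h3 (h θ) h5.symm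
    rw [he]
    dsimp only
    rw [h8, add_comm]
    push_cast
    congr 1
    · rw [h4, form_self_eq_re _ h1, form_self_eq_re _ h7]
      simp
    · exact form_self_eq_re _ h6
  refine ⟨_, ∫ θ, e θ ∂freq, ?_, hsum.symm, ?_, mse_eq_ofReal ha hF hG hs.memL2⟩
  · simp only [hpair]
    rw [← hCC]
    exact hlim
  · refine integral_nonneg_of_ae ?_
    filter_upwards [hF.posSemidef, hG.posSemidef] with θ h5 h6
    exact add_nonneg (form_self_re_nonneg _ h5) (form_self_re_nonneg _ h6)

lemma IsSolution.mse_unique (hb : ∀ n ∈ S, -(b : ℤ) ≤ n) (ha : SummableCoeff S a)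
    (hF : IsSpectralDensity F) (hG : IsSpectralDensity G) (hm : IsMinimal (F + G))
    {h h' : VecFun T} (hs : IsSolution S a F G h) (hs' : IsSolution S a F G h') :
    mse S a h F G = mse S a h' F G :=
  le_antisymm
    ((hs.isOptimal hb ha hF hG hm).2 h' (hs'.isOptimal hb ha hF hG hm).1)
    ((hs'.isOptimal hb ha hF hG hm).2 h (hs.isOptimal hb ha hF hG hm).1)

lemma IsSolution.exists_isOperatorValue (hb : ∀ n ∈ S, -(b : ℤ) ≤ n) (ha : SummableCoeff S a)
    (hF : IsSpectralDensity F) (hG : IsSpectralDensity G) (hm : IsMinimal (F + G))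
    {h : VecFun T} (hs : IsSolution S a F G h) :
    ∃ v, IsOperatorValue S a F G v ∧ mse S a h F G = ENNReal.ofReal v := by
  obtain ⟨c, β, hA⟩ := exists_approximates hb ha hF hG hm hs
  obtain ⟨w, v, h1, h2, -, h4⟩ := hA.value hb ha hF hG hm
  exact ⟨v, ⟨c, β, _, hA, w, h1, h2⟩,
    (hs.mse_unique hb ha hF hG hm (hA.isSolution ha hF hG hm)).trans h4⟩

lemma IsOperatorValue.mse_eq (hb : ∀ n ∈ S, -(b : ℤ) ≤ n) (ha : SummableCoeff S a)
    (hF : IsSpectralDensity F) (hG : IsSpectralDensity G) (hm : IsMinimal (F + G)) {v : ℝ}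
    (hv : IsOperatorValue S a F G v) {h : VecFun T} (hs : IsSolution S a F G h) :
    mse S a h F G = ENNReal.ofReal v := by
  obtain ⟨c, β, C, hA, w, hw, hvw⟩ := hv
  obtain ⟨w', v', h1, h2, -, h4⟩ := hA.value hb ha hF hG hm
  rw [hs.mse_unique hb ha hF hG hm (hA.isSolution ha hF hG hm), h4]
  rw [tendsto_nhds_unique hw h1, ← h2] at hvw
  rw [Complex.ofReal_injective hvw]

end operators

/-! ### Minimality is inherited by larger densities -/

/-- With `u = xᵀ (P + Q)⁻¹` the left side equals `form P u (x P⁻¹)`; apply `norm_form_le` and `form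
P u u ≤ form (P + Q) u u`. -/
lemma form_add_inv_le {P Q : Matrix (Fin T) (Fin T) ℂ} (hP : P.PosSemidef) (hQ : Q.PosSemidef)
    (hu : IsUnit P.det) (hu' : IsUnit (P + Q).det) (x : Fin T → ℂ) :
    (form (P + Q)⁻¹ x x).re ≤ (form P⁻¹ x x).re := by
  set u := x ᵥ* (P + Q)⁻¹ with hudef
  have h1 : form (P + Q)⁻¹ x x = form (P + Q) u u := (form_inv_inv x x (hP.add hQ) hu').symm
  have h2 : form (P + Q)⁻¹ x x = form P u (x ᵥ* P⁻¹) := by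
    rw [form_inv_right _ _ hP hu]; rfl
  have h3 := norm_form_le u (x ᵥ* P⁻¹) hP
  rw [form_inv_inv _ _ hP hu, ← h2] at h3
  have h4 := Complex.re_le_norm (form (P + Q)⁻¹ x x)
  have h5 : (form (P + Q) u u).re = (form P u u).re + (form Q u u).re := by
    rw [form_add_mat, Complex.add_re]
  have h6 := form_self_re_nonneg u hQ
  rw [← h1] at h5
  linarith

lemma form_single_single (M : Matrix (Fin T) (Fin T) ℂ) (i j : Fin T) :
    form M (Pi.single i 1) (Pi.single j 1) = M i j := by
  rw [form, dotProduct_star_single, Matrix.single_one_vecMul]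
  simp [Matrix.row]

lemma posDef_of_posSemidef_of_isUnit {P : Matrix (Fin T) (Fin T) ℂ} (hP : P.PosSemidef)
    (hu : IsUnit P.det) : P.PosDef :=
  (hP.posDef_iff_isUnit).2 ((Matrix.isUnit_iff_isUnit_det _).2 hu)

lemma MatMeas.inv {W : MatFun T} (hW : MatMeas W) : MatMeas (fun θ => (W θ)⁻¹) := by
  have h0 : AEStronglyMeasurable (fun θ => (W θ : Fin T → Fin T → ℂ)) freq :=
    (aemeasurable_pi_lambda _ fun i => aemeasurable_pi_lambda _ fun j =>
      (hW i j).aemeasurable).aestronglyMeasurable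
  intro i j
  have h1 : AEStronglyMeasurable (fun θ => (W θ).det) freq :=
    (continuous_id.matrix_det :
      Continuous fun M : Matrix (Fin T) (Fin T) ℂ => M.det).comp_aestronglyMeasurable h0
  have h2 : AEStronglyMeasurable (fun θ => (W θ).adjugate i j) freq :=
    ((continuous_id.matrix_adjugate.matrix_elem i j :
      Continuous fun M : Matrix (Fin T) (Fin T) ℂ => M.adjugate i j)).comp_aestronglyMeasurable h0
  simp only [Matrix.inv_def, Ring.inverse_eq_inv', Matrix.smul_apply, smul_eq_mul]
  exact h1.aemeasurable.inv.aestronglyMeasurable.mul h2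

/-- Inversion reverses the order, which bounds the diagonal of the inverse, and the diagonal bounds
all entries. Minimality at `G₀` thereby spreads to the half-open segment towards any `G`. -/
lemma IsMinimal.add_right {P Q : MatFun T} (hm : IsMinimal P) (hP : IsSpectralDensity P)
    (hQ : IsSpectralDensity Q) : IsMinimal (P + Q) := by
  have hinv : ∀ᵐ θ ∂freq, IsUnit ((P + Q) θ).det := by
    filter_upwards [hm.invertible, hP.posSemidef, hQ.posSemidef] with θ h1 h2 h3
    exact (Matrix.isUnit_iff_isUnit_det _).1
      ((posDef_of_posSemidef_of_isUnit h2 h1).add_posSemidef h3).isUnit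
  refine ⟨hinv, fun i j => ?_⟩
  refine Integrable.mono' (((hm.integrable i i).re.add (hm.integrable j j).re).div_const 2)
    ((hP.add hQ).meas.inv i j) ?_
  filter_upwards [hm.invertible, hP.posSemidef, hQ.posSemidef, hinv] with θ h1 h2 h3 h4
  have h5 := norm_form_le (Pi.single i 1) (Pi.single j 1) (h2.add h3).inv
  have h6 := fun k => form_add_inv_le h2 h3 h1 h4 (Pi.single k 1)
  simp only [form_single_single] at h5 h6
  refine h5.trans ?_
  have := h6 i
  have := h6 j
  simp only [Pi.add_apply, RCLike.re_to_complex]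
  linarith

lemma IsMinimal.smul {W : MatFun T} (hm : IsMinimal W) {t : ℝ} (ht : 0 < t) :
    IsMinimal ((t : ℂ) • W) := by
  have ht0 : (t : ℂ) ≠ 0 := by exact_mod_cast ht.ne'
  refine ⟨?_, fun i j => ?_⟩
  · filter_upwards [hm.invertible] with θ h1
    rw [Pi.smul_apply, Matrix.det_smul]
    exact (IsUnit.mk0 _ (pow_ne_zero _ ht0)).mul h1
  · refine ((hm.integrable i j).const_mul ((t : ℂ)⁻¹)).congr ?_
    filter_upwards [hm.invertible] with θ h1
    have : ((t : ℂ) • W θ)⁻¹ = (t : ℂ)⁻¹ • (W θ)⁻¹ := by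
      refine Matrix.inv_eq_right_inv ?_
      rw [Matrix.smul_mul, Matrix.mul_smul, smul_smul, mul_inv_cancel₀ ht0, one_smul,
        Matrix.mul_nonsing_inv _ h1]
    rw [Pi.smul_apply, this]
    rfl

/-! ### The error as a function of the density -/

section affine

variable {W X : MatFun T} {h g : VecFun T}

lemma sqNorm_add_density (hW : IsSpectralDensity W) (hX : IsSpectralDensity X)
    (hh : AEStronglyMeasurable h freq) : sqNorm (W + X) h = sqNorm W h + sqNorm X h := by
  have hm : AEMeasurable (fun θ => ENNReal.ofReal (form (W θ) (h θ) (h θ)).re) freq :=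
    (hW.meas.form hh hh).re.aemeasurable.ennreal_ofReal
  rw [sqNorm_eq_form, sqNorm_eq_form, sqNorm_eq_form, ← lintegral_add_left' hm]
  refine lintegral_congr_ae ?_
  filter_upwards [hW.posSemidef, hX.posSemidef] with θ h1 h2
  rw [Pi.add_apply, form_add_mat, Complex.add_re]
  exact ENNReal.ofReal_add (form_self_re_nonneg _ h1) (form_self_re_nonneg _ h2)

lemma sqNorm_smul_density (W : MatFun T) (h : VecFun T) {t : ℝ} (ht : 0 ≤ t) :
    sqNorm ((t : ℂ) • W) h = ENNReal.ofReal t * sqNorm W h := by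
  rw [sqNorm_eq_form, sqNorm_eq_form, ← lintegral_const_mul' _ _ ENNReal.ofReal_ne_top]
  refine lintegral_congr fun θ => ?_
  rw [Pi.smul_apply, form_smul_mat, Complex.re_ofReal_mul, ENNReal.ofReal_mul ht]

lemma sqNorm_mix (hW : IsSpectralDensity W) (hX : IsSpectralDensity X)
    (hh : AEStronglyMeasurable h freq) {t : ℝ} (h0 : 0 ≤ t) (h1 : t ≤ 1) :
    sqNorm (((1 - t : ℝ) : ℂ) • W + (t : ℂ) • X) h
      = ENNReal.ofReal (1 - t) * sqNorm W h + ENNReal.ofReal t * sqNorm X h := by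
  rw [sqNorm_add_density (hW.smul (by linarith)) (hX.smul h0) hh,
    sqNorm_smul_density _ _ (by linarith), sqNorm_smul_density _ _ h0]

/-- The signal term does not depend on the noise density and is split with the weights `1 - t` and
`t`. This affinity is the source of the concavity of the optimal error. -/
lemma mse_mix {S : Set ℤ} {a : ℤ → Fin T → ℂ} {F : MatFun T} (hW : IsSpectralDensity W)
    (hX : IsSpectralDensity X) (hh : AEStronglyMeasurable h freq) {t : ℝ} (h0 : 0 ≤ t)
    (h1 : t ≤ 1) : mse S a h F (((1 - t : ℝ) : ℂ) • W + (t : ℂ) • X)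
      = ENNReal.ofReal (1 - t) * mse S a h F W + ENNReal.ofReal t * mse S a h F X := by
  have h2 : ENNReal.ofReal (1 - t) + ENNReal.ofReal t = 1 := by
    rw [← ENNReal.ofReal_add (by linarith) h0]; simp
  rw [mse, mse, mse, sqNorm_mix hW hX hh h0 h1]
  nth_rewrite 1 [← one_mul (sqNorm F (symbolA S a - h))]
  rw [← h2]
  ring

lemma tendsto_sqNorm (hW : IsSpectralDensity W) {x : ℕ → VecFun T} (hx : ∀ n, MemL2 W (x n))
    (hg : MemL2 W g) (h : Tendsto (fun n => sqNorm W (x n - g)) atTop (𝓝 0)) :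
    Tendsto (fun n => sqNorm W (x n)) atTop (𝓝 (sqNorm W g)) := by
  have h1 : Tendsto (fun n => WL2.mk hW _ (hx n)) atTop (𝓝 (WL2.mk hW g hg)) :=
    WL2.tendsto_iff_sqNorm.2 h
  have h2 := ENNReal.tendsto_ofReal (h1.norm.pow 2)
  simp only [← WL2.sqNorm_eq] at h2
  exact h2

lemma sqNorm_add_le (hW : IsSpectralDensity W) (hh : MemL2 W h) (hg : MemL2 W g) :
    sqNorm W (h + g) ≤ 2 * sqNorm W h + 2 * sqNorm W g := by
  have h1 := WL2.sqNorm_eq (WL2.mk hW h hh + WL2.mk hW g hg)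
  have h2 := WL2.sqNorm_eq (WL2.mk hW h hh)
  have h3 := WL2.sqNorm_eq (WL2.mk hW g hg)
  simp only [WL2.fn_add, WL2.fn_mk] at h1 h2 h3
  rw [h1, h2, h3, show (2 : ℝ≥0∞) = ENNReal.ofReal 2 by simp, ← ENNReal.ofReal_mul (by norm_num),
    ← ENNReal.ofReal_mul (by norm_num), ← ENNReal.ofReal_add (by positivity) (by positivity)]
  refine ENNReal.ofReal_le_ofReal ?_
  have h4 := norm_add_le (WL2.mk hW h hh) (WL2.mk hW g hg)
  nlinarith [norm_nonneg (WL2.mk hW h hh + WL2.mk hW g hg),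
    sq_nonneg (‖WL2.mk hW h hh‖ - ‖WL2.mk hW g hg‖), norm_nonneg (WL2.mk hW h hh),
    norm_nonneg (WL2.mk hW g hg)]

lemma sqNorm_sub_comm (W : MatFun T) (h g : VecFun T) : sqNorm W (h - g) = sqNorm W (g - h) := by
  rw [sqNorm_eq_form, sqNorm_eq_form]
  refine lintegral_congr fun θ => ?_
  have : (h - g) θ = (-1 : ℂ) • (g - h) θ := by simp
  rw [this, form_smul_left, form_smul_right]
  simp

end affine

/-! ### Least favorable densities -/

section main

variable {S : Set ℤ} {a : ℤ → Fin T → ℂ} {b : ℕ} {F G G₀ : MatFun T}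

/-- The segment from `G₀` to `G`. -/
def mix (G₀ G : MatFun T) (t : ℝ) : MatFun T := ((1 - t : ℝ) : ℂ) • G₀ + (t : ℂ) • G

lemma add_mix (F G₀ G : MatFun T) (t : ℝ) :
    F + mix G₀ G t = ((1 - t : ℝ) : ℂ) • (F + G₀) + (t : ℂ) • (F + G) := by
  rw [mix]; push_cast; module

lemma memL2_of_mix (hW : IsSpectralDensity G₀) (hX : IsSpectralDensity G) {h : VecFun T}
    {t : ℝ} (h0 : 0 < t) (h1 : t < 1) (hh : MemL2 (mix G₀ G t) h) :
    MemL2 G₀ h ∧ MemL2 G h := by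
  have h2 := hh.2
  rw [mix, sqNorm_mix hW hX hh.1 h0.le h1.le, ENNReal.add_lt_top] at h2
  have h3 := ENNReal.ofReal_pos.2 (sub_pos.2 h1)
  have h4 := ENNReal.ofReal_pos.2 h0
  exact ⟨⟨hh.1, ENNReal.lt_top_of_mul_ne_top_right h2.1.ne h3.ne'⟩,
    ⟨hh.1, ENNReal.lt_top_of_mul_ne_top_right h2.2.ne h4.ne'⟩⟩

lemma memL2_mix (hW : IsSpectralDensity G₀) (hX : IsSpectralDensity G) {h : VecFun T}
    {t : ℝ} (h0 : 0 < t) (h1 : t < 1) (hh0 : MemL2 G₀ h) (hh : MemL2 G h) :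
    MemL2 (mix G₀ G t) h := by
  refine ⟨hh.1, ?_⟩
  rw [mix, sqNorm_mix hW hX hh.1 h0.le h1.le]
  exact ENNReal.add_lt_top.2 ⟨ENNReal.mul_lt_top ENNReal.ofReal_lt_top hh0.2,
    ENNReal.mul_lt_top ENNReal.ofReal_lt_top hh.2⟩

lemma MemL2s.of_mix (hW : IsSpectralDensity G₀) (hX : IsSpectralDensity G) {h : VecFun T}
    {t : ℝ} (h0 : 0 < t) (h1 : t < 1) (hh : MemL2s S (mix G₀ G t) h) : MemL2s S G h := by
  refine ⟨(memL2_of_mix hW hX h0 h1 hh.1).2, fun ε hε => ?_⟩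
  have ht := ENNReal.ofReal_pos.2 h0
  obtain ⟨p, hp, hpε⟩ := hh.2 (ENNReal.ofReal t * ε) (ENNReal.mul_pos ht.ne' hε.ne')
  refine ⟨p, hp, ?_⟩
  rw [mix, sqNorm_mix hW hX (hh.1.1.sub (continuous_trigPoly p).aestronglyMeasurable)
    h0.le h1.le] at hpε
  exact lt_of_mul_lt_mul_left' (le_add_self.trans_lt hpε)

/-- If the errors along the segments from `G₀` to `G` do not exceed the error at `G₀`, then the
optimal characteristic at `G₀` lies in `L₂ˢ(F + G)` and its error at `G` is at most that at `G₀`. -/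
lemma memL2s_and_mse_le (hb : ∀ n ∈ S, -(b : ℤ) ≤ n) (ha : SummableCoeff S a)
    (hF : IsSpectralDensity F) (hG₀ : IsSpectralDensity G₀) (hG : IsSpectralDensity G)
    (hm : IsMinimal (F + G₀)) {h₀ : VecFun T} (hs₀ : IsSolution S a F G₀ h₀)
    (hle : ∀ t : ℝ, 0 < t → t < 1 → ∀ h, IsSolution S a F (mix G₀ G t) h →
      mse S a h F (mix G₀ G t) ≤ mse S a h₀ F G₀) :
    MemL2s S (F + G) h₀ ∧ mse S a h₀ F G ≤ mse S a h₀ F G₀ := by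
  have hW₀ := hF.add hG₀
  have hW := hF.add hG
  -- The shift by `2` keeps `t n` strictly between `0` and `1`, so finiteness of the norm at the
  -- mixture gives finiteness at both end points.
  set t : ℕ → ℝ := fun n => 1 / ((n : ℝ) + 2) with ht
  have ht0 : ∀ n, 0 < t n := fun n => by positivity
  have ht1 : ∀ n, t n < 1 := fun n => by
    rw [ht, div_lt_one (by positivity)]
    linarith [(Nat.cast_nonneg n : (0 : ℝ) ≤ n)]
  have htm : ∀ n m, n < m → t m < t n := fun n m hnm => by
    have : (n : ℝ) < m := by exact_mod_cast hnm
    exact one_div_lt_one_div_of_lt (by positivity) (by linarith)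
  have htlim : Tendsto t atTop (𝓝 0) := by
    have h1 := (tendsto_one_div_add_atTop_nhds_zero_nat (𝕜 := ℝ)).comp (tendsto_add_atTop_nat 1)
    refine h1.congr fun n => ?_
    simp only [Function.comp_def, ht]
    push_cast; ring_nf
  have hGt : ∀ n, IsSpectralDensity (mix G₀ G (t n)) := fun n =>
    (hG₀.smul (by linarith [ht1 n])).add (hG.smul (ht0 n).le)
  have hmt : ∀ n, IsMinimal (F + mix G₀ G (t n)) := fun n => by
    rw [add_mix]
    exact (hm.smul (by linarith [ht1 n])).add_right (hW₀.smul (by linarith [ht1 n]))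
      (hW.smul (ht0 n).le)
  choose h hs using fun n => exists_isSolution ha hF (hGt n) (hmt n)
  have hmem' : ∀ n, MemL2 (mix (F + G₀) (F + G) (t n)) (h n) := fun n => by
    have := (hs n).memL2
    rwa [add_mix] at this
  have hmem0 : ∀ n, MemL2 (F + G₀) (h n) := fun n =>
    (memL2_of_mix hW₀ hW (ht0 n) (ht1 n) (hmem' n)).1
  have hmem1 : ∀ n, MemL2 (F + G) (h n) := fun n =>
    (memL2_of_mix hW₀ hW (ht0 n) (ht1 n) (hmem' n)).2
  have hmemt : ∀ n m, MemL2 (F + mix G₀ G (t n)) (h m) := fun n m => by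
    rw [add_mix]; exact memL2_mix hW₀ hW (ht0 n) (ht1 n) (hmem0 m) (hmem1 m)
  -- the errors at the two end points
  set x : ℕ → ℝ := fun n => (mse S a (h n) F G₀).toReal with hx
  set y : ℕ → ℝ := fun n => (mse S a (h n) F G).toReal with hy
  set Δ : ℝ := (mse S a h₀ F G₀).toReal with hΔ
  have hxe : ∀ n, mse S a (h n) F G₀ = ENNReal.ofReal (x n) := fun n =>
    (ENNReal.ofReal_toReal (mse_lt_top ha hF hG₀ (hmem0 n)).ne).symm
  have hye : ∀ n, mse S a (h n) F G = ENNReal.ofReal (y n) := fun n =>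
    (ENNReal.ofReal_toReal (mse_lt_top ha hF hG (hmem1 n)).ne).symm
  have hΔe : mse S a h₀ F G₀ = ENNReal.ofReal Δ :=
    (ENNReal.ofReal_toReal (mse_lt_top ha hF hG₀ hs₀.memL2).ne).symm
  have hx0 : ∀ n, 0 ≤ x n := fun n => ENNReal.toReal_nonneg
  have hy0 : ∀ n, 0 ≤ y n := fun n => ENNReal.toReal_nonneg
  have hΔ0 : 0 ≤ Δ := ENNReal.toReal_nonneg
  have hmixe : ∀ n m, mse S a (h m) F (mix G₀ G (t n))
      = ENNReal.ofReal ((1 - t n) * x m + t n * y m) := fun n m => by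
    have h1 : 0 ≤ 1 - t n := by linarith [ht1 n]
    rw [mix, mse_mix hG₀ hG (hmem0 m).1 (ht0 n).le (ht1 n).le, hxe, hye,
      ← ENNReal.ofReal_mul h1, ← ENNReal.ofReal_mul (ht0 n).le,
      ← ENNReal.ofReal_add (mul_nonneg h1 (hx0 m)) (mul_nonneg (ht0 n).le (hy0 m))]
  have hE : ∀ n, (1 - t n) * x n + t n * y n ≤ Δ := fun n => by
    have h1 := hle (t n) (ht0 n) (ht1 n) (h n) (hs n)
    rwa [hmixe, hΔe, ENNReal.ofReal_le_ofReal_iff hΔ0] at h1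
  -- Pythagoras at `G₀`: the excess of `h n` over the optimal error is its squared distance to `h₀`.
  have hxΔ : ∀ n, sqNorm (F + G₀) (h n - h₀) = ENNReal.ofReal (x n - Δ) ∧ Δ ≤ x n := fun n => by
    have h1 := hs₀.mse_eq_add hb ha hF hG₀ hm (hmem0 n) (hs n).vcoef_eq_zero
    rw [hxe, hΔe] at h1
    have h2 : Δ ≤ x n := by
      rw [← ENNReal.ofReal_le_ofReal_iff (hx0 n), h1]; exact le_self_add
    refine ⟨?_, h2⟩
    rw [ENNReal.ofReal_sub _ hΔ0, h1, ENNReal.add_sub_cancel_left ENNReal.ofReal_ne_top]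
  -- A convex combination of `x n` and `y n` is at most `Δ`, and `x n ≥ Δ`.
  have hyΔ : ∀ n, y n ≤ Δ := fun n => by
    have h1 := hE n
    have h2 := (hxΔ n).2
    have h3 : t n * y n ≤ t n * Δ := by nlinarith [ht1 n]
    exact le_of_mul_le_mul_left h3 (ht0 n)
  -- monotonicity along the segment
  have hq : ∀ n m, ∃ q : ℝ, 0 ≤ q ∧ sqNorm (F + G) (h m - h n) = ENNReal.ofReal q ∧
      (1 - t n) * x n + t n * y n + t n * q ≤ (1 - t n) * x m + t n * y m := fun n m => by
    have hd : MemL2 (F + G) (h m - h n) := (hmem1 m).sub hW (hmem1 n)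
    refine ⟨(sqNorm (F + G) (h m - h n)).toReal, ENNReal.toReal_nonneg,
      (ENNReal.ofReal_toReal hd.2.ne).symm, ?_⟩
    have h1 := (hs n).mse_eq_add hb ha hF (hGt n) (hmt n) (hmemt n m) (hs m).vcoef_eq_zero
    have h2 : ENNReal.ofReal (t n) * sqNorm (F + G) (h m - h n)
        ≤ sqNorm (F + mix G₀ G (t n)) (h m - h n) := by
      rw [add_mix, sqNorm_mix hW₀ hW hd.1 (ht0 n).le (ht1 n).le]
      exact le_add_self
    have h3 : mse S a (h n) F (mix G₀ G (t n))
        + ENNReal.ofReal (t n) * sqNorm (F + G) (h m - h n)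
        ≤ mse S a (h m) F (mix G₀ G (t n)) := by
      rw [h1]; gcongr
    have h1t : 0 ≤ 1 - t n := by linarith [ht1 n]
    have h4 : ∀ m, 0 ≤ (1 - t n) * x m + t n * y m := fun m =>
      add_nonneg (mul_nonneg h1t (hx0 m)) (mul_nonneg (ht0 n).le (hy0 m))
    rwa [hmixe, hmixe, ← ENNReal.ofReal_toReal hd.2.ne, ← ENNReal.ofReal_mul (ht0 n).le,
      ← ENNReal.ofReal_add (h4 n) (mul_nonneg (ht0 n).le ENNReal.toReal_nonneg),
      ENNReal.ofReal_le_ofReal_iff (h4 m)] at h3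
  -- Compare `h n` and `h m` at both parameters. Weighting the two inequalities by `t m` and `t n`
  -- eliminates `y` and yields `x m ≤ x n`; the inequality at `t n` then leaves `q ≤ y m - y n`.
  have hcauchy : ∀ n m, n < m → sqNorm (F + G) (h m - h n) ≤ ENNReal.ofReal (y m - y n) ∧
      y n ≤ y m := fun n m hnm => by
    obtain ⟨q, hq0, hqe, h1⟩ := hq n m
    obtain ⟨q', hq0', -, h2⟩ := hq m n
    have hst := htm n m hnm
    have a1 := ht0 n
    have a2 := ht0 m
    have a3 := ht1 n
    have h3 : x m ≤ x n := by
      have e1 : t m * ((1 - t n) * x n + t n * y n) ≤ t m * ((1 - t n) * x m + t n * y m) :=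
        mul_le_mul_of_nonneg_left (by linarith [mul_nonneg a1.le hq0]) a2.le
      have e2 : t n * ((1 - t m) * x m + t m * y m) ≤ t n * ((1 - t m) * x n + t m * y n) :=
        mul_le_mul_of_nonneg_left (by linarith [mul_nonneg a2.le hq0']) a1.le
      have e3 : (t n - t m) * x m ≤ (t n - t m) * x n := by linarith
      exact le_of_mul_le_mul_left e3 (by linarith)
    have h4 : t n * q ≤ t n * (y m - y n) := by
      have e4 := mul_nonneg (sub_nonneg.2 a3.le) (sub_nonneg.2 h3)
      linarith
    have h5 := le_of_mul_le_mul_left h4 a1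
    refine ⟨?_, by linarith⟩
    rw [hqe]
    exact ENNReal.ofReal_le_ofReal h5
  have hmono : Monotone y := monotone_nat_of_le_succ fun n => (hcauchy n (n + 1) (by omega)).2
  have hbdd : BddAbove (Set.range y) := ⟨Δ, by rintro _ ⟨n, rfl⟩; exact hyΔ n⟩
  have hylim := tendsto_atTop_ciSup hmono hbdd
  set Y := ⨆ n, y n with hY
  have hyY : ∀ n, y n ≤ Y := fun n => le_ciSup hbdd n
  -- convergence at `G₀`
  have hconv0 : Tendsto (fun n => WL2.mk hW₀ _ (hmem0 n)) atTop (𝓝 (WL2.mk hW₀ _ hs₀.memL2)) := by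
    rw [WL2.tendsto_iff_sqNorm]
    simp only [WL2.fn_mk, (hxΔ _).1]
    rw [← ENNReal.ofReal_zero]
    refine ENNReal.tendsto_ofReal ?_
    -- Dropping `y n ≥ 0` in `hE` gives `(1 - t n) x n ≤ Δ`, hence the rate.
    refine squeeze_zero (fun n => sub_nonneg.2 (hxΔ n).2) (fun n => ?_)
      (g := fun n => t n / (1 - t n) * Δ) ?_
    · have h1 : 0 < 1 - t n := by linarith [ht1 n]
      rw [div_mul_eq_mul_div, le_div_iff₀ h1]
      nlinarith [hE n, mul_nonneg (ht0 n).le (hy0 n)]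
    · have h2 := (htlim.div (tendsto_const_nhds.sub htlim) (by norm_num :
        (1 : ℝ) - 0 ≠ 0)).mul_const Δ
      simpa using h2
  -- `F + G` need not be minimal, so completeness of `L₂(F + G)` is not at hand. Pointwise
  -- convergence to `h₀` and lower semicontinuity replace it.
  obtain ⟨ns, hns, hae⟩ := exists_ae_subseq_of_tendsto hW₀ hm hconv0
  have hlimle : ∀ n, sqNorm (F + G) (h₀ - h n) ≤ ENNReal.ofReal (Y - y n) := fun n => by
    refine sqNorm_le_of_tendsto_ae hW.meas (x := fun i => h (ns i) - h n)
      (fun i => (hmem1 _).1.sub (hmem1 _).1) ?_ ?_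
    · filter_upwards [hae] with θ hθ using hθ.sub tendsto_const_nhds
    · filter_upwards [eventually_gt_atTop n] with i hi
      refine (hcauchy n (ns i) (hi.trans_le (hns.id_le i))).1.trans (ENNReal.ofReal_le_ofReal ?_)
      linarith [hyY (ns i)]
  have hd : ∀ n, MemL2 (F + G) (h₀ - h n) := fun n =>
    ⟨hs₀.memL2.1.sub (hmem1 n).1, (hlimle n).trans_lt ENNReal.ofReal_lt_top⟩
  have hmem : MemL2 (F + G) h₀ := by simpa using (hd 0).add hW (hmem1 0)
  have hlim : Tendsto (fun n => sqNorm (F + G) (h₀ - h n)) atTop (𝓝 0) := by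
    refine tendsto_of_tendsto_of_tendsto_of_le_of_le tendsto_const_nhds ?_ (fun _ => zero_le)
      hlimle
    rw [← ENNReal.ofReal_zero]
    refine ENNReal.tendsto_ofReal ?_
    simpa using (tendsto_const_nhds (x := Y)).sub hylim
  have hlim' : Tendsto (fun n => sqNorm F (h n - h₀) + sqNorm G (h n - h₀)) atTop (𝓝 0) := by
    refine hlim.congr fun n => ?_
    rw [sqNorm_sub_comm, sqNorm_add_density hF hG ((hmem1 n).1.sub hmem.1)]
  refine ⟨⟨hmem, fun ε hε => ?_⟩, ?_⟩
  -- `h₀` is approximated by some `h n`, and `h n` by an observed polynomial, because membership in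
  -- `L₂ˢ` at the mixture passes to `F + G`. Each squared norm enters with the factor `2` of
  -- `sqNorm_add_le`.
  · have hε4 : 0 < ε / 4 := ENNReal.div_pos hε.ne' (by norm_num)
    obtain ⟨n, hn⟩ := (hlim.eventually_lt_const hε4).exists
    have h1 : MemL2s S (F + mix G₀ G (t n)) (h n) :=
      ((hs n).isOptimal hb ha hF (hGt n) (hmt n)).1
    rw [add_mix] at h1
    obtain ⟨p, hp, hpε⟩ := (MemL2s.of_mix hW₀ hW (ht0 n) (ht1 n) h1).2 (ε / 4) hε4
    refine ⟨p, hp, ?_⟩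
    have h2 : h₀ - trigPoly p = (h₀ - h n) + (h n - trigPoly p) := by abel
    rw [h2]
    refine (sqNorm_add_le hW (hd n) ((hmem1 n).sub hW (memL2_trigPoly hW p))).trans_lt ?_
    have h3 : ε = 2 * (ε / 4) + 2 * (ε / 4) := by
      rw [← two_mul, ← mul_assoc, show (2 : ℝ≥0∞) * 2 = 4 by norm_num,
        ENNReal.mul_div_cancel (by norm_num) (by norm_num)]
    rw [h3]
    exact ENNReal.add_lt_add ((ENNReal.mul_lt_mul_iff_right (by norm_num) (by norm_num)).2 hn)
      ((ENNReal.mul_lt_mul_iff_right (by norm_num) (by norm_num)).2 hpε)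
  · have hA := memL2_symbolA ha hF
    have hlF : Tendsto (fun n => sqNorm F (h n - h₀)) atTop (𝓝 0) :=
      tendsto_of_tendsto_of_tendsto_of_le_of_le tendsto_const_nhds hlim' (fun _ => zero_le)
        (fun n => le_self_add)
    have hlG : Tendsto (fun n => sqNorm G (h n - h₀)) atTop (𝓝 0) :=
      tendsto_of_tendsto_of_tendsto_of_le_of_le tendsto_const_nhds hlim' (fun _ => zero_le)
        (fun n => le_add_self)
    have h1 : Tendsto (fun n => mse S a (h n) F G) atTop (𝓝 (mse S a h₀ F G)) := by
      refine Tendsto.add (tendsto_sqNorm hF (fun n => hA.sub hF ((hmem1 n).left hG))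
        (hA.sub hF (hmem.left hG)) (hlF.congr fun n => ?_))
        (tendsto_sqNorm hG (fun n => (hmem1 n).right hF) (hmem.right hF) hlG)
      rw [sub_sub_sub_cancel_left, sqNorm_sub_comm]
    refine le_of_tendsto h1 (.of_forall fun n => ?_)
    rw [hye, hΔe]
    exact ENNReal.ofReal_le_ofReal (hyΔ n)

/-- A maximiser of the operator expression over a convex class of densities is least favorable,
and the optimal characteristic for it is minimax-robust. -/
lemma minimaxSolution_of_solvesExtremal (hb : ∀ n ∈ S, -(b : ℤ) ≤ n) (ha : SummableCoeff S a)
    (hF : IsSpectralDensity F) (hm : IsMinimal (F + G₀)) {D : Set (MatFun T)}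
    (hD : ∀ G ∈ D, IsSpectralDensity G)
    (hconv : G₀ ∈ D → ∀ G ∈ D, ∀ t : ℝ, 0 < t → t < 1 → mix G₀ G t ∈ D)
    (hext : SolvesExtremal S a {F} D F G₀) : MinimaxSolution S a F D G₀ := by
  obtain ⟨-, hG₀D, v₀, hv₀, hmax⟩ := hext
  have hG₀ := hD G₀ hG₀D
  have key : ∀ h₀, IsSolution S a F G₀ h₀ → ∀ G ∈ D,
      MemL2s S (F + G) h₀ ∧ mse S a h₀ F G ≤ mse S a h₀ F G₀ := fun h₀ hs₀ G hGD => by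
    refine memL2s_and_mse_le hb ha hF hG₀ (hD G hGD) hm hs₀ fun t ht0 ht1 h hs => ?_
    have hmixD := hconv hG₀D G hGD t ht0 ht1
    -- Interior points of the segment are minimal, so they are admissible competitors in the
    -- extremal problem even when `G` itself is not.
    have hmt : IsMinimal (F + mix G₀ G t) := by
      rw [add_mix]
      exact (hm.smul (by linarith)).add_right ((hF.add hG₀).smul (by linarith))
        ((hF.add (hD G hGD)).smul ht0.le)
    obtain ⟨v, hv, hve⟩ := hs.exists_isOperatorValue hb ha hF (hD _ hmixD) hmt
    rw [hve, hv₀.mse_eq hb ha hF hG₀ hm hs₀]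
    exact ENNReal.ofReal_le_ofReal (hmax F rfl _ hmixD hmt v hv)
  have hsol : ∀ β C, IsInverseImage S a F G₀ β C →
      IsSolution S a F G₀ (charFormula S a F G₀ C) := by
    rintro β C ⟨c, hc⟩
    exact hc.isSolution ha hF hG₀ hm
  refine ⟨⟨rfl, hG₀D, ?_⟩, ?_, ?_, ?_⟩
  · rintro F' hF' G hGD
    obtain rfl : F' = F := hF'
    obtain ⟨h₀, hs₀⟩ := exists_isSolution ha hF hG₀ hm
    obtain ⟨h1, h2⟩ := key h₀ hs₀ G hGD
    rw [(hs₀.isOptimal hb ha hF hG₀ hm).optimalMse_eq]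
    -- `h₀` is admissible at `G`, so its error bounds the optimal one there; the saddle point
    -- inequality does the rest.
    exact (iInf₂_le h₀ h1).trans h2
  · obtain ⟨c, β, C, hA, -⟩ := hv₀
    exact ⟨β, C, c, hA⟩
  · exact fun β C hC => (hsol β C hC).isOptimal hb ha hF hG₀ hm
  · intro β C hC
    have hs₀ := hsol β C hC
    have hk := key _ hs₀
    have hworst : worstMse S a {F} D (charFormula S a F G₀ C)
        = mse S a (charFormula S a F G₀ C) F G₀ := by
      refine le_antisymm ?_ ?_
      · refine iSup₂_le fun F' hF' => iSup₂_le fun G hGD => ?_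
        obtain rfl : F' = F := hF'
        exact (hk G hGD).2
      · exact le_iSup₂_of_le F rfl (le_iSup₂_of_le G₀ hG₀D le_rfl)
    refine ⟨?_, ⟨F, rfl, G₀, hG₀D, hworst.symm⟩, fun h hh => ?_⟩
    · rintro F' hF' G hGD
      obtain rfl : F' = F := hF'
      exact (hk G hGD).1
    -- The worst error of any `h ∈ H_D` is at least its error at `G₀`, which is at least that of the
    -- optimal `h₀`.
    · rw [hworst]
      refine ((hs₀.isOptimal hb ha hF hG₀ hm).2 h (hh F rfl G₀ hG₀D)).trans ?_
      exact le_iSup₂_of_le F rfl (le_iSup₂_of_le G₀ hG₀D le_rfl)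

end main

/-! ### Convexity of the band classes -/

section convexity

variable {V U G₀ G : MatFun T} {t : ℝ}

lemma IsSpectralDensity.mix (h₀ : IsSpectralDensity G₀) (h : IsSpectralDensity G) (ht0 : 0 ≤ t)
    (ht1 : t ≤ 1) : IsSpectralDensity (mix G₀ G t) :=
  (h₀.smul (sub_nonneg.2 ht1)).add (h.smul ht0)

lemma re_mix_apply (i j : Fin T) (θ : ℝ) :
    (mix G₀ G t θ i j).re = (1 - t) * (G₀ θ i j).re + t * (G θ i j).re := by
  simp only [mix, Pi.add_apply, Pi.smul_apply, Matrix.add_apply, Matrix.smul_apply, smul_eq_mul,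
    Complex.add_re, Complex.re_ofReal_mul]

lemma trace_re_mix (θ : ℝ) :
    (mix G₀ G t θ).trace.re = (1 - t) * (G₀ θ).trace.re + t * (G θ).trace.re := by
  simp only [mix, Pi.add_apply, Pi.smul_apply, Matrix.trace_add, Matrix.trace_smul, smul_eq_mul,
    Complex.add_re, Complex.re_ofReal_mul]

lemma bracket_mix (B : Matrix (Fin T) (Fin T) ℂ) (θ : ℝ) :
    bracket B (mix G₀ G t θ) = (1 - t) * bracket B (G₀ θ) + t * bracket B (G θ) := by
  have h : ∑ k, ∑ l, B k l * mix G₀ G t θ k l = ((1 - t : ℝ) : ℂ) * ∑ k, ∑ l, B k l * G₀ θ k l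
      + (t : ℂ) * ∑ k, ∑ l, B k l * G θ k l := by
    simp only [Finset.mul_sum, ← Finset.sum_add_distrib]
    refine Finset.sum_congr rfl fun k _ => Finset.sum_congr rfl fun l _ => ?_
    simp only [mix, Pi.add_apply, Pi.smul_apply, Matrix.add_apply, Matrix.smul_apply, smul_eq_mul]
    ring
  rw [bracket, h, Complex.add_re, Complex.re_ofReal_mul, Complex.re_ofReal_mul]
  rfl

lemma IsSpectralDensity.integrable_trace (h : IsSpectralDensity G) :
    Integrable (fun θ => (G θ).trace.re) freq :=
  (integrable_finsetSum _ fun i _ => h.integrable i i).re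

lemma IsSpectralDensity.integrable_bracket (h : IsSpectralDensity G)
    (B : Matrix (Fin T) (Fin T) ℂ) : Integrable (fun θ => bracket B (G θ)) freq :=
  (integrable_finsetSum _ fun k _ => integrable_finsetSum _ fun l _ =>
    (h.integrable k l).const_mul (B k l)).re

lemma convexComb_mem_Icc {v u x y : ℝ} (ht0 : 0 ≤ t) (ht1 : t ≤ 1) (hx : v ≤ x ∧ x ≤ u)
    (hy : v ≤ y ∧ y ≤ u) : v ≤ (1 - t) * x + t * y ∧ (1 - t) * x + t * y ≤ u :=
  convex_Icc v u hx hy (sub_nonneg.2 ht1) ht0 (sub_add_cancel 1 t)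

lemma integral_convexComb {f g : ℝ → ℝ} (hf : Integrable f freq) (hg : Integrable g freq) {q : ℝ}
    (hfq : ∫ θ, f θ ∂freq = q) (hgq : ∫ θ, g θ ∂freq = q) :
    ∫ θ, ((1 - t) * f θ + t * g θ) ∂freq = q := by
  rw [integral_add (hf.const_mul _) (hg.const_mul _), integral_const_mul, integral_const_mul, hfq,
    hgq]
  ring

/-- The band and the moment condition both concern a real-linear functional of `G`: an interval is
convex, and equal means are kept. -/
lemma mix_mem_band1 {q : ℝ} (h₀ : G₀ ∈ band1 V U q) (h : G ∈ band1 V U q) (ht0 : 0 ≤ t)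
    (ht1 : t ≤ 1) : mix G₀ G t ∈ band1 V U q := by
  refine ⟨h₀.1.mix h.1 ht0 ht1, ?_, ?_⟩
  · filter_upwards [h₀.2.1, h.2.1] with θ h1 h2
    rw [trace_re_mix]
    exact convexComb_mem_Icc ht0 ht1 h1 h2
  · simp only [trace_re_mix]
    exact integral_convexComb h₀.1.integrable_trace h.1.integrable_trace h₀.2.2 h.2.2

lemma mix_mem_band2 {q : Fin T → ℝ} (h₀ : G₀ ∈ band2 V U q) (h : G ∈ band2 V U q) (ht0 : 0 ≤ t)
    (ht1 : t ≤ 1) : mix G₀ G t ∈ band2 V U q := by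
  refine ⟨h₀.1.mix h.1 ht0 ht1, fun k => ⟨?_, ?_⟩⟩
  · filter_upwards [(h₀.2 k).1, (h.2 k).1] with θ h1 h2
    rw [re_mix_apply]
    exact convexComb_mem_Icc ht0 ht1 h1 h2
  · simp only [re_mix_apply]
    exact integral_convexComb (h₀.1.integrable k k).re (h.1.integrable k k).re (h₀.2 k).2
      (h.2 k).2

lemma mix_mem_band3 {B : Matrix (Fin T) (Fin T) ℂ} {q : ℝ} (h₀ : G₀ ∈ band3 V U B q)
    (h : G ∈ band3 V U B q) (ht0 : 0 ≤ t) (ht1 : t ≤ 1) : mix G₀ G t ∈ band3 V U B q := by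
  refine ⟨h₀.1.mix h.1 ht0 ht1, ?_, ?_⟩
  · filter_upwards [h₀.2.1, h.2.1] with θ h1 h2
    rw [bracket_mix]
    exact convexComb_mem_Icc ht0 ht1 h1 h2
  · simp only [bracket_mix]
    exact integral_convexComb (h₀.1.integrable_bracket B) (h.1.integrable_bracket B) h₀.2.2 h.2.2

/-- The matrix order is handled through the convex cone of positive semidefinite matrices, since
`mix - V` and `U - mix` are the corresponding combinations of the differences. -/
lemma mix_mem_band4 {Q : Matrix (Fin T) (Fin T) ℂ} (h₀ : G₀ ∈ band4 V U Q) (h : G ∈ band4 V U Q)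
    (ht0 : 0 ≤ t) (ht1 : t ≤ 1) : mix G₀ G t ∈ band4 V U Q := by
  have hs0 : (0 : ℂ) ≤ ((1 - t : ℝ) : ℂ) := Complex.zero_le_real.2 (sub_nonneg.2 ht1)
  have hs1 : (0 : ℂ) ≤ (t : ℂ) := Complex.zero_le_real.2 ht0
  refine ⟨h₀.1.mix h.1 ht0 ht1, ?_, fun i j => ?_⟩
  · filter_upwards [h₀.2.1, h.2.1] with θ h1 h2
    refine ⟨?_, ?_⟩
    · convert (h1.1.smul hs0).add (h2.1.smul hs1) using 1
      simp only [mix, Pi.add_apply, Pi.smul_apply, Complex.ofReal_sub, Complex.ofReal_one]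
      module
    · convert (h1.2.smul hs0).add (h2.2.smul hs1) using 1
      simp only [mix, Pi.add_apply, Pi.smul_apply, Complex.ofReal_sub, Complex.ofReal_one]
      module
  · simp only [mix, Pi.add_apply, Pi.smul_apply, Matrix.add_apply, Matrix.smul_apply, smul_eq_mul]
    rw [integral_add ((h₀.1.integrable i j).const_mul _) ((h.1.integrable i j).const_mul _),
      integral_const_mul, integral_const_mul, h₀.2.2, h.2.2, Complex.ofReal_sub,
      Complex.ofReal_one]
    ring

end convexity

end Filtering

end

theorem corollary7 {T s : ℕ} (M N : Fin s → ℕ) (a : ℤ → Fin T → ℂ)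
    (ha : SummableCoeff (missing M N) a)
    (F V U : MatFun T) (hF : IsSpectralDensity F) (hV : IsSpectralDensity V)
    (hU : IsSpectralDensity U) (G₀ : MatFun T) (hmin : IsMinimal (F + G₀)) :
    (∀ q : ℝ,
      SolvesExtremal (missing M N) a {F} (band1 V U q) F G₀ →
      Satisfies (missing M N) a F G₀ (Relation1 F G₀ V U) →
      MinimaxSolution (missing M N) a F (band1 V U q) G₀) ∧
    (∀ q : Fin T → ℝ,
      SolvesExtremal (missing M N) a {F} (band2 V U q) F G₀ →
      Satisfies (missing M N) a F G₀ (Relation2 F G₀ V U) →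
      MinimaxSolution (missing M N) a F (band2 V U q) G₀) ∧
    (∀ (B₂ : Matrix (Fin T) (Fin T) ℂ) (q : ℝ), B₂.PosDef →
      SolvesExtremal (missing M N) a {F} (band3 V U B₂ q) F G₀ →
      Satisfies (missing M N) a F G₀ (Relation3 F G₀ V U B₂) →
      MinimaxSolution (missing M N) a F (band3 V U B₂ q) G₀) ∧
    (∀ Q : Matrix (Fin T) (Fin T) ℂ, Q.PosDef →
      SolvesExtremal (missing M N) a {F} (band4 V U Q) F G₀ →
      Satisfies (missing M N) a F G₀ (Relation4 F G₀ V U) →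
      MinimaxSolution (missing M N) a F (band4 V U Q) G₀) := by
  obtain ⟨b, hb⟩ := exists_lower_bound_missing M N
  -- Each class enters through two facts: its members are spectral densities, and it contains the
  -- segment from `G₀` to each of its members.
  refine ⟨fun q hext _ => ?_, fun q hext _ => ?_, fun B q _ hext _ => ?_, fun Q _ hext _ => ?_⟩ <;>
    refine minimaxSolution_of_solvesExtremal hb ha hF hmin (fun G h => h.1)
      (fun h₀ G h t ht0 ht1 => ?_) hext
  · exact mix_mem_band1 h₀ h ht0.le ht1.le
  · exact mix_mem_band2 h₀ h ht0.le ht1.le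
  · exact mix_mem_band3 h₀ h ht0.le ht1.le
  · exact mix_mem_band4 h₀ h ht0.le ht1.le
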